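/- **Setting.** Let $M$ be a smooth manifold of dimension $d+1\ge 2$ (spacetime). The dynamical fields $\phi$ are smooth sections of a natural vector bundle over $M$ (associated with the frame bundle by a smooth finite-dimensional representation of $GL(d+1,\mathbb R)$), with values in an invariant open subset, e.g. a Lorentzian metric together with tensor fields. They form the field space $\mathscr F$; its tangent vectors (variations) $V$ are smooth sections of the bundle, and functions and forms on $\mathscr F$ are assumed smooth along smooth finite-dimensional families of fields. $\delta$ is the exterior derivative and $I_V$ the contraction on $\mathscr F$; $d$, $i_\xi$, $\pounds_\xi$ act on spacetime forms. A possibly field-dependent smooth vector field $\xi=\xi[\phi]$ on $M$ generates the vector field $\hat\xi$ on $\mathscr F$ with $I_{\hat\xi}\delta\phi=\pounds_\xi\phi$; on field-space forms put $L_{\hat\xi}=I_{\hat\xi}\delta+\delta I_{\hat\xi}$ and define the anomaly operator $\Delta_{\hat\xi}=L_{\hat\xi}-\pounds_\xi-I_{\widehat{\delta\xi}}$, where $(I_{\widehat{\delta\xi}}\theta)(V)=\theta(\pounds_{\delta\xi(V)}\phi)$ on field-space one-forms and $I_{\widehat{\delta\xi}}=0$ on zero-forms. Let $U\subseteq M$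 be open. Let $L'$ (a spacetime $(d+1)$-form) and $b'$ (a $d$-form) be field-space zero-forms and let $\theta'$ (a $d$-form) and $\lambda'$ (a $(d-1)$-form) be field-space one-forms, none of them assumed covariant, such that on $U$ $$\delta L'=E\cdot\delta\phi+d\theta',\qquad \Delta_{\hat\zeta}L'=d\Delta_{\hat\zeta}b',\qquad \Delta_{\hat\zeta}\theta'=\Delta_{\hat\zeta}\delta b'+d\Delta_{\hat\zeta}\lambda'$$ for all field-dependent vector fields $\zeta$. Let $\mathscr S=\{\phi\in\mathscr F: E[\phi]=0\text{ on }U\}$ (no boundary conditions), whose tangent vectors are the velocities of smooth curves of fields in $\mathscr S$, and let $\omega'=\delta\theta'$. Put $\theta^c=\theta'-\delta b'-d\lambda'$ and $L^c=L'-db'$. Let $Q_\zeta$ be any spacetime $(d-1)$-form depending smoothly on a vector field $\zeta$ and on $\phi$ that is a Noether potential, i.e. $I_{\hat\zeta}\theta^c-i_\zeta L^c=dQ_\zeta$ on $U$ for all $\phi\in\mathscr S$ and all field-independent $\zeta$, and put $$Q'_\zeta=Q_\zeta+i_\zeta b'+I_{\hat\zeta}\lambda'.$$ For field-dependent $\xi$,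 $Q'_\xi$ is evaluated at $\zeta=\xi[\phi]$, and $Q'_{\delta\xi}(V)=Q'_{\delta\xi(V)}$. **Claim 1 (generalized Iyer–Wald identity).** For every smooth field-dependent vector field $\xi$ on $M$, on $\overline U$, at every $\phi\in\mathscr S$ and on every tangent vector of $\mathscr S$ at $\phi$, $$-I_{\hat\xi}\omega'=d\big(\delta Q'_\xi-Q'_{\delta\xi}-i_\xi\theta'-\Delta_{\hat\xi}\lambda'\big).$$ **Boundary.** Let $N$ be a smooth $d$-dimensional manifold with a smooth injective map $N\to M$ (e.g. the inclusion of a timelike or null component of $\partial U$) and suppose that on $\mathscr S$ the pullback of $\theta'$ to $N$ decomposes as $$\underline{\theta'}=-\delta\ell'+d\beta'+\mathcal E,$$ where $\ell'$ is a field-space zero-form and $\beta',\mathcal E$ are field-space one-forms, with values in forms on $N$ of degrees $d$, $d-1$, $d$. Let $\xi$ be tangent to $N$, i.e. it is induced by a smooth field-dependent vector field on $N$. Let $\Sigma$ be a smooth cubical $d$-chain in $\overline U$ (e.g. a compact oriented hypersurface, subdivided into cubes) whose boundary $\partial\Sigma$ is the image of a chain in $N$. All quantities integrated over $\partial\Sigma$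 are forms on $N$ ($Q'$ and $\lambda'$ are pulled back to $N$). Define $$\Omega=\int_\Sigma\omega'-\int_{\partial\Sigma}\delta\beta',\qquad h_\zeta=Q'_\zeta+i_\zeta\ell'-I_{\hat\zeta}\beta',\qquad H_\xi=\int_{\partial\Sigma}h_\xi,$$ $$\mathcal F_{\hat\xi}=\int_{\partial\Sigma}\big(i_\xi\mathcal E-\Delta_{\hat\xi}(\beta'-\lambda')+h_{\delta\xi}\big).$$ **Claim 2 (localized charges and the modified Hamilton equation).** At every $\phi\in\mathscr S$ and on every tangent vector of $\mathscr S$ at $\phi$, $$-I_{\hat\xi}\Omega=\int_{\partial\Sigma}\delta h_\xi-\int_{\partial\Sigma}\big(i_\xi\mathcal E-\Delta_{\hat\xi}(\beta'-\lambda')+h_{\delta\xi}\big),\qquad \delta H_\xi=-I_{\hat\xi}\Omega+\mathcal F_{\hat\xi}.$$ -/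

import Mathlib

open scoped ContDiff Manifold
open Set

namespace CovariantPhaseSpace

noncomputable section

/-! ### Differential forms and vector fields on a manifold

`X` is a boundaryless smooth manifold modelled on `E`. As in Mathlib, the tangent space at `x` is
`E`, identified through the preferred chart `chartAt E x`. A `k`-form is a map
`α : X → E [⋀^Fin k]→L[ℝ] ℝ` and a vector field is a map `ξ : X → E`, with `α x` and `ξ x`
expressed in this frame at `x`. -/

section Forms

variable {E : Type*} [NormedAddCommGroup E] [NormedSpace ℝ E]
  {X : Type*} [TopologicalSpace X] [ChartedSpace E X] [IsManifold 𝓘(ℝ, E) ∞ X]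

/-- The representative of a vector field in the preferred chart at `x₀`. -/
def vecInChart (ξ : X → E) (x₀ : X) (u : E) : E :=
  tangentCoordChange 𝓘(ℝ, E) ((chartAt E x₀).symm u) x₀ ((chartAt E x₀).symm u)
    (ξ ((chartAt E x₀).symm u))

/-- The representative of a differential form in the preferred chart at `x₀`. -/
def formInChart {k : ℕ} (α : X → E [⋀^Fin k]→L[ℝ] ℝ) (x₀ : X) (u : E) : E [⋀^Fin k]→L[ℝ] ℝ :=
  (α ((chartAt E x₀).symm u)).compContinuousLinearMap
    (tangentCoordChange 𝓘(ℝ, E) x₀ ((chartAt E x₀).symm u) ((chartAt E x₀).symm u))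

/-- A family of vector fields that is jointly smooth in the parameter and the point. -/
def SmoothVecFamily {P : Type*} [NormedAddCommGroup P] [NormedSpace ℝ P] (ξ : P → X → E) : Prop :=
  ∀ x₀ : X, ContDiffOn ℝ ∞ (fun q : P × E => vecInChart (ξ q.1) x₀ q.2)
    (univ ×ˢ (chartAt E x₀).target)

/-- A family of differential forms that is jointly smooth in the parameter and the point. -/
def SmoothFormFamily {P : Type*} [NormedAddCommGroup P] [NormedSpace ℝ P] {k : ℕ}
    (α : P → X → E [⋀^Fin k]→L[ℝ] ℝ) : Prop :=
  ∀ x₀ : X, ContDiffOn ℝ ∞ (fun q : P × E => formInChart (α q.1) x₀ q.2)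
    (univ ×ˢ (chartAt E x₀).target)

/-- A smooth vector field. -/
def IsSmoothVec (ξ : X → E) : Prop := SmoothVecFamily fun _ : ℝ => ξ

/-- The exterior derivative `d` on spacetime, computed at `x` in the preferred chart at `x`. -/
def dForm {k : ℕ} (α : X → E [⋀^Fin k]→L[ℝ] ℝ) (x : X) : E [⋀^Fin (k + 1)]→L[ℝ] ℝ :=
  extDeriv (formInChart α x) (chartAt E x x)

/-- The interior product `i_ξ`. -/
def iForm {k : ℕ} (ξ : X → E) (α : X → E [⋀^Fin (k + 1)]→L[ℝ] ℝ) (x : X) : E [⋀^Fin k]→L[ℝ] ℝ :=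
  (α x).curryLeft (ξ x)

/-- The Lie derivative `£_ξ = d i_ξ + i_ξ d` of differential forms. -/
def lieForm : {k : ℕ} → (X → E) → (X → E [⋀^Fin k]→L[ℝ] ℝ) → X → E [⋀^Fin k]→L[ℝ] ℝ
  | 0, ξ, α => iForm ξ (dForm α)
  | _ + 1, ξ, α => dForm (iForm ξ α) + iForm ξ (dForm α)

variable {E' : Type*} [NormedAddCommGroup E'] [NormedSpace ℝ E']
  {Y : Type*} [TopologicalSpace Y] [ChartedSpace E' Y]

/-- The pullback of a differential form along `f : Y → X`. -/
def pullForm {k : ℕ} (f : Y → X) (α : X → E [⋀^Fin k]→L[ℝ] ℝ) (y : Y) : E' [⋀^Fin k]→L[ℝ] ℝ :=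
  (α (f y)).compContinuousLinearMap
    (show E' →L[ℝ] E from mfderiv 𝓘(ℝ, E') 𝓘(ℝ, E) f y)

end Forms

/-! ### Smooth cubical chains and integration -/

section Chains

/-- Extension of a map on the unit cube to `ℝᵏ`, by clamping all the coordinates to `[0, 1]`. -/
def clampExt {X : Type*} {k : ℕ} (σ : (Fin k → unitInterval) → X) (u : Fin k → ℝ) : X :=
  σ fun i => projIcc 0 1 zero_le_one (u i)

theorem clampExt_insertNth {X : Type*} {k : ℕ} (σ : (Fin (k + 1) → unitInterval) → X)
    (i : Fin (k + 1))
    (e : unitInterval) (u : Fin k → ℝ) :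
    clampExt (fun v => σ (Fin.insertNth (α := fun _ => unitInterval) i e v)) u =
      clampExt σ (Fin.insertNth (α := fun _ => ℝ) i (e : ℝ) u) := by
  refine congrArg σ (funext fun j => ?_)
  refine Fin.succAboveCases i ?_ ?_ j
  · simp [projIcc_val]
  · intro j
    simp

variable {E : Type*} [NormedAddCommGroup E] [NormedSpace ℝ E]
  {X : Type*} [TopologicalSpace X] [ChartedSpace E X]

variable (E X) in
/-- A smooth singular `k`-cube in `X`: a map `[0, 1]ᵏ → X` that is smooth up to the boundary. -/
@[ext]
structure SmoothCube (k : ℕ) where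
  toFun : (Fin k → unitInterval) → X
  smooth : ContMDiffOn 𝓘(ℝ, Fin k → ℝ) 𝓘(ℝ, E) ∞ (clampExt toFun) (Icc 0 1)

/-- The face of a cube on which the `i`-th coordinate equals `e` (for `e = 0` or `e = 1`). -/
def SmoothCube.face {k : ℕ} (σ : SmoothCube E X (k + 1)) (i : Fin (k + 1)) (e : unitInterval) :
    SmoothCube E X k where
  toFun v := σ.toFun (Fin.insertNth (α := fun _ => unitInterval) i e v)
  smooth := by
    have h1 : ContDiff ℝ ∞
        (fun u : Fin k → ℝ => (Fin.insertNth (α := fun _ => ℝ) i (e : ℝ) u : Fin (k + 1) → ℝ)) := by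
      rw [contDiff_pi]
      intro j
      refine Fin.succAboveCases i ?_ ?_ j
      · simpa using contDiff_const
      · intro j
        simpa using contDiff_apply ℝ ℝ j
    have h2 := σ.smooth.comp (t := Icc 0 1) (s := Icc (0 : Fin k → ℝ) 1)
      (f := fun u : Fin k → ℝ => (Fin.insertNth (α := fun _ => ℝ) i (e : ℝ) u : Fin (k + 1) → ℝ))
      h1.contMDiff.contMDiffOn (by
        intro u hu
        constructor
        · intro j
          refine Fin.succAboveCases i ?_ ?_ j
          · simpa using e.2.1
          · intro j
            simpa using hu.1 j
        · intro j
          refine Fin.succAboveCases i ?_ ?_ j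
          · simpa using e.2.2
          · intro j
            simpa using hu.2 j)
    refine h2.congr ?_
    intro u _
    exact clampExt_insertNth σ.toFun i e u

/-- A smooth cubical `k`-chain: a formal integer combination of smooth `k`-cubes. -/
abbrev Chain (E X : Type*) [NormedAddCommGroup E] [NormedSpace ℝ E] [TopologicalSpace X]
    [ChartedSpace E X] (k : ℕ) := SmoothCube E X k →₀ ℤ

/-- The boundary `∂ σ = ∑ i, (-1) ^ i (σ|_{uᵢ = 1} - σ|_{uᵢ = 0})`, extended to chains. -/
def Chain.boundary {k : ℕ} (c : Chain E X (k + 1)) : Chain E X k :=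
  c.sum fun σ m => m • ∑ i : Fin (k + 1),
    (-1 : ℤ) ^ (i : ℕ) • (Finsupp.single (σ.face i 1) (1 : ℤ) - Finsupp.single (σ.face i 0) (1 : ℤ))

/-- The integral of a `k`-form over a smooth `k`-cube. -/
def cubeIntegral {k : ℕ} (α : X → E [⋀^Fin k]→L[ℝ] ℝ) (σ : SmoothCube E X k) : ℝ :=
  ∫ u in Icc (0 : Fin k → ℝ) 1, α (clampExt σ.toFun u) fun i =>
    (show E from mfderivWithin 𝓘(ℝ, Fin k → ℝ) 𝓘(ℝ, E) (clampExt σ.toFun) (Icc 0 1) u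
      (Pi.single i (1 : ℝ) : Fin k → ℝ))

/-- The integral of a `k`-form over a smooth cubical `k`-chain. -/
def chainIntegral {k : ℕ} (c : Chain E X k) (α : X → E [⋀^Fin k]→L[ℝ] ℝ) : ℝ :=
  c.sum fun σ m => (m : ℝ) * cubeIntegral α σ

/-- All cubes of the chain lie in the set `s`. -/
def Chain.LiesIn {k : ℕ} (c : Chain E X k) (s : Set X) : Prop :=
  ∀ σ ∈ c.support, range σ.toFun ⊆ s

variable {E' : Type*} [NormedAddCommGroup E'] [NormedSpace ℝ E']
  {Y : Type*} [TopologicalSpace Y] [ChartedSpace E' Y]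

/-- The image of a smooth cube under a smooth map. -/
def SmoothCube.map {k : ℕ} {f : Y → X} (hf : ContMDiff 𝓘(ℝ, E') 𝓘(ℝ, E) ∞ f)
    (σ : SmoothCube E' Y k) : SmoothCube E X k where
  toFun v := f (σ.toFun v)
  smooth := hf.comp_contMDiffOn σ.smooth

/-- The image of a smooth chain under a smooth map. -/
def Chain.map {k : ℕ} {f : Y → X} (hf : ContMDiff 𝓘(ℝ, E') 𝓘(ℝ, E) ∞ f) (c : Chain E' Y k) :
    Chain E X k :=
  c.mapDomain (SmoothCube.map hf)

end Chains

/-! ### Dynamical fields -/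

/-- The type of a collection of dynamical fields: a smooth representation `rep` of `GL(E)` on the
value space `W` (it says how field values change under a change of frame of the tangent space) and
an invariant open set `dom` of admissible values. For a metric together with tensorial matter
fields, `W = Sym² E* ⊕ ⨁ᵢ E^{⊗ rᵢ} ⊗ (E*)^{⊗ sᵢ}`, `rep` is the tensor representation and `dom`
consists of the values whose first component is nondegenerate of Lorentzian signature. Only the
values of `rep` at invertible maps matter. -/
structure FieldType (E W : Type*) [NormedAddCommGroup E] [NormedSpace ℝ E]
    [NormedAddCommGroup W] [NormedSpace ℝ W] where
  rep : (E →L[ℝ] E) → (W →L[ℝ] W)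
  rep_one : rep 1 = 1
  rep_mul : ∀ A B : E →L[ℝ] E, IsUnit A → IsUnit B → rep (A * B) = rep A * rep B
  rep_smooth : ContDiffOn ℝ ∞ rep {A | IsUnit A}
  dom : Set W
  dom_open : IsOpen dom
  dom_invariant : ∀ A : E →L[ℝ] E, IsUnit A → ∀ w ∈ dom, rep A w ∈ dom

section Fields

variable {E : Type*} [NormedAddCommGroup E] [NormedSpace ℝ E]
  {W : Type*} [NormedAddCommGroup W] [NormedSpace ℝ W]
  {M : Type*} [TopologicalSpace M] [ChartedSpace E M] [IsManifold 𝓘(ℝ, E) ∞ M]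
  (τ : FieldType E W)

/-- The representative of a field in the preferred chart at `x₀`. -/
def fieldInChart (φ : M → W) (x₀ : M) (u : E) : W :=
  τ.rep (tangentCoordChange 𝓘(ℝ, E) ((chartAt E x₀).symm u) x₀ ((chartAt E x₀).symm u))
    (φ ((chartAt E x₀).symm u))

/-- A family of fields (sections) that is jointly smooth in the parameter and the point. -/
def SmoothFieldFamily {P : Type*} [NormedAddCommGroup P] [NormedSpace ℝ P] (φ : P → M → W) : Prop :=
  ∀ x₀ : M, ContDiffOn ℝ ∞ (fun q : P × E => fieldInChart τ (φ q.1) x₀ q.2)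
    (univ ×ˢ (chartAt E x₀).target)

/-- A smooth family of field configurations, that is, a smooth map from `P` to the field space. -/
def ConfigFamily {P : Type*} [NormedAddCommGroup P] [NormedSpace ℝ P] (φ : P → M → W) : Prop :=
  SmoothFieldFamily τ φ ∧ ∀ s x, φ s x ∈ τ.dom

/-- A tangent vector to the field space: a smooth field variation. -/
def IsVariation (V : M → W) : Prop := SmoothFieldFamily τ fun _ : ℝ => V

/-- The field space `𝓕`: smooth fields with admissible values. -/
def fieldSpace : Set (M → W) := {φ | ConfigFamily τ fun _ : ℝ => φ}

/-- The Lie derivative `£_ξ φ` of a field, computed at `x` in the preferred chart at `x`: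
`(£_ξ φ)(x) = Dφ(ξ) - rep'(Dξ) φ`, where `rep'` is the derivative of `rep` at the identity. -/
def lieField (ξ : M → E) (φ : M → W) (x : M) : W :=
  fderiv ℝ (fieldInChart τ φ x) (chartAt E x x) (ξ x)
    - fderiv ℝ τ.rep 1 (fderiv ℝ (vecInChart ξ x) (chartAt E x x)) (φ x)

/-- `c` is a smooth curve in the field space through `φ` with velocity `V`. -/
def IsCurve (c : ℝ → M → W) (φ V : M → W) : Prop :=
  ConfigFamily τ c ∧ c 0 = φ ∧ ∀ x, HasDerivAt (fun t => c t x) (V x) 0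

/-- The derivative of a function `f` on field space at `φ` along the tangent vector `V`: the common
value of `(d/dt) f (c t)` at `t = 0` for all smooth curves `c` through `φ` with velocity `V`. -/
def vary {A : Type*} [NormedAddCommGroup A] [NormedSpace ℝ A] (f : (M → W) → A) (φ V : M → W) : A :=
  Classical.epsilon fun a => ∀ c : ℝ → M → W, IsCurve τ c φ V → HasDerivAt (fun t => f (c t)) a 0

/-! ### Field-space forms

`X` is the manifold (spacetime itself, or a hypersurface) on which the values live. A field-space
`0`-form `α` sends a configuration `φ` to a spacetime form `α φ`; a field-space `1`-form `θ` sends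
`φ` and a variation `V` to `θ φ V`; a field-space `2`-form sends `φ`, `U`, `V` to `Θ φ U V`.
Smoothness is meant along smooth finite-dimensional families. -/

variable {F : Type*} [NormedAddCommGroup F] [NormedSpace ℝ F]
  {X : Type*} [TopologicalSpace X] [ChartedSpace F X] [IsManifold 𝓘(ℝ, F) ∞ X] {k : ℕ}

/-- Smooth field-space `0`-forms with values in spacetime `k`-forms. -/
def IsZeroForm (α : (M → W) → X → F [⋀^Fin k]→L[ℝ] ℝ) : Prop :=
  ∀ (P : Type) [NormedAddCommGroup P] [NormedSpace ℝ P] [FiniteDimensional ℝ P] (c : P → M → W),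
    ConfigFamily τ c → SmoothFormFamily fun s => α (c s)

/-- Smooth field-space `1`-forms with values in spacetime `k`-forms. -/
def IsOneForm (θ : (M → W) → (M → W) → X → F [⋀^Fin k]→L[ℝ] ℝ) : Prop :=
  (∀ φ ∈ fieldSpace τ, ∀ V₁ V₂ : M → W, IsVariation τ V₁ → IsVariation τ V₂ → ∀ a b : ℝ,
    θ φ (a • V₁ + b • V₂) = a • θ φ V₁ + b • θ φ V₂) ∧
  ∀ (P : Type) [NormedAddCommGroup P] [NormedSpace ℝ P] [FiniteDimensional ℝ P]
    (c V : P → M → W), ConfigFamily τ c → SmoothFieldFamily τ V →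
      SmoothFormFamily fun s => θ (c s) (V s)

/-- Smooth field-dependent vector fields on `X`. -/
def IsFieldVec (ξ : (M → W) → X → F) : Prop :=
  ∀ (P : Type) [NormedAddCommGroup P] [NormedSpace ℝ P] [FiniteDimensional ℝ P] (c : P → M → W),
    ConfigFamily τ c → SmoothVecFamily fun s => ξ (c s)

/-- The field-space exterior derivative `δ` of a field-space `0`-form. -/
def delta0 (α : (M → W) → X → F [⋀^Fin k]→L[ℝ] ℝ) (φ V : M → W) (x : X) : F [⋀^Fin k]→L[ℝ] ℝ :=
  vary τ (fun ψ => α ψ x) φ V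

/-- The field-space exterior derivative `δ` of a field-space `1`-form:
`(δθ)(U, V) = U(θ(V)) - V(θ(U))` for variations `U`, `V` that do not depend on the fields. -/
def delta1 (θ : (M → W) → (M → W) → X → F [⋀^Fin k]→L[ℝ] ℝ) (φ U V : M → W) (x : X) :
    F [⋀^Fin k]→L[ℝ] ℝ :=
  vary τ (fun ψ => θ ψ V x) φ U - vary τ (fun ψ => θ ψ U x) φ V

/-- The variation `δξ` of a field-dependent vector field. -/
def deltaVec (ξ : (M → W) → X → F) (φ V : M → W) (x : X) : F :=
  vary τ (fun ψ => ξ ψ x) φ V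

/-- The vector field `ξ̂` on field space generated by `ξ`, that is, `I_ξ̂ δφ = £_ξ φ`. -/
def hat (ξ : (M → W) → M → E) (φ : M → W) : M → W := lieField τ (ξ φ) φ

/-- The contraction `I_ξ̂ θ` of a field-space `1`-form. -/
def contr1 (ξ : (M → W) → M → E) (θ : (M → W) → (M → W) → X → F [⋀^Fin k]→L[ℝ] ℝ) (φ : M → W) :
    X → F [⋀^Fin k]→L[ℝ] ℝ := θ φ (hat τ ξ φ)

/-- The contraction `I_ξ̂ Θ` of a field-space `2`-form. -/
def contr2 (ξ : (M → W) → M → E) (Θ : (M → W) → (M → W) → (M → W) → X → F [⋀^Fin k]→L[ℝ] ℝ)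
    (φ V : M → W) : X → F [⋀^Fin k]→L[ℝ] ℝ := Θ φ (hat τ ξ φ) V

/-- The contraction `I_{δξ^}` of a field-space `1`-form with the vector-valued one-form
`V ↦ £_{δξ(V)} φ` on field space. -/
def contrDelta (ξ : (M → W) → M → E) (θ : (M → W) → (M → W) → X → F [⋀^Fin k]→L[ℝ] ℝ)
    (φ V : M → W) : X → F [⋀^Fin k]→L[ℝ] ℝ := θ φ (lieField τ (deltaVec τ ξ φ V) φ)

/-- The field-space Lie derivative `L_ξ̂ = I_ξ̂ δ` of a field-space `0`-form. -/
def lieFS0 (ξ : (M → W) → M → E) (α : (M → W) → X → F [⋀^Fin k]→L[ℝ] ℝ) :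
    (M → W) → X → F [⋀^Fin k]→L[ℝ] ℝ := contr1 τ ξ (delta0 τ α)

/-- The field-space Lie derivative `L_ξ̂ = I_ξ̂ δ + δ I_ξ̂` of a field-space `1`-form. -/
def lieFS1 (ξ : (M → W) → M → E) (θ : (M → W) → (M → W) → X → F [⋀^Fin k]→L[ℝ] ℝ)
    (φ V : M → W) : X → F [⋀^Fin k]→L[ℝ] ℝ :=
  contr2 τ ξ (delta1 τ θ) φ V + delta0 τ (contr1 τ ξ θ) φ V

/-- The anomaly operator `Δ_ξ̂ = L_ξ̂ - £_ξ` on field-space `0`-forms. Here `ξX` is the vector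
field on `X` that `ξ` induces: `ξ` itself for spacetime forms, and the restriction of `ξ` for forms
on a hypersurface to which `ξ` is tangent. -/
def anomaly0 (ξ : (M → W) → M → E) (ξX : (M → W) → X → F)
    (α : (M → W) → X → F [⋀^Fin k]→L[ℝ] ℝ) (φ : M → W) : X → F [⋀^Fin k]→L[ℝ] ℝ :=
  lieFS0 τ ξ α φ - lieForm (ξX φ) (α φ)

/-- The anomaly operator `Δ_ξ̂ = L_ξ̂ - £_ξ - I_{δξ^}` on field-space `1`-forms. -/
def anomaly1 (ξ : (M → W) → M → E) (ξX : (M → W) → X → F)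
    (θ : (M → W) → (M → W) → X → F [⋀^Fin k]→L[ℝ] ℝ) (φ V : M → W) : X → F [⋀^Fin k]→L[ℝ] ℝ :=
  lieFS1 τ ξ θ φ V - lieForm (ξX φ) (θ φ V) - contrDelta τ ξ θ φ V

/-- The solution space `𝓢` of the region `U`: configurations that satisfy the field equations
`EL = 0` in `U`; no boundary conditions are imposed. -/
def solutionSpace (EL : (M → W) → M → W →L[ℝ] E [⋀^Fin k]→L[ℝ] ℝ) (U : Set M) : Set (M → W) :=
  {φ | φ ∈ fieldSpace τ ∧ ∀ x ∈ U, EL φ x = 0}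

/-- `V` is tangent to `S` at `φ`: it is the velocity of a smooth curve of fields that stays
in `S`. -/
def IsTangent (S : Set (M → W)) (φ V : M → W) : Prop :=
  ∃ c : ℝ → M → W, IsCurve τ c φ V ∧ ∀ t, c t ∈ S

/-! ### Covariant Lagrangian, Noether potential, symplectic form, charges and fluxes -/

/-- The Noether current `J_ζ = I_ζ̂ θᶜ - i_ζ Lᶜ` of the covariant Lagrangian `Lᶜ = L' - db'` and
the covariant symplectic potential `θᶜ = θ' - δb' - dλ'`. -/
def covCurrent (L : (M → W) → M → E [⋀^Fin (k + 2)]→L[ℝ] ℝ)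
    (θ : (M → W) → (M → W) → M → E [⋀^Fin (k + 1)]→L[ℝ] ℝ)
    (b : (M → W) → M → E [⋀^Fin (k + 1)]→L[ℝ] ℝ)
    (lam : (M → W) → (M → W) → M → E [⋀^Fin k]→L[ℝ] ℝ)
    (ζ : M → E) (φ : M → W) : M → E [⋀^Fin (k + 1)]→L[ℝ] ℝ :=
  (θ φ (lieField τ ζ φ) - delta0 τ b φ (lieField τ ζ φ) - dForm (lam φ (lieField τ ζ φ)))
    - iForm ζ (L φ - dForm (b φ))

/-- Smooth dependence of a potential `Q_ζ[φ]` on the vector field `ζ` and the field `φ`. -/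
def IsSmoothPotential (Q : (M → E) → (M → W) → M → E [⋀^Fin k]→L[ℝ] ℝ) : Prop :=
  ∀ (P : Type) [NormedAddCommGroup P] [NormedSpace ℝ P] [FiniteDimensional ℝ P]
    (Z : P → M → E) (c : P → M → W), SmoothVecFamily Z → ConfigFamily τ c →
      SmoothFormFamily fun s => Q (Z s) (c s)

/-- The potential `Q'_ζ = Q_ζ + i_ζ b' + I_ζ̂ λ'`. -/
def potential (Q : (M → E) → (M → W) → M → E [⋀^Fin k]→L[ℝ] ℝ)
    (b : (M → W) → M → E [⋀^Fin (k + 1)]→L[ℝ] ℝ)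
    (lam : (M → W) → (M → W) → M → E [⋀^Fin k]→L[ℝ] ℝ)
    (ζ : M → E) (φ : M → W) : M → E [⋀^Fin k]→L[ℝ] ℝ :=
  Q ζ φ + iForm ζ (b φ) + lam φ (lieField τ ζ φ)

/-- The charge density `h_ζ = Q'_ζ + i_ζ ℓ' - I_ζ̂ β'` on the hypersurface `f : X → M`; here `ζX`
is the vector field on the hypersurface induced by `ζ`, and `Q'` is pulled back. -/
def chargeDensity (f : X → M) (Q' : (M → E) → (M → W) → M → E [⋀^Fin k]→L[ℝ] ℝ)
    (l : (M → W) → X → F [⋀^Fin (k + 1)]→L[ℝ] ℝ)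
    (β : (M → W) → (M → W) → X → F [⋀^Fin k]→L[ℝ] ℝ)
    (ζ : M → E) (ζX : X → F) (φ : M → W) : X → F [⋀^Fin k]→L[ℝ] ℝ :=
  pullForm f (Q' ζ φ) + iForm ζX (l φ) - β φ (lieField τ ζ φ)

/-- The flux integrand `i_ξ ℰ - Δ_ξ̂ (β' - λ') + h_{δξ}` on the hypersurface `f : X → M`, a
field-space `1`-form; `h` is the charge density. -/
def fluxDensity (f : X → M) (lam : (M → W) → (M → W) → M → E [⋀^Fin k]→L[ℝ] ℝ)
    (β : (M → W) → (M → W) → X → F [⋀^Fin k]→L[ℝ] ℝ)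
    (ℰ : (M → W) → (M → W) → X → F [⋀^Fin (k + 1)]→L[ℝ] ℝ)
    (h : (M → E) → (X → F) → (M → W) → X → F [⋀^Fin k]→L[ℝ] ℝ)
    (ξ : (M → W) → M → E) (ξX : (M → W) → X → F) (φ V : M → W) : X → F [⋀^Fin k]→L[ℝ] ℝ :=
  iForm (ξX φ) (ℰ φ V)
    - anomaly1 τ ξ ξX (fun ψ U => β ψ U - pullForm f (lam ψ U)) φ V
    + h (deltaVec τ ξ φ V) (deltaVec τ ξX φ V) φ

/-- The subregion symplectic form `Ω = ∫_Σ δθ' - ∫_{∂Σ} δβ'`; the cut `∂Σ` is given as a chain `S`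
in the hypersurface `X`. -/
def symplecticForm (θ : (M → W) → (M → W) → M → E [⋀^Fin (k + 1)]→L[ℝ] ℝ)
    (β : (M → W) → (M → W) → X → F [⋀^Fin k]→L[ℝ] ℝ)
    (Sig : Chain E M (k + 1)) (S : Chain F X k) (φ U V : M → W) : ℝ :=
  chainIntegral Sig (delta1 τ θ φ U V) - chainIntegral S (delta1 τ β φ U V)

end Fields

end

end CovariantPhaseSpace

open CovariantPhaseSpace

/-! Claim 1 is the variation of a Noether identity. On solutions, `I_ζ̂ θᶜ - i_ζ Lᶜ = dQ_ζ` holds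
for every fixed `ζ`, hence pointwise in field space with `ζ = ξ[φ]`. Differentiating this along a
curve of solutions and subtracting the same identity with the fixed generator `δξ(V)` removes the
terms caused by the field dependence of `ξ`. Then `δL' = dθ'` on shell, Cartan's formula for `£_ξ
θ'`, `δ² b' = 0`, and the anomaly equation for `θ'`, which is what produces `I_ξ̂ δθ'`, give the
result by linear algebra (`iyerWald_of_mem`). Both sides are smooth spacetime forms, so the equality
passes from `U` to its closure.

For Claim 2 the potential in Claim 1 is pulled back to `N`, where the decomposition of `θ'` replaces
`i_ξ θ'`. Together with `I_ξ̂ δβ'` it equals `δh_ξ` minus the flux density, up to `£_ξ β' - i_ξ dβ'`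
(`pullForm_iyerWaldPotential`). By Cartan this remainder is exact, or zero in degree 0. It
integrates to zero because the cut is closed: its image is a boundary, `∂∂ = 0`, and pushing chains
forward along an injective map is injective. Stokes on chains and differentiation under the integral
finish the argument.

Most of the work makes these manipulations legitimate. Functions on field space are smooth only
along finite-dimensional families, so it must be shown that a derivative depends on the velocity of
the curve alone, that every variation is a velocity, that second variations commute, and that
variations are again smooth. All four come from explicit two-parameter families. Since the
admissible values form only an open set and `M` need not be compact, such a family may leave field
space at once; time is therefore slowed down by a positive function of the point
(`SmoothFieldFamily.exists_cutoff`, `boundedTime`). -/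

namespace CovariantPhaseSpace

/-! ### Smooth dependence of pullback and contraction of alternating maps -/

section AlternatingSmooth

variable {E F : Type*}
  [NormedAddCommGroup E] [NormedSpace ℝ E] [NormedAddCommGroup F] [NormedSpace ℝ F]
  {k : ℕ}

/-- The normalized antisymmetrization, a continuous left inverse of the inclusion of alternating
into multilinear maps. -/
noncomputable def antisymmetrize (F : Type*) [NormedAddCommGroup F] [NormedSpace ℝ F] (k : ℕ) :
    ContinuousMultilinearMap ℝ (fun _ : Fin k => F) ℝ →L[ℝ] F [⋀^Fin k]→L[ℝ] ℝ :=
  LinearMap.mkContinuous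
    { toFun := fun f => ((k.factorial : ℝ)⁻¹) • ContinuousMultilinearMap.alternatization f
      map_add' := by intro f g; simp
      map_smul' := by
        intro c f
        ext v
        simp [ContinuousMultilinearMap.alternatization_apply_apply, Finset.mul_sum]
        refine Finset.sum_congr rfl fun σ _ => ?_
        rw [mul_left_comm, mul_smul_comm, mul_smul_comm, mul_smul_comm] }
    ((k.factorial : ℝ)⁻¹ * k.factorial) fun f => by
      refine ContinuousAlternatingMap.opNorm_le_bound _ (by positivity) fun v => ?_
      simp only [LinearMap.coe_mk, AddHom.coe_mk, ContinuousAlternatingMap.smul_apply,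
        ContinuousMultilinearMap.alternatization_apply_apply, norm_smul, norm_inv]
      rw [Real.norm_natCast, mul_assoc, mul_assoc]
      gcongr
      -- The sum has `k!` terms, each bounded by `‖f‖ ∏ ‖v i‖`; this is the factor `k!` in the
      -- bound.
      refine (norm_sum_le _ _).trans ?_
      refine (Finset.sum_le_card_nsmul _ _ (‖f‖ * ∏ i, ‖v i‖) fun σ _ => ?_).trans ?_
      · have h := f.le_opNorm (v ∘ σ)
        have h2 : ∏ i, ‖(v ∘ σ) i‖ = ∏ i, ‖v i‖ := Equiv.prod_comp σ fun i => ‖v i‖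
        rw [h2] at h
        rcases Int.units_eq_one_or (Equiv.Perm.sign σ) with hs | hs <;> rw [hs] <;>
          simpa using h
      · simp [Finset.card_univ, Fintype.card_perm]

theorem antisymmetrize_apply (f : F [⋀^Fin k]→L[ℝ] ℝ) :
    antisymmetrize F k f.toContinuousMultilinearMap = f := by
  ext v
  simp only [antisymmetrize, LinearMap.mkContinuous_apply, LinearMap.coe_mk, AddHom.coe_mk,
    ContinuousAlternatingMap.smul_apply, ContinuousMultilinearMap.alternatization_apply_apply]
  have : ∀ σ : Equiv.Perm (Fin k), Equiv.Perm.sign σ • f.toContinuousMultilinearMap (v ∘ σ)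
      = f v := by
    intro σ
    have h := f.toAlternatingMap.map_perm v σ
    change Equiv.Perm.sign σ • f.toAlternatingMap (v ∘ σ) = _
    rw [h, smul_smul]
    simp
  rw [Finset.sum_congr rfl fun σ _ => this σ]
  simp [Finset.card_univ, Fintype.card_perm]
  field_simp

/-- Between multilinear maps, pullback is itself continuous multilinear in the linear maps, hence
smooth. The result is brought back to alternating maps by the continuous projection
`antisymmetrize`, which fixes them. -/
theorem contDiff_compContinuousLinearMap :
    ContDiff ℝ ∞ fun p : (F [⋀^Fin k]→L[ℝ] ℝ) × (E →L[ℝ] F) =>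
      p.1.compContinuousLinearMap p.2 := by
  have h1 : ContDiff ℝ ∞ fun p : (F [⋀^Fin k]→L[ℝ] ℝ) × (E →L[ℝ] F) =>
      (ContinuousMultilinearMap.compContinuousLinearMapContinuousMultilinear ℝ
        (fun _ : Fin k => E) (fun _ => F) ℝ (fun _ => p.2))
        (ContinuousAlternatingMap.toContinuousMultilinearMapCLM ℝ p.1) := by
    refine ContDiff.clm_apply ?_ ?_
    · exact (ContinuousMultilinearMap.contDiff _).comp (contDiff_pi.2 fun _ => contDiff_snd)
    · exact (ContinuousLinearMap.contDiff _).comp contDiff_fst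
  convert (antisymmetrize E k).contDiff.comp h1 with p
  exact (antisymmetrize_apply _).symm

theorem contDiff_curryLeft :
    ContDiff ℝ ∞ fun p : (F [⋀^Fin (k + 1)]→L[ℝ] ℝ) × F => p.1.curryLeft p.2 :=
  ((ContinuousAlternatingMap.curryLeftLI (𝕜 := ℝ) (E := F) (F := ℝ) (n := k)).contDiff.comp
    contDiff_fst).clm_apply contDiff_snd

end AlternatingSmooth

/-! ### Transition maps between preferred charts and their derivatives -/

section Charts

variable {E : Type*} [NormedAddCommGroup E] [NormedSpace ℝ E]
  {X : Type*} [TopologicalSpace X] [ChartedSpace E X]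

/-- The transition map from the preferred chart at `x` to the preferred chart at `y`. -/
def transition (E : Type*) [NormedAddCommGroup E] [NormedSpace ℝ E]
    {X : Type*} [TopologicalSpace X] [ChartedSpace E X] (x y : X) (u : E) : E :=
  chartAt E y ((chartAt E x).symm u)

/-- The part of the target of the chart at `x` that lies in the source of the chart at `y`. -/
def overlap (E : Type*) [NormedAddCommGroup E] [NormedSpace ℝ E]
    {X : Type*} [TopologicalSpace X] [ChartedSpace E X] (x y : X) : Set E :=
  ((chartAt E x).symm.trans (chartAt E y)).source

theorem mem_overlap {x y : X} {u : E} : u ∈ overlap E x y ↔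
    u ∈ (chartAt E x).target ∧ (chartAt E x).symm u ∈ (chartAt E y).source := by
  simp [overlap]

theorem isOpen_overlap (x y : X) : IsOpen (overlap E x y) :=
  ((chartAt E x).symm.trans (chartAt E y)).open_source

theorem transition_mem_overlap {x₀ x₁ : X} {u : E} (hu : u ∈ overlap E x₀ x₁) :
    transition E x₀ x₁ u ∈ overlap E x₁ x₀ := by
  rw [mem_overlap] at hu ⊢
  unfold transition
  refine ⟨(chartAt E x₁).map_source hu.2, ?_⟩
  rw [(chartAt E x₁).left_inv hu.2]
  exact (chartAt E x₀).map_target hu.1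

theorem transition_transition {x₀ x₁ : X} {u : E} (hu : u ∈ overlap E x₀ x₁) :
    transition E x₁ x₀ (transition E x₀ x₁ u) = u := by
  rw [mem_overlap] at hu
  unfold transition
  rw [(chartAt E x₁).left_inv hu.2, (chartAt E x₀).right_inv hu.1]

theorem chart_symm_transition {x₀ x₁ : X} {u : E} (hu : u ∈ overlap E x₀ x₁) :
    (chartAt E x₁).symm (transition E x₀ x₁ u) = (chartAt E x₀).symm u := by
  rw [mem_overlap] at hu
  exact (chartAt E x₁).left_inv hu.2

variable [IsManifold 𝓘(ℝ, E) ∞ X]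

theorem coordChange_self {x z : X} (h : z ∈ (chartAt E x).source) :
    tangentCoordChange 𝓘(ℝ, E) x x z = ContinuousLinearMap.id ℝ E := by
  ext v
  exact tangentCoordChange_self (by rwa [extChartAt_source])

theorem coordChange_comp {w x y z : X} (hw : z ∈ (chartAt E w).source)
    (hx : z ∈ (chartAt E x).source) (hy : z ∈ (chartAt E y).source) :
    (tangentCoordChange 𝓘(ℝ, E) x y z).comp (tangentCoordChange 𝓘(ℝ, E) w x z) =
      tangentCoordChange 𝓘(ℝ, E) w y z := by
  ext v
  exact tangentCoordChange_comp (by simp only [extChartAt_source]; exact ⟨⟨hw, hx⟩, hy⟩)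

theorem coordChange_comp_apply {w x y z : X} (hw : z ∈ (chartAt E w).source)
    (hx : z ∈ (chartAt E x).source) (hy : z ∈ (chartAt E y).source) (v : E) :
    tangentCoordChange 𝓘(ℝ, E) x y z (tangentCoordChange 𝓘(ℝ, E) w x z v) =
      tangentCoordChange 𝓘(ℝ, E) w y z v := by
  rw [← coordChange_comp hw hx hy]; rfl

theorem isUnit_coordChange {x y z : X} (hx : z ∈ (chartAt E x).source)
    (hy : z ∈ (chartAt E y).source) : IsUnit (tangentCoordChange 𝓘(ℝ, E) x y z) :=
  ⟨⟨tangentCoordChange 𝓘(ℝ, E) x y z, tangentCoordChange 𝓘(ℝ, E) y x z,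
    (coordChange_comp hy hx hy).trans (coordChange_self hy),
    (coordChange_comp hx hy hx).trans (coordChange_self hx)⟩, rfl⟩

theorem hasFDerivAt_transition {x y z : X} (hx : z ∈ (chartAt E x).source)
    (hy : z ∈ (chartAt E y).source) :
    HasFDerivAt (transition E x y) (tangentCoordChange 𝓘(ℝ, E) x y z) (chartAt E x z) := by
  have h := hasFDerivWithinAt_tangentCoordChange (I := 𝓘(ℝ, E)) (x := x) (y := y) (z := z)
    (by simp only [extChartAt_source]; exact ⟨hx, hy⟩)
  simp only [modelWithCornersSelf_coe, range_id, hasFDerivWithinAt_univ] at h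
  exact h

theorem contDiffOn_transition (x y : X) :
    ContDiffOn ℝ ∞ (transition E x y) (overlap E x y) := by
  have := contDiffOn_ext_coord_change (I := 𝓘(ℝ, E)) (n := ∞) y x
  have h2 : ((extChartAt 𝓘(ℝ, E) x).symm.trans (extChartAt 𝓘(ℝ, E) y)).source = overlap E x y := by
    ext u
    simp [mem_overlap]
  rw [h2] at this
  exact this

theorem contDiffOn_coordChange (x y : X) :
    ContDiffOn ℝ ∞ (fun u => tangentCoordChange 𝓘(ℝ, E) x y ((chartAt E x).symm u))
      (overlap E x y) := by
  have h := (contDiffOn_transition (E := E) x y).fderiv_of_isOpen (m := ∞) (isOpen_overlap x y)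
    (by simp)
  refine h.congr fun u hu => ?_
  rw [mem_overlap] at hu
  have h2 := hasFDerivAt_transition (E := E) (x := x) (y := y)
    ((chartAt E x).map_target hu.1) hu.2
  rw [(chartAt E x).right_inv hu.1] at h2
  exact h2.fderiv.symm

end Charts

/-! ### Smoothness in parameters and mixed partial derivatives -/

section PartialDerivatives

variable {P E G : Type*} [NormedAddCommGroup P] [NormedSpace ℝ P]
  [NormedAddCommGroup E] [NormedSpace ℝ E] [NormedAddCommGroup G] [NormedSpace ℝ G]

theorem contDiffOn_partial_fderiv {f : P → E → G} {O : Set E} (hO : IsOpen O)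
    (hf : ContDiffOn ℝ ∞ (fun q : P × E => f q.1 q.2) (univ ×ˢ O)) :
    ContDiffOn ℝ ∞ (fun q : P × E => fderiv ℝ (f q.1) q.2) (univ ×ˢ O) := by
  intro q hq
  have hq' : univ ×ˢ O ∈ nhds q := (isOpen_univ.prod hO).mem_nhds hq
  have h1 : ContDiffAt ℝ ∞ (Function.uncurry fun (q : P × E) (v : E) => f q.1 v) (q, q.2) := by
    have h2 : ContDiffAt ℝ ∞ (fun r : (P × E) × E => ((r.1.1, r.2) : P × E)) (q, q.2) :=
      ((contDiff_fst.comp contDiff_fst).prodMk contDiff_snd).contDiffAt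
    exact ContDiffAt.comp (x := (q, q.2)) (f := fun r : (P × E) × E => ((r.1.1, r.2) : P × E))
      (g := fun q : P × E => f q.1 q.2) ((hf q hq).contDiffAt hq') h2
  exact (ContDiffAt.fderiv (m := ∞) h1 contDiffAt_snd (by simp)).contDiffWithinAt

theorem contDiffOn_slice {f : P → E → G} {O : Set E} (s : P)
    (hf : ContDiffOn ℝ ∞ (fun q : P × E => f q.1 q.2) (univ ×ˢ O)) :
    ContDiffOn ℝ ∞ (f s) O :=
  hf.comp (f := fun u : E => ((s, u) : P × E)) (contDiff_const.prodMk contDiff_id).contDiffOn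
    fun _ hu => ⟨mem_univ _, hu⟩

theorem contDiff_slice_left {f : P → E → G} {O : Set E} {u : E} (hu : u ∈ O)
    (hf : ContDiffOn ℝ ∞ (fun q : P × E => f q.1 q.2) (univ ×ˢ O)) :
    ContDiff ℝ ∞ fun s => f s u := by
  rw [← contDiffOn_univ]
  exact hf.comp (f := fun s : P => ((s, u) : P × E)) (contDiff_id.prodMk contDiff_const).contDiffOn
    fun _ _ => ⟨mem_univ _, hu⟩

/-- Symmetry of the second derivative of the joint function, applied to one parameter direction and
one spatial direction. It lies behind both `δd = dδ` and the symmetry of second variations. -/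
theorem hasDerivAt_partial_fderiv {f : ℝ → E → G} {t : ℝ} {u : E}
    (hf : ContDiffAt ℝ ∞ (fun q : ℝ × E => f q.1 q.2) (t, u)) :
    HasDerivAt (fun s => fderiv ℝ (f s) u) (fderiv ℝ (fun v => deriv (fun s => f s v) t) u) t := by
  set F : ℝ × E → G := fun q => f q.1 q.2 with hF
  have hev : ∀ᶠ q in nhds (t, u), DifferentiableAt ℝ F q :=
    ((hf.of_le (m := 1) (by norm_cast)).eventually (by simp)).mono
      fun q hq => hq.differentiableAt (by simp)
  have hd : DifferentiableAt ℝ (fderiv ℝ F) (t, u) :=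
    (hf.fderiv_right (m := 1) (by norm_cast)).differentiableAt (by simp)
  have hsymm : IsSymmSndFDerivAt ℝ F (t, u) :=
    hf.isSymmSndFDerivAt (by simp [minSmoothness_of_isRCLikeNormedField]; norm_cast)
  have hright : ∀ q, DifferentiableAt ℝ F q →
      HasFDerivAt (f q.1) ((fderiv ℝ F q).comp (ContinuousLinearMap.inr ℝ ℝ E)) q.2 := by
    intro q hq
    exact HasFDerivAt.comp (f := fun v : E => ((q.1, v) : ℝ × E)) (g := F) q.2
      hq.hasFDerivAt (hasFDerivAt_prodMk_right q.1 q.2)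
  have hleft : ∀ q, DifferentiableAt ℝ F q →
      HasDerivAt (fun s => f s q.2) (fderiv ℝ F q (1, 0)) q.1 := by
    intro q hq
    have h := HasFDerivAt.comp (f := fun s : ℝ => ((s, q.2) : ℝ × E)) (g := F) q.1
      hq.hasFDerivAt (hasFDerivAt_prodMk_left q.1 q.2)
    exact h.hasDerivAt
  have hevt : ∀ᶠ s in nhds t, DifferentiableAt ℝ F (s, u) :=
    (Continuous.tendsto (by fun_prop : Continuous fun s : ℝ => ((s, u) : ℝ × E)) t).eventually hev
  have hevu : ∀ᶠ v in nhds u, DifferentiableAt ℝ F (t, v) :=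
    (Continuous.tendsto (by fun_prop : Continuous fun v : E => ((t, v) : ℝ × E)) u).eventually hev
  have e1 : (fun v => deriv (fun s => f s v) t) =ᶠ[nhds u] fun v => fderiv ℝ F (t, v) (1, 0) :=
    hevu.mono fun v hv => (hleft _ hv).deriv
  have e2 : (fun s => fderiv ℝ (f s) u) =ᶠ[nhds t]
      fun s => (fderiv ℝ F (s, u)).comp (ContinuousLinearMap.inr ℝ ℝ E) :=
    hevt.mono fun s hs => (hright _ hs).fderiv
  have d1 : HasFDerivAt (fun v => fderiv ℝ F (t, v) (1, 0))
      (((fderiv ℝ (fderiv ℝ F) (t, u)).comp (ContinuousLinearMap.inr ℝ ℝ E)).flip (1, 0)) u := by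
    have h := HasFDerivAt.comp (f := fun v : E => ((t, v) : ℝ × E)) (g := fderiv ℝ F) u
      hd.hasFDerivAt (hasFDerivAt_prodMk_right t u)
    have h2 := h.clm_apply (hasFDerivAt_const ((1, 0) : ℝ × E) u)
    simpa using h2
  have d2 : HasDerivAt (fun s => (fderiv ℝ F (s, u)).comp (ContinuousLinearMap.inr ℝ ℝ E))
      ((fderiv ℝ (fderiv ℝ F) (t, u) (1, 0)).comp (ContinuousLinearMap.inr ℝ ℝ E)) t := by
    have h := (HasFDerivAt.comp (f := fun s : ℝ => ((s, u) : ℝ × E)) (g := fderiv ℝ F) t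
      hd.hasFDerivAt (hasFDerivAt_prodMk_left t u)).hasDerivAt
    have h2 := h.clm_comp (hasDerivAt_const t (ContinuousLinearMap.inr ℝ ℝ E))
    simpa using h2
  refine (d2.congr_of_eventuallyEq e2).congr_deriv ?_
  rw [e1.fderiv_eq, d1.fderiv]
  ext h
  simpa using hsymm (1, 0) (0, h)

end PartialDerivatives

/-! ### Smooth families of sections, treated uniformly for forms, vectors and fields -/

section SmoothInCharts

variable {E : Type*} [NormedAddCommGroup E] [NormedSpace ℝ E]
  {X : Type*} [TopologicalSpace X] [ChartedSpace E X]
  {A : Type*} [NormedAddCommGroup A] [NormedSpace ℝ A]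
  {P P' : Type*} [NormedAddCommGroup P] [NormedSpace ℝ P] [NormedAddCommGroup P'] [NormedSpace ℝ P']

/-- Joint smoothness of a family of sections whose representative at `u` in the chart at `x₀` is
obtained with the linear map `R x₀ u` from its value. -/
def SmoothInCharts (R : X → E → A →L[ℝ] A) (α : P → X → A) : Prop :=
  ∀ x₀ : X, ContDiffOn ℝ ∞ (fun q : P × E => R x₀ q.2 (α q.1 ((chartAt E x₀).symm q.2)))
    (univ ×ˢ (chartAt E x₀).target)

namespace SmoothInCharts

variable {R : X → E → A →L[ℝ] A} {α β : P → X → A}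

theorem comp (hα : SmoothInCharts R α) {g : P' → P} (hg : ContDiff ℝ ∞ g) :
    SmoothInCharts R fun s => α (g s) := fun x₀ =>
  (hα x₀).comp (f := fun q : P' × E => ((g q.1, q.2) : P × E))
    ((hg.comp contDiff_fst).prodMk contDiff_snd).contDiffOn fun _ hq => ⟨mem_univ _, hq.2⟩

theorem add (hα : SmoothInCharts R α) (hβ : SmoothInCharts R β) :
    SmoothInCharts R fun s => α s + β s := fun x₀ => by
  simpa only [Pi.add_apply, map_add] using (hα x₀).add (hβ x₀)

theorem neg (hα : SmoothInCharts R α) : SmoothInCharts R fun s => - α s := fun x₀ => by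
  simpa only [Pi.neg_apply, map_neg] using (hα x₀).neg

theorem sub (hα : SmoothInCharts R α) (hβ : SmoothInCharts R β) :
    SmoothInCharts R fun s => α s - β s := by
  simpa only [sub_eq_add_neg] using hα.add hβ.neg

/-- At the centre of a preferred chart the representative is the value itself, so evaluation at a
point is a slice of the jointly smooth representative. -/
theorem contDiff_apply (hα : SmoothInCharts R α)
    (hR : ∀ x, R x (chartAt E x x) = ContinuousLinearMap.id ℝ A) (x : X) :
    ContDiff ℝ ∞ fun s => α s x := by
  have := contDiff_slice_left
    (f := fun s u => R x u (α s ((chartAt E x).symm u))) (mem_chart_target E x) (hα x)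
  simpa [hR] using this

/-- The change of frame `R x₀ u` is linear and independent of the parameter, so it passes through
the parameter derivative. -/
theorem rep_deriv {α : P × ℝ → X → A} (hα : SmoothInCharts R α)
    (hR : ∀ x, R x (chartAt E x x) = ContinuousLinearMap.id ℝ A)
    (x₀ : X) (u : E) (s : P) (t : ℝ) :
    R x₀ u (deriv (fun r => α (s, r) ((chartAt E x₀).symm u)) t) =
      deriv (fun r => R x₀ u (α (s, r) ((chartAt E x₀).symm u))) t := by
  have h1 : DifferentiableAt ℝ (fun r => α (s, r) ((chartAt E x₀).symm u)) t :=
    ((hα.contDiff_apply hR ((chartAt E x₀).symm u)).comp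
      (contDiff_const.prodMk contDiff_id : ContDiff ℝ ∞ fun r : ℝ => ((s, r) : P × ℝ))).differentiable
      (by simp) t
  exact (((R x₀ u).hasFDerivAt.comp_hasDerivAt t h1.hasDerivAt).deriv).symm

theorem deriv_right {α : P × ℝ → X → A} (hα : SmoothInCharts R α)
    (hR : ∀ x, R x (chartAt E x x) = ContinuousLinearMap.id ℝ A) :
    SmoothInCharts R fun (p : P × ℝ) y => deriv (fun t => α (p.1, t) y) p.2 := fun x₀ => by
  intro q hq
  have h2 : ContDiffAt ℝ ∞ (Function.uncurry fun (q : (P × ℝ) × E) (t : ℝ) =>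
      R x₀ q.2 (α (q.1.1, t) ((chartAt E x₀).symm q.2))) (q, q.1.2) := by
    refine ContDiffAt.comp (x := (q, q.1.2))
      (f := fun r : ((P × ℝ) × E) × ℝ => (((r.1.1.1, r.2), r.1.2) : (P × ℝ) × E))
      (g := fun q : (P × ℝ) × E => R x₀ q.2 (α q.1 ((chartAt E x₀).symm q.2)))
      ((hα x₀).contDiffAt ((isOpen_univ.prod (chartAt E x₀).open_target).mem_nhds
        ⟨mem_univ _, hq.2⟩)) ?_
    exact ContDiff.contDiffAt (by fun_prop)
  have h3 := (ContDiffAt.fderiv (m := ∞) (g := fun q : (P × ℝ) × E => q.1.2) h2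
    (ContDiff.contDiffAt (by fun_prop)) (by simp)).clm_apply (contDiffAt_const (c := (1 : ℝ)))
  refine ContDiffAt.contDiffWithinAt ?_
  refine h3.congr_of_eventuallyEq (Filter.Eventually.of_forall fun r => ?_)
  simp only
  rw [hα.rep_deriv hR, fderiv_apply_one_eq_deriv]

end SmoothInCharts

end SmoothInCharts

/-! ### Differential forms in charts: `d`, `i_ξ`, `£_ξ` and their smoothness -/

section FormsInCharts

variable {E : Type*} [NormedAddCommGroup E] [NormedSpace ℝ E]
  {X : Type*} [TopologicalSpace X] [ChartedSpace E X] [IsManifold 𝓘(ℝ, E) ∞ X]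
  {P P' : Type*} [NormedAddCommGroup P] [NormedSpace ℝ P] [NormedAddCommGroup P'] [NormedSpace ℝ P']
  {k : ℕ}

theorem formInChart_self (α : X → E [⋀^Fin k]→L[ℝ] ℝ) (x : X) :
    formInChart α x (chartAt E x x) = α x := by
  unfold formInChart
  rw [(chartAt E x).left_inv (mem_chart_source E x), coordChange_self (mem_chart_source E x)]
  ext v
  simp

theorem vecInChart_self (ξ : X → E) (x : X) : vecInChart ξ x (chartAt E x x) = ξ x := by
  unfold vecInChart
  rw [(chartAt E x).left_inv (mem_chart_source E x), coordChange_self (mem_chart_source E x)]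
  simp

theorem vecInChart_transition (ξ : X → E) {x₀ x₁ : X} {u : E} (hu : u ∈ overlap E x₀ x₁) :
    vecInChart ξ x₁ (transition E x₀ x₁ u) =
      tangentCoordChange 𝓘(ℝ, E) x₀ x₁ ((chartAt E x₀).symm u) (vecInChart ξ x₀ u) := by
  rw [mem_overlap] at hu
  unfold vecInChart transition
  rw [(chartAt E x₁).left_inv hu.2, coordChange_comp_apply (mem_chart_source E _)
    ((chartAt E x₀).map_target hu.1) hu.2]

theorem formInChart_transition (α : X → E [⋀^Fin k]→L[ℝ] ℝ) {x₀ x₁ : X} {u : E}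
    (hu : u ∈ overlap E x₀ x₁) :
    formInChart α x₀ u = (formInChart α x₁ (transition E x₀ x₁ u)).compContinuousLinearMap
      (tangentCoordChange 𝓘(ℝ, E) x₀ x₁ ((chartAt E x₀).symm u)) := by
  rw [mem_overlap] at hu
  unfold formInChart transition
  rw [(chartAt E x₁).left_inv hu.2]
  ext v
  simp only [ContinuousAlternatingMap.compContinuousLinearMap_apply]
  congr 1
  ext i
  exact (coordChange_comp_apply ((chartAt E x₀).map_target hu.1) hu.2 (mem_chart_source E _) _).symm

theorem formInChart_iForm (ξ : X → E) (α : X → E [⋀^Fin (k + 1)]→L[ℝ] ℝ) {x₀ : X} {u : E}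
    (hu : u ∈ (chartAt E x₀).target) :
    formInChart (iForm ξ α) x₀ u = (formInChart α x₀ u).curryLeft (vecInChart ξ x₀ u) := by
  unfold formInChart iForm vecInChart
  have hu' := (chartAt E x₀).map_target hu
  rw [ContinuousAlternatingMap.curryLeft_compContinuousLinearMap,
    coordChange_comp_apply (mem_chart_source E _) hu' (mem_chart_source E _),
    coordChange_self (mem_chart_source E _)]
  rfl

theorem hasFDerivAt_transition' {x₀ x₁ : X} {u : E} (hu : u ∈ overlap E x₀ x₁) :
    HasFDerivAt (transition E x₀ x₁)
      (tangentCoordChange 𝓘(ℝ, E) x₀ x₁ ((chartAt E x₀).symm u)) u := by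
  rw [mem_overlap] at hu
  have h := hasFDerivAt_transition (E := E) (x := x₀) (y := x₁)
    ((chartAt E x₀).map_target hu.1) hu.2
  rwa [(chartAt E x₀).right_inv hu.1] at h

/-- `dForm` uses a different chart at every point. That it is computed by any single chart follows
because `extDeriv` commutes with pullback along transition maps; smoothness of `dForm α` is visible
only in this form. -/
theorem formInChart_dForm {α : X → E [⋀^Fin k]→L[ℝ] ℝ} {x₀ : X}
    (hα : ContDiffOn ℝ ∞ (formInChart α x₀) (chartAt E x₀).target) {u : E}
    (hu : u ∈ (chartAt E x₀).target) :
    formInChart (dForm α) x₀ u = extDeriv (formInChart α x₀) u := by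
  set y := (chartAt E x₀).symm u with hy
  have hys : y ∈ (chartAt E x₀).source := (chartAt E x₀).map_target hu
  have hyu : chartAt E x₀ y = u := (chartAt E x₀).right_inv hu
  have hv : chartAt E y y ∈ overlap E y x₀ := by
    rw [mem_overlap]
    refine ⟨mem_chart_target E y, ?_⟩
    rwa [(chartAt E y).left_inv (mem_chart_source E y)]
  have htr : transition E y x₀ (chartAt E y y) = u := by
    unfold transition
    rw [(chartAt E y).left_inv (mem_chart_source E y), hyu]
  have hloc : formInChart α y =ᶠ[nhds (chartAt E y y)] fun v =>
      (formInChart α x₀ (transition E y x₀ v)).compContinuousLinearMap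
        (fderiv ℝ (transition E y x₀) v) := by
    filter_upwards [(isOpen_overlap y x₀).mem_nhds hv] with v hv
    rw [formInChart_transition α hv, (hasFDerivAt_transition' hv).fderiv]
  have hd : dForm α y = (extDeriv (formInChart α x₀) u).compContinuousLinearMap
      (tangentCoordChange 𝓘(ℝ, E) y x₀ y) := by
    unfold dForm
    rw [hloc.extDeriv_eq, extDeriv_pullback (r := ∞), htr, (hasFDerivAt_transition' hv).fderiv,
      (chartAt E y).left_inv (mem_chart_source E y)]
    · rw [htr]
      exact (hα.contDiffAt ((chartAt E x₀).open_target.mem_nhds hu)).differentiableAt (by simp)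
    · exact (contDiffOn_transition y x₀).contDiffAt ((isOpen_overlap y x₀).mem_nhds hv)
    · simp [minSmoothness_of_isRCLikeNormedField]; norm_cast
  rw [formInChart, ← hy, hd]
  ext v
  simp only [ContinuousAlternatingMap.compContinuousLinearMap_apply]
  congr 1
  ext i
  simp only [Function.comp_apply]
  rw [coordChange_comp_apply hys (mem_chart_source E y) hys, coordChange_self hys]
  rfl

/-! ### Smooth families -/

/-- The linear maps that take the values of a form to its representatives in charts. -/
noncomputable def formRep (x₀ : X) (u : E) : (E [⋀^Fin k]→L[ℝ] ℝ) →L[ℝ] (E [⋀^Fin k]→L[ℝ] ℝ) :=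
  ContinuousAlternatingMap.compContinuousLinearMapCLM
    (tangentCoordChange 𝓘(ℝ, E) x₀ ((chartAt E x₀).symm u) ((chartAt E x₀).symm u))

theorem formRep_self (x : X) :
    formRep (k := k) x (chartAt E x x) = ContinuousLinearMap.id ℝ (E [⋀^Fin k]→L[ℝ] ℝ) :=
  ContinuousLinearMap.ext fun a => formInChart_self (fun _ => a) x

/-- The linear maps that take the values of a vector field to its representatives in charts. -/
noncomputable def vecRep (x₀ : X) (u : E) : E →L[ℝ] E :=
  tangentCoordChange 𝓘(ℝ, E) ((chartAt E x₀).symm u) x₀ ((chartAt E x₀).symm u)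

theorem vecRep_self (x : X) : vecRep x (chartAt E x x) = ContinuousLinearMap.id ℝ E :=
  ContinuousLinearMap.ext fun a => vecInChart_self (fun _ => a) x

theorem SmoothVecFamily.inCharts {ξ : P → X → E} (hξ : SmoothVecFamily ξ) :
    SmoothInCharts vecRep ξ := hξ

/-- A single smooth form. -/
def IsSmoothForm (α : X → E [⋀^Fin k]→L[ℝ] ℝ) : Prop := SmoothFormFamily fun _ : ℝ => α

namespace SmoothFormFamily

variable {α β : P → X → E [⋀^Fin k]→L[ℝ] ℝ}

theorem inCharts (hα : SmoothFormFamily α) : SmoothInCharts formRep α := hα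

theorem comp (hα : SmoothFormFamily α) {g : P' → P} (hg : ContDiff ℝ ∞ g) :
    SmoothFormFamily fun s => α (g s) := hα.inCharts.comp hg

theorem isSmoothForm (hα : SmoothFormFamily α) (s : P) : IsSmoothForm (α s) :=
  hα.comp (g := fun _ : ℝ => s) contDiff_const

theorem add (hα : SmoothFormFamily α) (hβ : SmoothFormFamily β) :
    SmoothFormFamily fun s => α s + β s := hα.inCharts.add hβ.inCharts

theorem neg (hα : SmoothFormFamily α) : SmoothFormFamily fun s => - α s :=
  hα.inCharts.neg

theorem sub (hα : SmoothFormFamily α) (hβ : SmoothFormFamily β) :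
    SmoothFormFamily fun s => α s - β s := hα.inCharts.sub hβ.inCharts

theorem contDiffAt (hα : SmoothFormFamily α) {x₀ : X} {u : E} (hu : u ∈ (chartAt E x₀).target)
    (s : P) : ContDiffAt ℝ ∞ (fun q : P × E => formInChart (α q.1) x₀ q.2) (s, u) :=
  (hα x₀).contDiffAt ((isOpen_univ.prod (chartAt E x₀).open_target).mem_nhds ⟨mem_univ _, hu⟩)

theorem iForm {α : P → X → E [⋀^Fin (k + 1)]→L[ℝ] ℝ} (hα : SmoothFormFamily α) {ξ : P → X → E}
    (hξ : SmoothVecFamily ξ) : SmoothFormFamily fun s => iForm (ξ s) (α s) := fun x₀ => by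
  refine (contDiff_curryLeft.comp_contDiffOn ((hα x₀).prodMk (hξ x₀))).congr fun q hq => ?_
  exact formInChart_iForm _ _ hq.2

theorem dForm (hα : SmoothFormFamily α) : SmoothFormFamily fun s => dForm (α s) := fun x₀ => by
  have h := contDiffOn_partial_fderiv (f := fun s u => formInChart (α s) x₀ u)
    (chartAt E x₀).open_target (hα x₀)
  have h2 := (ContinuousAlternatingMap.alternatizeUncurryFinCLM ℝ E ℝ
    (n := k)).contDiff.comp_contDiffOn (n := ∞) h
  refine h2.congr fun q hq => ?_
  exact formInChart_dForm
    (contDiffOn_slice (f := fun s u => formInChart (α s) x₀ u) q.1 (hα x₀)) hq.2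

theorem lieForm (hα : SmoothFormFamily α) {ξ : P → X → E} (hξ : SmoothVecFamily ξ) :
    SmoothFormFamily fun s => lieForm (ξ s) (α s) := by
  cases k with
  | zero => exact hα.dForm.iForm hξ
  | succ k => exact (hα.iForm hξ).dForm.add (hα.dForm.iForm hξ)

theorem contDiff_apply (hα : SmoothFormFamily α) (x : X) : ContDiff ℝ ∞ fun s => α s x :=
  hα.inCharts.contDiff_apply formRep_self x

theorem formInChart_deriv {α : P × ℝ → X → E [⋀^Fin k]→L[ℝ] ℝ} (hα : SmoothFormFamily α)
    (x₀ : X) (u : E) (s : P) (t : ℝ) :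
    formInChart (fun y => deriv (fun r => α (s, r) y) t) x₀ u =
      deriv (fun r => formInChart (α (s, r)) x₀ u) t :=
  hα.inCharts.rep_deriv formRep_self x₀ u s t

theorem deriv_right {α : P × ℝ → X → E [⋀^Fin k]→L[ℝ] ℝ} (hα : SmoothFormFamily α) :
    SmoothFormFamily fun (p : P × ℝ) y => deriv (fun t => α (p.1, t) y) p.2 :=
  hα.inCharts.deriv_right formRep_self

theorem deriv {α : ℝ → X → E [⋀^Fin k]→L[ℝ] ℝ} (hα : SmoothFormFamily α) :
    SmoothFormFamily fun (t : ℝ) y => deriv (fun t => α t y) t :=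
  (deriv_right (P := ℝ) (hα.comp (g := fun p : ℝ × ℝ => p.2) contDiff_snd)).comp
    (g := fun t : ℝ => ((0, t) : ℝ × ℝ)) (contDiff_const.prodMk contDiff_id)

theorem hasDerivAt {α : ℝ → X → E [⋀^Fin k]→L[ℝ] ℝ} (hα : SmoothFormFamily α) (x : X) (t : ℝ) :
    HasDerivAt (fun s => α s x) (_root_.deriv (fun s => α s x) t) t :=
  ((hα.contDiff_apply x).differentiable (by simp) t).hasDerivAt

/-- The exterior derivative commutes with the derivative in a parameter. -/
theorem hasDerivAt_dForm {α : ℝ → X → E [⋀^Fin k]→L[ℝ] ℝ} (hα : SmoothFormFamily α) (x : X) (t : ℝ) :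
    HasDerivAt (fun s => CovariantPhaseSpace.dForm (α s) x)
      (CovariantPhaseSpace.dForm (fun y => _root_.deriv (fun s => α s y) t) x) t := by
  have h := hasDerivAt_partial_fderiv (f := fun s u => formInChart (α s) x u)
    (hα.contDiffAt (mem_chart_target E x) t)
  have h2 := (ContinuousAlternatingMap.alternatizeUncurryFinCLM ℝ E ℝ
    (n := k)).hasFDerivAt.comp_hasDerivAt t h
  refine h2.congr_deriv ?_
  have h3 := fun u => formInChart_deriv (P := ℝ)
    (hα.comp (g := fun p : ℝ × ℝ => p.2) contDiff_snd) x u 0 t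
  change _ = extDeriv _ _
  rw [show formInChart (fun y => _root_.deriv (fun s => α s y) t) x = fun u => _ from funext h3]
  rfl

end SmoothFormFamily

namespace IsSmoothForm

variable {α β : X → E [⋀^Fin k]→L[ℝ] ℝ}

theorem contDiffOn (hα : IsSmoothForm α) (x₀ : X) :
    ContDiffOn ℝ ∞ (formInChart α x₀) (chartAt E x₀).target := 
  contDiffOn_slice (f := fun (_ : ℝ) u => formInChart α x₀ u) 0 (hα x₀)

theorem differentiableAt (hα : IsSmoothForm α) (x : X) :
    DifferentiableAt ℝ (formInChart α x) (chartAt E x x) :=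
  ((hα.contDiffOn x).contDiffAt ((chartAt E x).open_target.mem_nhds
    (mem_chart_target E x))).differentiableAt (by simp)

theorem dForm_add (hα : IsSmoothForm α) (hβ : IsSmoothForm β) :
    dForm (α + β) = dForm α + dForm β :=
  funext fun x => extDeriv_add (hα.differentiableAt x) (hβ.differentiableAt x)

theorem dForm_neg : dForm (-α) = - dForm α := by
  funext x
  have h : formInChart (-α) x = (-1 : ℝ) • formInChart α x := by
    ext u v; simp [formInChart]
  change extDeriv (formInChart (-α) x) _ = - extDeriv _ _
  rw [h, extDeriv_smul]
  simp

theorem dForm_sub (hα : IsSmoothForm α) (hβ : IsSmoothForm β) :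
    dForm (α - β) = dForm α - dForm β := by
  rw [sub_eq_add_neg, dForm_add hα hβ.neg, dForm_neg, sub_eq_add_neg]

/-- A smooth form that vanishes on a set vanishes on its closure. -/
theorem eq_zero_of_mem_closure (hα : IsSmoothForm α) {U : Set X} (h : ∀ x ∈ U, α x = 0) {x : X}
    (hx : x ∈ closure U) : α x = 0 := by
  -- The values `α y` refer to frames that jump with `y`, so continuity is used for the
  -- representative in the one chart at `x`.
  have hc : ContinuousAt (fun y => formInChart α x (chartAt E x y)) x :=
    ContinuousAt.comp (g := formInChart α x)
      ((hα.contDiffOn x).continuousOn.continuousAt ((chartAt E x).open_target.mem_nhds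
        (mem_chart_target E x))) ((chartAt E x).continuousAt (mem_chart_source E x))
  by_contra hne
  rw [← formInChart_self α x] at hne
  have h2 := hc.eventually_ne hne
  have h3 := (chartAt E x).open_source.mem_nhds (mem_chart_source E x)
  obtain ⟨y, ⟨hy1, hy2⟩, hyU⟩ := mem_closure_iff_nhds.1 hx _ (Filter.inter_mem h2 h3)
  apply hy1
  unfold formInChart
  rw [(chartAt E x).left_inv hy2, h y hyU]
  ext v; simp

end IsSmoothForm

end FormsInCharts

/-! ### Pullback of forms along a smooth map -/

section Pullback

variable {E : Type*} [NormedAddCommGroup E] [NormedSpace ℝ E]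
  {X : Type*} [TopologicalSpace X] [ChartedSpace E X]
  {E' : Type*} [NormedAddCommGroup E'] [NormedSpace ℝ E']
  {Y : Type*} [TopologicalSpace Y] [ChartedSpace E' Y]
  {P : Type*} [NormedAddCommGroup P] [NormedSpace ℝ P] {k : ℕ} {f : Y → X}

/-- The representative of a map in the preferred charts at `y` and `x`. -/
def mapInCharts (E E' : Type*) [NormedAddCommGroup E] [NormedSpace ℝ E]
    {X : Type*} [TopologicalSpace X] [ChartedSpace E X] [NormedAddCommGroup E'] [NormedSpace ℝ E']
    {Y : Type*} [TopologicalSpace Y] [ChartedSpace E' Y] (f : Y → X) (y : Y) (x : X) (v : E') : E :=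
  chartAt E x (f ((chartAt E' y).symm v))

theorem pullForm_iForm {ξ : X → E} {η : Y → E'}
    (h : ∀ y, (show E' →L[ℝ] E from mfderiv 𝓘(ℝ, E') 𝓘(ℝ, E) f y) (η y) = ξ (f y))
    (α : X → E [⋀^Fin (k + 1)]→L[ℝ] ℝ) :
    pullForm (E' := E') f (iForm ξ α) = iForm η (pullForm f α) := by
  funext y
  unfold pullForm iForm
  rw [ContinuousAlternatingMap.curryLeft_compContinuousLinearMap, h]

theorem pullForm_add (α β : X → E [⋀^Fin k]→L[ℝ] ℝ) :
    pullForm (E' := E') f (α + β) = pullForm f α + pullForm f β := rfl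

theorem pullForm_sub (α β : X → E [⋀^Fin k]→L[ℝ] ℝ) :
    pullForm (E' := E') f (α - β) = pullForm f α - pullForm f β := by
  funext y; ext v; rfl

theorem eventually_mem_chart_source (hf : ContMDiff 𝓘(ℝ, E') 𝓘(ℝ, E) ∞ f) {y₀ : Y} {x₀ : X} {v : E'}
    (hv : v ∈ (chartAt E' y₀).target) (hx : f ((chartAt E' y₀).symm v) ∈ (chartAt E x₀).source) :
    ∀ᶠ w in nhds v, w ∈ (chartAt E' y₀).target ∧ f ((chartAt E' y₀).symm w) ∈ (chartAt E x₀).source :=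
  ((chartAt E' y₀).open_target.eventually_mem hv).and
    ((hf.continuous.continuousAt.comp ((chartAt E' y₀).continuousAt_symm hv) :
      ContinuousAt (fun w => f ((chartAt E' y₀).symm w)) v)
        ((chartAt E x₀).open_source.mem_nhds hx))

variable [IsManifold 𝓘(ℝ, E) ∞ X] [IsManifold 𝓘(ℝ, E') ∞ Y]

theorem contDiffAt_mapInCharts (hf : ContMDiff 𝓘(ℝ, E') 𝓘(ℝ, E) ∞ f) {y₀ : Y} {x₀ : X} {v : E'}
    (hv : v ∈ (chartAt E' y₀).target) (hx : f ((chartAt E' y₀).symm v) ∈ (chartAt E x₀).source) :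
    ContDiffAt ℝ ∞ (mapInCharts E E' f y₀ x₀) v := by
  rw [← contMDiffAt_iff_contDiffAt]
  have h1 : ContMDiffAt 𝓘(ℝ, E') 𝓘(ℝ, E') ∞ (chartAt E' y₀).symm v :=
    (contMDiffOn_chart_symm (I := 𝓘(ℝ, E')) (x := y₀)).contMDiffAt
      ((chartAt E' y₀).open_target.mem_nhds hv)
  have h2 : ContMDiffAt 𝓘(ℝ, E) 𝓘(ℝ, E) ∞ (chartAt E x₀) (f ((chartAt E' y₀).symm v)) :=
    (contMDiffOn_chart (I := 𝓘(ℝ, E)) (x := x₀)).contMDiffAt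
      ((chartAt E x₀).open_source.mem_nhds hx)
  exact h2.comp v ((hf _).comp v h1)

/-- Near `v` the representative factors through the charts centred at the point and its image, where
its derivative is `mfderiv` by definition; the two outer factors are transition maps. -/
theorem hasFDerivAt_mapInCharts (hf : ContMDiff 𝓘(ℝ, E') 𝓘(ℝ, E) ∞ f) {y₀ : Y} {x₀ : X} {v : E'}
    (hv : v ∈ (chartAt E' y₀).target) (hx : f ((chartAt E' y₀).symm v) ∈ (chartAt E x₀).source) :
    HasFDerivAt (mapInCharts E E' f y₀ x₀)
      ((tangentCoordChange 𝓘(ℝ, E) (f ((chartAt E' y₀).symm v)) x₀ (f ((chartAt E' y₀).symm v))).comp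
        ((show E' →L[ℝ] E from mfderiv 𝓘(ℝ, E') 𝓘(ℝ, E) f ((chartAt E' y₀).symm v)).comp
          (tangentCoordChange 𝓘(ℝ, E') y₀ ((chartAt E' y₀).symm v) ((chartAt E' y₀).symm v)))) v := by
  set y := (chartAt E' y₀).symm v with hy
  have hys : y ∈ (chartAt E' y₀).source := (chartAt E' y₀).map_target hv
  have hvo : v ∈ overlap E' y₀ y := by rw [mem_overlap]; exact ⟨hv, mem_chart_source E' y⟩
  have h1 := hasFDerivAt_transition' hvo
  rw [← hy] at h1
  have htv : transition E' y₀ y v = chartAt E' y y := rfl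
  have h2 : HasFDerivAt (mapInCharts E E' f y (f y))
      (show E' →L[ℝ] E from mfderiv 𝓘(ℝ, E') 𝓘(ℝ, E) f y) (chartAt E' y y) := by
    have h := ((hf.mdifferentiable (by simp)) y).hasMFDerivAt.2
    simp only [modelWithCornersSelf_coe, range_id] at h
    exact HasFDerivWithinAt.hasFDerivAt_of_univ h
  have hmv : mapInCharts E E' f y (f y) (chartAt E' y y) = chartAt E (f y) (f y) := by
    unfold mapInCharts
    rw [(chartAt E' y).left_inv (mem_chart_source E' y)]
  have h3 := hasFDerivAt_transition (E := E) (x := f y) (y := x₀) (mem_chart_source E (f y)) hx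
  rw [← hmv] at h3
  have h4 := (h3.comp _ h2)
  rw [← htv] at h4
  have h5 := h4.comp v h1
  refine h5.congr_of_eventuallyEq ?_
  have c1 : ContinuousAt (fun w => f ((chartAt E' y₀).symm w)) v :=
    hf.continuous.continuousAt.comp ((chartAt E' y₀).continuousAt_symm hv)
  filter_upwards [(isOpen_overlap y₀ y).mem_nhds hvo,
    c1 ((chartAt E (f y)).open_source.mem_nhds (mem_chart_source E (f y)))] with w hw hw2
  rw [mem_overlap] at hw
  simp only [mapInCharts, transition, Function.comp_apply]
  rw [(chartAt E' y).left_inv hw.2, (chartAt E (f y)).left_inv hw2]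

theorem formInChart_pullForm (hf : ContMDiff 𝓘(ℝ, E') 𝓘(ℝ, E) ∞ f)
    (α : X → E [⋀^Fin k]→L[ℝ] ℝ) {y₀ : Y} {x₀ : X} {v : E'}
    (hv : v ∈ (chartAt E' y₀).target) (hx : f ((chartAt E' y₀).symm v) ∈ (chartAt E x₀).source) :
    formInChart (pullForm (E' := E') f α) y₀ v =
      (formInChart α x₀ (mapInCharts E E' f y₀ x₀ v)).compContinuousLinearMap
        (fderiv ℝ (mapInCharts E E' f y₀ x₀) v) := by
  rw [(hasFDerivAt_mapInCharts hf hv hx).fderiv]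
  unfold formInChart pullForm mapInCharts
  rw [(chartAt E x₀).left_inv hx]
  have key : ∀ (a : E [⋀^Fin k]→L[ℝ] ℝ) (A : E' →L[ℝ] E) (T : E' →L[ℝ] E') (B C : E →L[ℝ] E),
      C.comp B = ContinuousLinearMap.id ℝ E →
      (a.compContinuousLinearMap A).compContinuousLinearMap T =
        (a.compContinuousLinearMap C).compContinuousLinearMap (B.comp (A.comp T)) := by
    intro a A T B C h
    ext w
    refine congrArg a (funext fun i => ?_)
    exact (DFunLike.congr_fun h (A (T (w i)))).symm
  exact key _ _ _ _ _ ((coordChange_comp (mem_chart_source E _) hx (mem_chart_source E _)).trans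
    (coordChange_self (mem_chart_source E _)))

theorem SmoothFormFamily.pullForm (hf : ContMDiff 𝓘(ℝ, E') 𝓘(ℝ, E) ∞ f)
    {α : P → X → E [⋀^Fin k]→L[ℝ] ℝ} (hα : SmoothFormFamily α) :
    SmoothFormFamily fun s => pullForm (E' := E') f (α s) := by
  rintro y₀ ⟨s, v⟩ ⟨-, hv⟩
  set x₀ := f ((chartAt E' y₀).symm v) with hx₀
  have hx : f ((chartAt E' y₀).symm v) ∈ (chartAt E x₀).source := mem_chart_source E _
  have hF := contDiffAt_mapInCharts hf hv hx
  have hG := hF.fderiv_right (m := ∞) (by simp)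
  have hmem : mapInCharts E E' f y₀ x₀ v ∈ (chartAt E x₀).target := (chartAt E x₀).map_source hx
  have h1 : ContDiffAt ℝ ∞ (fun q : P × E' =>
      formInChart (α q.1) x₀ (mapInCharts E E' f y₀ x₀ q.2)) (s, v) :=
    ContDiffAt.comp (x := (s, v)) (g := fun q : P × E => formInChart (α q.1) x₀ q.2)
      (f := fun q : P × E' => ((q.1, mapInCharts E E' f y₀ x₀ q.2) : P × E))
      (hα.contDiffAt hmem s) (contDiffAt_fst.prodMk (hF.comp (f := Prod.snd) (s, v) contDiffAt_snd))
  have h2 : ContDiffAt ℝ ∞ (fun q : P × E' => fderiv ℝ (mapInCharts E E' f y₀ x₀) q.2) (s, v) :=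
    hG.comp (f := Prod.snd) (s, v) contDiffAt_snd
  have h3 := ContDiffAt.comp (s, v) contDiff_compContinuousLinearMap.contDiffAt (h1.prodMk h2)
  refine (h3.congr_of_eventuallyEq ?_).contDiffWithinAt
  filter_upwards [continuousAt_snd.eventually (eventually_mem_chart_source hf hv hx)] with q hq
  exact formInChart_pullForm hf _ hq.1 hq.2

theorem dForm_pullForm (hf : ContMDiff 𝓘(ℝ, E') 𝓘(ℝ, E) ∞ f)
    {α : X → E [⋀^Fin k]→L[ℝ] ℝ} (hα : IsSmoothForm α) :
    dForm (pullForm (E' := E') f α) = pullForm f (dForm α) := by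
  funext y
  have hv := mem_chart_target E' y
  have hsymm := (chartAt E' y).left_inv (mem_chart_source E' y)
  have hx : f ((chartAt E' y).symm (chartAt E' y y)) ∈ (chartAt E (f y)).source := by
    rw [hsymm]; exact mem_chart_source E _
  have hm : mapInCharts E E' f y (f y) (chartAt E' y y) = chartAt E (f y) (f y) := by
    unfold mapInCharts; rw [hsymm]
  have hloc : formInChart (pullForm (E' := E') f α) y =ᶠ[nhds (chartAt E' y y)] fun v =>
      (formInChart α (f y) (mapInCharts E E' f y (f y) v)).compContinuousLinearMap
        (fderiv ℝ (mapInCharts E E' f y (f y)) v) := by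
    filter_upwards [eventually_mem_chart_source hf hv hx] with w hw
    exact formInChart_pullForm hf _ hw.1 hw.2
  rw [dForm, hloc.extDeriv_eq, extDeriv_pullback (r := ∞), hm,
    (hasFDerivAt_mapInCharts hf hv hx).fderiv, hsymm, coordChange_self (mem_chart_source E' y),
    coordChange_self (mem_chart_source E (f y))]
  · rfl
  · rw [hm]; exact hα.differentiableAt (f y)
  · exact contDiffAt_mapInCharts hf hv hx
  · simp [minSmoothness_of_isRCLikeNormedField]; norm_cast

theorem pullForm_lieForm (hf : ContMDiff 𝓘(ℝ, E') 𝓘(ℝ, E) ∞ f) {ξ : X → E} {η : Y → E'}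
    (hξ : IsSmoothVec ξ)
    (h : ∀ y, (show E' →L[ℝ] E from mfderiv 𝓘(ℝ, E') 𝓘(ℝ, E) f y) (η y) = ξ (f y))
    {α : X → E [⋀^Fin k]→L[ℝ] ℝ} (hα : IsSmoothForm α) :
    pullForm (E' := E') f (lieForm ξ α) = lieForm η (pullForm f α) := by
  cases k with
  | zero =>
    change pullForm (E' := E') f (iForm ξ (dForm α)) = iForm η (dForm (pullForm f α))
    rw [pullForm_iForm h, dForm_pullForm hf hα]
  | succ k =>
    change pullForm (E' := E') f (dForm (iForm ξ α) + iForm ξ (dForm α)) =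
      dForm (iForm η (pullForm f α)) + iForm η (dForm (pullForm f α))
    have h2 : IsSmoothForm (iForm ξ α) := hα.iForm hξ
    rw [pullForm_add, pullForm_iForm h, dForm_pullForm hf hα, ← dForm_pullForm hf h2,
      pullForm_iForm h]

end Pullback

/-! ### Coordinate covariance of the Lie derivative of a field -/

section LocalLie

variable {E : Type*} [NormedAddCommGroup E] [NormedSpace ℝ E]
  {W : Type*} [NormedAddCommGroup W] [NormedSpace ℝ W] (τ : FieldType E W)

/-- The Lie derivative of a field in terms of its representative `F` and the representative `Z` of
the vector field in a chart. -/
noncomputable def lieLocal (Z : E → E) (F : E → W) (u : E) : W :=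
  fderiv ℝ F u (Z u) - fderiv ℝ τ.rep 1 (fderiv ℝ Z u) (F u)

theorem FieldType.rep_apply_mul {A B : E →L[ℝ] E} (hA : IsUnit A) (hB : IsUnit B) (w : W) :
    τ.rep A (τ.rep B w) = τ.rep (A.comp B) w := by
  change (τ.rep A * τ.rep B) w = τ.rep (A * B) w
  rw [τ.rep_mul A B hA hB]

variable [CompleteSpace E]

theorem FieldType.hasFDerivAt_rep_one :
    HasFDerivAt τ.rep (fderiv ℝ τ.rep 1) (1 : E →L[ℝ] E) :=
  ((τ.rep_smooth.contDiffAt (Units.isOpen.mem_nhds isUnit_one)).differentiableAt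
    (by simp)).hasFDerivAt

/-- Differentiate `rep (T (1 + tB) A) = rep T ∘ rep (1 + tB) ∘ rep A` at `t = 0`. Multiplicativity
is available at invertible maps only, and `1 + tB` is invertible for small `t`. -/
theorem FieldType.fderiv_rep_conj {T A : E →L[ℝ] E} (hTA : T.comp A = ContinuousLinearMap.id ℝ E)
    (hAT : A.comp T = ContinuousLinearMap.id ℝ E) (B : E →L[ℝ] E) :
    fderiv ℝ τ.rep 1 (T.comp (B.comp A)) =
      (τ.rep T).comp ((fderiv ℝ τ.rep 1 B).comp (τ.rep A)) := by
  have hT : IsUnit T := ⟨⟨T, A, hTA, hAT⟩, rfl⟩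
  have hA : IsUnit A := ⟨⟨A, T, hAT, hTA⟩, rfl⟩
  have hline : HasDerivAt (fun t : ℝ => (1 : E →L[ℝ] E) + t • B) B 0 := by
    simpa using ((hasDerivAt_id (0 : ℝ)).smul_const B).const_add 1
  have hline2 : HasDerivAt (fun t : ℝ => (1 : E →L[ℝ] E) + t • (T.comp (B.comp A)))
      (T.comp (B.comp A)) 0 := by
    simpa using ((hasDerivAt_id (0 : ℝ)).smul_const (T.comp (B.comp A))).const_add 1
  have h0 : (1 : E →L[ℝ] E) + (0 : ℝ) • B = 1 := by simp
  have h0' : (1 : E →L[ℝ] E) + (0 : ℝ) • (T.comp (B.comp A)) = 1 := by simp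
  have d1 : HasDerivAt (fun t : ℝ => τ.rep (1 + t • B)) (fderiv ℝ τ.rep 1 B) 0 :=
    HasFDerivAt.comp_hasDerivAt (l := τ.rep) (0 : ℝ) (by rw [h0]; exact τ.hasFDerivAt_rep_one) hline
  have d2 : HasDerivAt (fun t : ℝ => τ.rep (1 + t • (T.comp (B.comp A))))
      (fderiv ℝ τ.rep 1 (T.comp (B.comp A))) 0 :=
    HasFDerivAt.comp_hasDerivAt (l := τ.rep) (0 : ℝ) (by rw [h0']; exact τ.hasFDerivAt_rep_one)
      hline2
  have d3 : HasDerivAt (fun t : ℝ => (τ.rep T).comp ((τ.rep (1 + t • B)).comp (τ.rep A)))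
      ((τ.rep T).comp ((fderiv ℝ τ.rep 1 B).comp (τ.rep A))) 0 := by
    have h := (hasDerivAt_const (0 : ℝ) (τ.rep T)).clm_comp
      (d1.clm_comp (hasDerivAt_const (0 : ℝ) (τ.rep A)))
    simpa using h
  refine d2.unique (d3.congr_of_eventuallyEq ?_)
  have hu : ∀ᶠ t : ℝ in nhds 0, IsUnit ((1 : E →L[ℝ] E) + t • B) := by
    refine hline.continuousAt.eventually (p := IsUnit) ?_
    refine Units.isOpen.mem_nhds ?_
    change IsUnit ((1 : E →L[ℝ] E) + (0 : ℝ) • B)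
    rw [h0]
    exact isUnit_one
  filter_upwards [hu] with t ht
  have e : (1 : E →L[ℝ] E) + t • (T.comp (B.comp A)) = T * ((1 + t • B) * A) := by
    have : T * A = 1 := hTA
    rw [add_mul, mul_add, one_mul, this]
    ext v
    simp
  rw [e, τ.rep_mul _ _ hT (ht.mul hA), τ.rep_mul _ _ ht hA]
  rfl

/-- Covariance of the Lie derivative of a field under a change of coordinates. -/
theorem lieLocal_change {g : E → E} {T : E → E →L[ℝ] E} {Z : E → E} {F : E → W} {v : E}
    (hg : ContDiffAt ℝ ∞ g v) (hT : DifferentiableAt ℝ T v)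
    (hTg : ∀ᶠ w in nhds v, (T w).comp (fderiv ℝ g w) = ContinuousLinearMap.id ℝ E)
    (hgT : ∀ᶠ w in nhds v, (fderiv ℝ g w).comp (T w) = ContinuousLinearMap.id ℝ E)
    (hZ : DifferentiableAt ℝ Z (g v)) (hF : DifferentiableAt ℝ F (g v)) :
    lieLocal τ (fun w => T w (Z (g w))) (fun w => τ.rep (T w) (F (g w))) v =
      τ.rep (T v) (lieLocal τ Z F (g v)) := by
  set A := fderiv ℝ g v with hA
  have hTA : (T v).comp A = ContinuousLinearMap.id ℝ E := hTg.self_of_nhds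
  have hAT : A.comp (T v) = ContinuousLinearMap.id ℝ E := hgT.self_of_nhds
  have hATv : ∀ x, A (T v x) = x := fun x => DFunLike.congr_fun hAT x
  have hTunit : ∀ᶠ w in nhds v, IsUnit (T w) := by
    filter_upwards [hTg, hgT] with w h1 h2
    exact ⟨⟨T w, fderiv ℝ g w, h1, h2⟩, rfl⟩
  have hAunit : IsUnit A := ⟨⟨A, T v, hAT, hTA⟩, rfl⟩
  set DT := fderiv ℝ T v with hDT
  have dT : HasFDerivAt T DT v := hT.hasFDerivAt
  have dg : HasFDerivAt g A v := (hg.differentiableAt (by simp)).hasFDerivAt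
  have dF : HasFDerivAt (fun w => F (g w)) ((fderiv ℝ F (g v)).comp A) v :=
    hF.hasFDerivAt.comp v dg
  have dZ : HasFDerivAt (fun w => Z (g w)) ((fderiv ℝ Z (g v)).comp A) v :=
    hZ.hasFDerivAt.comp v dg
  -- the derivative of `τ.rep (T w)`
  have drep : HasFDerivAt (fun w => τ.rep (T w))
      (((ContinuousLinearMap.compL ℝ W W W).flip (τ.rep (T v))).comp
        ((fderiv ℝ τ.rep 1).comp (((ContinuousLinearMap.compL ℝ E E E).flip A).comp DT))) v := by
    have h1 : HasFDerivAt (fun w => (T w).comp A)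
        (((ContinuousLinearMap.compL ℝ E E E).flip A).comp DT) v :=
      ((ContinuousLinearMap.compL ℝ E E E).flip A).hasFDerivAt.comp v dT
    have h2 : HasFDerivAt (fun w => τ.rep ((T w).comp A))
        ((fderiv ℝ τ.rep 1).comp (((ContinuousLinearMap.compL ℝ E E E).flip A).comp DT)) v :=
      HasFDerivAt.comp (g := τ.rep) v (by
        have h3 : (T v).comp A = 1 := hTA
        rw [h3]; exact τ.hasFDerivAt_rep_one) h1
    have h3 := ((ContinuousLinearMap.compL ℝ W W W).flip (τ.rep (T v))).hasFDerivAt.comp v h2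
    -- Since `A` is inverse to `T v`, `rep (T w) = rep (T w ∘ A) ∘ rep (T v)` with `T w ∘ A = 1` at
    -- `w = v`; so only the derivative of `rep` at the identity is needed.
    refine h3.congr_of_eventuallyEq ?_
    filter_upwards [hTunit] with w hw
    ext x
    change τ.rep (T w) x = τ.rep ((T w).comp A) (τ.rep (T v) x)
    rw [τ.rep_apply_mul (A := (T w).comp A) (hw.mul hAunit) hTunit.self_of_nhds]
    congr 2
    ext y
    exact congrArg (T w) (hATv y).symm
  have dF1 := drep.clm_apply dF
  have dZ1 := dT.clm_apply dZ
  -- the derivative of the inverse Jacobian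
  have hsymm : ∀ h k, DT h (A k) = DT k (A h) := by
    have hD2 : DifferentiableAt ℝ (fderiv ℝ g) v :=
      (hg.fderiv_right (m := 1) (by norm_cast)).differentiableAt (by simp)
    have h1 := dT.clm_comp hD2.hasFDerivAt
    have h2 := h1.congr_of_eventuallyEq (f₁ := fun _ => ContinuousLinearMap.id ℝ E)
      (hTg.mono fun w hw => hw.symm)
    have h3 := h2.unique (hasFDerivAt_const _ v)
    -- This is the derivative of `T ∘ Dg = id`; symmetry of `D²g` then gives the claim.
    have h4 : ∀ h k, DT h (A k) = - T v (fderiv ℝ (fderiv ℝ g) v h k) := by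
      intro h k
      have h5 := DFunLike.congr_fun (DFunLike.congr_fun h3 h) k
      simp only [add_apply, ContinuousLinearMap.comp_apply,
        ContinuousLinearMap.compL_apply, ContinuousLinearMap.flip_apply,
        zero_apply] at h5
      rw [← hA] at h5
      rw [eq_neg_iff_add_eq_zero, add_comm]
      exact h5
    intro h k
    have hs : IsSymmSndFDerivAt ℝ g v :=
      hg.isSymmSndFDerivAt (by simp [minSmoothness_of_isRCLikeNormedField]; norm_cast)
    rw [h4, h4, hs h k]
  -- Symmetry turns `k ↦ DT k (Z)` into `DT (T Z) ∘ A`, which is exactly the term that the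
  -- derivative of `rep (T w)` along `T Z` produces. The two inhomogeneous terms therefore cancel
  -- below.
  have hDZ1 : fderiv ℝ (fun w => T w (Z (g w))) v =
      (DT (T v (Z (g v)))).comp A + (T v).comp ((fderiv ℝ Z (g v)).comp A) := by
    rw [dZ1.fderiv]
    ext k
    simp only [add_apply, ContinuousLinearMap.comp_apply,
      ContinuousLinearMap.flip_apply]
    rw [hsymm, hATv, add_comm]
  unfold lieLocal
  rw [hDZ1, dF1.fderiv, map_add, τ.fderiv_rep_conj hTA hAT]
  simp only [add_apply, ContinuousLinearMap.comp_apply,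
    ContinuousLinearMap.flip_apply, ContinuousLinearMap.compL_apply, hATv, map_sub]
  have h6 : τ.rep A (τ.rep (T v) (F (g v))) = F (g v) := by
    rw [τ.rep_apply_mul hAunit hTunit.self_of_nhds, hAT]
    exact DFunLike.congr_fun τ.rep_one _
  rw [h6]
  abel

end LocalLie

/-! ### Fields in charts and smoothness of `£_ξ φ` -/

section FieldsInCharts

variable {E : Type*} [NormedAddCommGroup E] [NormedSpace ℝ E]
  {W : Type*} [NormedAddCommGroup W] [NormedSpace ℝ W]
  {M : Type*} [TopologicalSpace M] [ChartedSpace E M] [IsManifold 𝓘(ℝ, E) ∞ M]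
  {τ : FieldType E W}
  {P P' : Type*} [NormedAddCommGroup P] [NormedSpace ℝ P] [NormedAddCommGroup P'] [NormedSpace ℝ P']

/-- The linear maps that take the values of a field to its representatives in charts. -/
noncomputable def fieldRep (τ : FieldType E W) (x₀ : M) (u : E) : W →L[ℝ] W :=
  τ.rep (tangentCoordChange 𝓘(ℝ, E) ((chartAt E x₀).symm u) x₀ ((chartAt E x₀).symm u))

theorem fieldRep_self (x : M) :
    fieldRep τ x (chartAt E x x) = ContinuousLinearMap.id ℝ W := by
  unfold fieldRep
  rw [(chartAt E x).left_inv (mem_chart_source E x), coordChange_self (mem_chart_source E x)]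
  exact τ.rep_one

theorem fieldInChart_self (φ : M → W) (x : M) : fieldInChart τ φ x (chartAt E x x) = φ x := by
  unfold fieldInChart
  rw [(chartAt E x).left_inv (mem_chart_source E x), coordChange_self (mem_chart_source E x)]
  exact DFunLike.congr_fun τ.rep_one _

theorem fieldInChart_transition (φ : M → W) {x₀ x₁ : M} {u : E} (hu : u ∈ overlap E x₀ x₁) :
    fieldInChart τ φ x₁ (transition E x₀ x₁ u) =
      τ.rep (tangentCoordChange 𝓘(ℝ, E) x₀ x₁ ((chartAt E x₀).symm u)) (fieldInChart τ φ x₀ u) := by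
  rw [mem_overlap] at hu
  unfold fieldInChart transition
  have h := (chartAt E x₀).map_target hu.1
  rw [(chartAt E x₁).left_inv hu.2, τ.rep_apply_mul (isUnit_coordChange h hu.2)
    (isUnit_coordChange (mem_chart_source E _) h),
    coordChange_comp (mem_chart_source E _) h hu.2]

/-- `lieField` is defined in a chart that changes with the point; `lieLocal_change`, applied to the
transition into the fixed chart, shows that the fixed chart gives the same result. This makes `hat`
preserve smooth families. -/
theorem fieldInChart_lieField [CompleteSpace E] {ξ : M → E} {φ : M → W} {x₀ : M}
    (hξ : ContDiffOn ℝ ∞ (vecInChart ξ x₀) (chartAt E x₀).target)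
    (hφ : ContDiffOn ℝ ∞ (fieldInChart τ φ x₀) (chartAt E x₀).target) {u : E}
    (hu : u ∈ (chartAt E x₀).target) :
    fieldInChart τ (lieField τ ξ φ) x₀ u =
      lieLocal τ (vecInChart ξ x₀) (fieldInChart τ φ x₀) u := by
  set y := (chartAt E x₀).symm u with hy
  have hys : y ∈ (chartAt E x₀).source := (chartAt E x₀).map_target hu
  have hv : chartAt E y y ∈ overlap E y x₀ := by
    rw [mem_overlap]
    refine ⟨mem_chart_target E y, ?_⟩
    rwa [(chartAt E y).left_inv (mem_chart_source E y)]
  have hsymm : (chartAt E y).symm (chartAt E y y) = y :=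
    (chartAt E y).left_inv (mem_chart_source E y)
  have htr : transition E y x₀ (chartAt E y y) = u := by
    unfold transition
    rw [hsymm, (chartAt E x₀).right_inv hu]
  set T : E → E →L[ℝ] E := fun v =>
    tangentCoordChange 𝓘(ℝ, E) x₀ y ((chartAt E x₀).symm (transition E y x₀ v)) with hT
  have hTy : T (chartAt E y y) = tangentCoordChange 𝓘(ℝ, E) x₀ y y := by
    rw [hT]; simp only; rw [htr]
  have hev := (isOpen_overlap (E := E) y x₀).eventually_mem hv
  have e1 : vecInChart ξ y =ᶠ[nhds (chartAt E y y)]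
      fun v => T v (vecInChart ξ x₀ (transition E y x₀ v)) := by
    filter_upwards [hev] with v hv
    have h := vecInChart_transition ξ (transition_mem_overlap hv)
    rwa [transition_transition hv] at h
  have e2 : fieldInChart τ φ y =ᶠ[nhds (chartAt E y y)]
      fun v => τ.rep (T v) (fieldInChart τ φ x₀ (transition E y x₀ v)) := by
    filter_upwards [hev] with v hv
    have h := fieldInChart_transition (τ := τ) φ (transition_mem_overlap hv)
    rwa [transition_transition hv] at h
  have hg : ContDiffAt ℝ ∞ (transition E y x₀) (chartAt E y y) :=
    (contDiffOn_transition y x₀).contDiffAt ((isOpen_overlap y x₀).mem_nhds hv)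
  have hTd : DifferentiableAt ℝ T (chartAt E y y) := by
    have h1 : ContDiffAt ℝ ∞ (fun w => tangentCoordChange 𝓘(ℝ, E) x₀ y ((chartAt E x₀).symm w))
        (transition E y x₀ (chartAt E y y)) :=
      (contDiffOn_coordChange x₀ y).contDiffAt
        ((isOpen_overlap x₀ y).mem_nhds (transition_mem_overlap hv))
    exact (h1.comp _ hg).differentiableAt (by simp)
  have hTg : ∀ᶠ w in nhds (chartAt E y y),
      (T w).comp (fderiv ℝ (transition E y x₀) w) = ContinuousLinearMap.id ℝ E := by
    filter_upwards [hev] with w hw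
    rw [hT]; simp only
    rw [(hasFDerivAt_transition' hw).fderiv, chart_symm_transition hw]
    rw [mem_overlap] at hw
    have := (chartAt E y).map_target hw.1
    rw [coordChange_comp this hw.2 this, coordChange_self this]
  have hgT : ∀ᶠ w in nhds (chartAt E y y),
      (fderiv ℝ (transition E y x₀) w).comp (T w) = ContinuousLinearMap.id ℝ E := by
    filter_upwards [hev] with w hw
    rw [hT]; simp only
    rw [(hasFDerivAt_transition' hw).fderiv, chart_symm_transition hw]
    rw [mem_overlap] at hw
    have := (chartAt E y).map_target hw.1
    rw [coordChange_comp hw.2 this hw.2, coordChange_self hw.2]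
  have hdZ : DifferentiableAt ℝ (vecInChart ξ x₀) (transition E y x₀ (chartAt E y y)) := by
    rw [htr]
    exact (hξ.contDiffAt ((chartAt E x₀).open_target.mem_nhds hu)).differentiableAt (by simp)
  have hdF : DifferentiableAt ℝ (fieldInChart τ φ x₀) (transition E y x₀ (chartAt E y y)) := by
    rw [htr]
    exact (hφ.contDiffAt ((chartAt E x₀).open_target.mem_nhds hu)).differentiableAt (by simp)
  have key := lieLocal_change τ hg hTd hTg hgT hdZ hdF
  rw [htr, hTy] at key
  have h1 : lieField τ ξ φ y = lieLocal τ (vecInChart ξ y) (fieldInChart τ φ y) (chartAt E y y) := by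
    unfold lieField lieLocal
    rw [vecInChart_self, fieldInChart_self]
  have h2 : lieLocal τ (vecInChart ξ y) (fieldInChart τ φ y) (chartAt E y y) =
      lieLocal τ (fun v => T v (vecInChart ξ x₀ (transition E y x₀ v)))
        (fun v => τ.rep (T v) (fieldInChart τ φ x₀ (transition E y x₀ v))) (chartAt E y y) := by
    unfold lieLocal
    rw [e1.fderiv_eq, e2.fderiv_eq, e1.self_of_nhds, e2.self_of_nhds]
  rw [fieldInChart, ← hy, h1, h2, key, τ.rep_apply_mul
    (isUnit_coordChange (mem_chart_source E y) hys) (isUnit_coordChange hys (mem_chart_source E y)),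
    coordChange_comp hys (mem_chart_source E y) hys, coordChange_self hys]
  exact DFunLike.congr_fun τ.rep_one _

namespace SmoothFieldFamily

variable {φ ψ : P → M → W}

theorem inCharts (hφ : SmoothFieldFamily τ φ) : SmoothInCharts (fieldRep τ) φ := hφ

theorem comp (hφ : SmoothFieldFamily τ φ) {g : P' → P} (hg : ContDiff ℝ ∞ g) :
    SmoothFieldFamily τ fun s => φ (g s) := hφ.inCharts.comp hg

theorem add (hφ : SmoothFieldFamily τ φ) (hψ : SmoothFieldFamily τ ψ) :
    SmoothFieldFamily τ fun s => φ s + ψ s := hφ.inCharts.add hψ.inCharts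

theorem sub (hφ : SmoothFieldFamily τ φ) (hψ : SmoothFieldFamily τ ψ) :
    SmoothFieldFamily τ fun s => φ s - ψ s := hφ.inCharts.sub hψ.inCharts

theorem smul (hφ : SmoothFieldFamily τ φ) {a : P → ℝ} (ha : ContDiff ℝ ∞ a) :
    SmoothFieldFamily τ fun s => a s • φ s := fun x₀ => by
  have h := (ha.comp contDiff_fst).contDiffOn.smul (hφ x₀)
  refine h.congr fun q _ => ?_
  simp [fieldInChart]

theorem deriv_right {φ : P × ℝ → M → W} (hφ : SmoothFieldFamily τ φ) :
    SmoothFieldFamily τ fun (p : P × ℝ) y => deriv (fun t => φ (p.1, t) y) p.2 :=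
  hφ.inCharts.deriv_right fieldRep_self

/-- Reparametrization of a smooth family of fields by parameters that vary with the point. -/
theorem reparam (hφ : SmoothFieldFamily τ φ) {g : P' → M → P}
    (hg : ∀ x₀ : M, ContDiffOn ℝ ∞ (fun q : P' × E => g q.1 ((chartAt E x₀).symm q.2))
      (univ ×ˢ (chartAt E x₀).target)) :
    SmoothFieldFamily τ fun s x => φ (g s x) x := fun x₀ =>
  (hφ x₀).comp (f := fun q : P' × E => ((g q.1 ((chartAt E x₀).symm q.2), q.2) : P × E))
    ((hg x₀).prodMk contDiff_snd.contDiffOn) fun _ hq => ⟨mem_univ _, hq.2⟩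

/-- The Lie derivative of a smooth family of fields along a smooth family of vector fields. -/
theorem lieField [CompleteSpace E] (hφ : SmoothFieldFamily τ φ) {ξ : P → M → E}
    (hξ : SmoothVecFamily ξ) : SmoothFieldFamily τ fun s => lieField τ (ξ s) (φ s) := fun x₀ => by
  have hO := (chartAt E x₀).open_target
  have h1 := contDiffOn_partial_fderiv (f := fun s u => fieldInChart τ (φ s) x₀ u) hO (hφ x₀)
  have h2 := contDiffOn_partial_fderiv (f := fun s u => vecInChart (ξ s) x₀ u) hO (hξ x₀)
  have h3 := (h1.clm_apply (hξ x₀)).sub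
    (((fderiv ℝ τ.rep 1).contDiff.comp_contDiffOn h2).clm_apply (hφ x₀))
  refine h3.congr fun q hq => ?_
  exact fieldInChart_lieField
    (contDiffOn_slice (f := fun s u => vecInChart (ξ s) x₀ u) q.1 (hξ x₀))
    (contDiffOn_slice (f := fun s u => fieldInChart τ (φ s) x₀ u) q.1 (hφ x₀)) hq.2

end SmoothFieldFamily

/-- Invariance of `dom` under a change of frame and under its inverse lets admissibility be tested
in a fixed chart, where it is an open condition. -/
theorem fieldInChart_mem_dom {φ : M → W} {x₀ : M} {u : E} (hu : u ∈ (chartAt E x₀).target) :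
    fieldInChart τ φ x₀ u ∈ τ.dom ↔ φ ((chartAt E x₀).symm u) ∈ τ.dom := by
  have hys := (chartAt E x₀).map_target hu
  refine ⟨fun h => ?_, fun h =>
    τ.dom_invariant _ (isUnit_coordChange (mem_chart_source E _) hys) _ h⟩
  have h2 := τ.dom_invariant _ (isUnit_coordChange hys (mem_chart_source E _)) _ h
  rw [fieldInChart, τ.rep_apply_mul (isUnit_coordChange hys (mem_chart_source E _))
    (isUnit_coordChange (mem_chart_source E _) hys), coordChange_comp (mem_chart_source E _) hys
    (mem_chart_source E _), coordChange_self (mem_chart_source E _)] at h2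
  rwa [show τ.rep (ContinuousLinearMap.id ℝ E) = 1 from τ.rep_one] at h2

end FieldsInCharts

/-! ### Parameter integrals, Hadamard's lemma, and a derivative along the diagonal -/

section Hadamard

variable {P E B : Type*} [NormedAddCommGroup P] [NormedSpace ℝ P] [NormedAddCommGroup E]
  [NormedSpace ℝ E] [NormedAddCommGroup B] [NormedSpace ℝ B]

/-- The integral is the value at `0` of the convolution of the indicator of `(0, 1]` with `x ↦ χ x •
h p (-x)`. The bump `χ` supplies the compact support required for smoothness of convolutions with
parameters, and equals 1 for `|x| ≤ 2`, so it does not affect the integral. -/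
theorem contDiffOn_intervalIntegral {h : P → ℝ → B} {s : Set P} (hs : IsOpen s)
    (hh : ContDiffOn ℝ ∞ (fun q : P × ℝ => h q.1 q.2) (s ×ˢ univ)) :
    ContDiffOn ℝ ∞ (fun p => ∫ x in (0 : ℝ)..1, h p x) s := by
  let χ : ContDiffBump (0 : ℝ) := ⟨2, 3, by norm_num, by norm_num⟩
  let f : ℝ → ℝ := (Ioc (0 : ℝ) 1).indicator 1
  let g : P → ℝ → B := fun p x => χ x • h p (-x)
  have hf : MeasureTheory.LocallyIntegrable f MeasureTheory.volume := by
    refine MeasureTheory.Integrable.locallyIntegrable ?_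
    exact (MeasureTheory.integrable_indicator_iff measurableSet_Ioc).2
      (MeasureTheory.integrableOn_const (C := (1 : ℝ)) (by simp))
  have hg : ContDiffOn ℝ ∞ (fun q : P × ℝ => g q.1 q.2) (s ×ˢ univ) := by
    refine ContDiffOn.smul ?_ ?_
    · exact (χ.contDiff.comp contDiff_snd).contDiffOn
    · exact hh.comp (f := fun q : P × ℝ => ((q.1, -q.2) : P × ℝ))
        (contDiff_fst.prodMk contDiff_snd.neg).contDiffOn fun q hq => ⟨hq.1, mem_univ _⟩
  have key := MeasureTheory.contDiffOn_convolution_right_with_param (n := ⊤)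
    (μ := MeasureTheory.volume) (ContinuousLinearMap.lsmul ℝ ℝ)
    (f := f) (g := g) (k := Metric.closedBall 0 3) hs (isCompact_closedBall _ _)
    (fun p x _ hx => by
      have : χ x = 0 := χ.zero_of_le_dist (by
        rw [Metric.mem_closedBall, not_le] at hx; exact hx.le)
      simp [g, this]) hf hg
  have key2 := key.comp (f := fun p : P => ((p, 0) : P × ℝ))
    (contDiff_id.prodMk contDiff_const).contDiffOn fun p hp => ⟨hp, mem_univ _⟩
  refine key2.congr fun p _ => ?_
  simp only [MeasureTheory.convolution, Function.comp_apply, ContinuousLinearMap.lsmul_apply, zero_sub]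
  rw [intervalIntegral.integral_of_le zero_le_one, ← MeasureTheory.integral_indicator
    measurableSet_Ioc]
  congr 1
  funext x
  by_cases hx : x ∈ Ioc (0 : ℝ) 1
  · have h1 : χ (-x) = 1 := χ.one_of_mem_closedBall (by
      rw [Metric.mem_closedBall, dist_zero_right, norm_neg, Real.norm_eq_abs, abs_of_pos hx.1]
      exact hx.2.trans (by norm_num [χ]))
    simp [f, g, hx, h1]
  · simp [f, hx]

theorem dslope_zero_eq_integral [CompleteSpace B] {g : ℝ → B} (hg : ContDiff ℝ ∞ g) (t : ℝ) :
    dslope g 0 t = ∫ x in (0 : ℝ)..1, deriv g (x * t) := by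
  have hg' : Continuous (deriv g) := hg.continuous_deriv (by simp)
  rcases eq_or_ne t 0 with rfl | ht
  · simp
  · have h1 : ∀ x ∈ uIcc (0 : ℝ) 1, HasDerivAt (fun x => g (x * t)) (t • deriv g (x * t)) x := by
      intro x _
      have := ((hg.differentiable (by simp)) (x * t)).hasDerivAt.scomp x
        ((hasDerivAt_id x).mul_const t)
      simp only [id_eq, one_mul] at this
      exact this
    have h2 := intervalIntegral.integral_eq_sub_of_hasDerivAt h1
      (Continuous.intervalIntegrable (by fun_prop) _ _)
    rw [intervalIntegral.integral_smul] at h2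
    rw [dslope_of_ne _ ht, slope_def_module]
    simp only [one_mul, zero_mul] at h2
    rw [← h2, sub_zero, smul_smul, inv_mul_cancel₀ ht, one_smul]

/-- Hadamard's lemma with parameters. -/
theorem contDiffOn_dslope [CompleteSpace B] {G : ℝ → E → B} {O : Set E} (hO : IsOpen O)
    (hG : ContDiffOn ℝ ∞ (fun q : ℝ × E => G q.1 q.2) (univ ×ˢ O)) :
    ContDiffOn ℝ ∞ (fun q : ℝ × E => dslope (fun t => G t q.2) 0 q.1) (univ ×ˢ O) := by
  have h0 : ContDiffOn ℝ ∞ (fun q : E × ℝ => deriv (fun t => G t q.1) q.2) (O ×ˢ univ) := by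
    intro q hq
    have hmem : univ ×ˢ O ∈ nhds ((q.2, q.1) : ℝ × E) :=
      (isOpen_univ.prod hO).mem_nhds ⟨mem_univ _, hq.1⟩
    have h2 : ContDiffAt ℝ ∞ (Function.uncurry fun (q : E × ℝ) (t : ℝ) => G t q.1) (q, q.2) := by
      refine ContDiffAt.comp (x := (q, q.2))
        (f := fun r : (E × ℝ) × ℝ => ((r.2, r.1.1) : ℝ × E))
        (g := fun q : ℝ × E => G q.1 q.2) ((hG (q.2, q.1) ⟨mem_univ _, hq.1⟩).contDiffAt hmem) ?_
      exact ContDiff.contDiffAt (by fun_prop)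
    have h3 := (ContDiffAt.fderiv (m := ∞) (g := fun q : E × ℝ => q.2) h2
      contDiffAt_snd (by simp)).clm_apply (contDiffAt_const (c := (1 : ℝ)))
    simpa only [fderiv_apply_one_eq_deriv] using h3.contDiffWithinAt
  have h1 : ContDiffOn ℝ ∞
      (fun q : (ℝ × E) × ℝ => deriv (fun t => G t q.1.2) (q.2 * q.1.1)) ((univ ×ˢ O) ×ˢ univ) :=
    h0.comp (f := fun q : (ℝ × E) × ℝ => ((q.1.2, q.2 * q.1.1) : E × ℝ))
      (ContDiff.contDiffOn (by fun_prop)) fun q hq => ⟨hq.1.2, mem_univ _⟩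
  refine (contDiffOn_intervalIntegral
    (h := fun (q : ℝ × E) (x : ℝ) => deriv (fun t => G t q.2) (x * q.1))
    (isOpen_univ.prod hO) h1).congr fun q hq => ?_
  exact dslope_zero_eq_integral (contDiff_slice_left hq.2 hG) q.1

/-- Constancy along the first axis kills the first partial derivative. In this way two curves that
are the diagonal and the axis of one family are shown to give equal derivatives. -/
theorem deriv_diagonal {F : ℝ × ℝ → B} (hF : DifferentiableAt ℝ F (0, 0))
    (h : ∀ s, F (s, 0) = F (0, 0)) :
    deriv (fun t => F (t, t)) 0 = deriv (fun t => F (0, t)) 0 := by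
  have d1 : HasDerivAt (fun t : ℝ => F (t, t)) (fderiv ℝ F (0, 0) (1, 1)) 0 :=
    HasFDerivAt.comp_hasDerivAt (l := F) (f := fun t : ℝ => ((t, t) : ℝ × ℝ)) (0 : ℝ)
      hF.hasFDerivAt ((hasDerivAt_id 0).prodMk (hasDerivAt_id 0))
  have d2 : HasDerivAt (fun t : ℝ => F (0, t)) (fderiv ℝ F (0, 0) (0, 1)) 0 :=
    HasFDerivAt.comp_hasDerivAt (l := F) (f := fun t : ℝ => ((0, t) : ℝ × ℝ)) (0 : ℝ)
      hF.hasFDerivAt ((hasDerivAt_const 0 0).prodMk (hasDerivAt_id 0))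
  have d3 : HasDerivAt (fun t : ℝ => F (t, 0)) (fderiv ℝ F (0, 0) (1, 0)) 0 :=
    HasFDerivAt.comp_hasDerivAt (l := F) (f := fun t : ℝ => ((t, 0) : ℝ × ℝ)) (0 : ℝ)
      hF.hasFDerivAt ((hasDerivAt_id 0).prodMk (hasDerivAt_const 0 0))
  have h0 : fderiv ℝ F (0, 0) (1, 0) = 0 := by
    have : (fun t : ℝ => F (t, 0)) = fun _ => F (0, 0) := funext h
    rw [this] at d3
    exact d3.unique (hasDerivAt_const _ _)
  rw [d1.deriv, d2.deriv, show ((1, 1) : ℝ × ℝ) = (1, 0) + (0, 1) by simp, map_add, h0, zero_add]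

end Hadamard

/-! ### Slowing down time -/

section BoundedTime

/-- A reparametrization of time with values in `[-e, e]` that is tangent to the identity. -/
noncomputable def boundedTime (e t : ℝ) : ℝ := t * (e ^ 2 / (e ^ 2 + t ^ 2))

theorem abs_boundedTime_le {e : ℝ} (he : 0 < e) (t : ℝ) : |boundedTime e t| ≤ e := by
  have hp : 0 < e ^ 2 + t ^ 2 := by positivity
  rw [boundedTime, abs_mul, abs_of_nonneg (by positivity : 0 ≤ e ^ 2 / (e ^ 2 + t ^ 2)), ← mul_div_assoc,
    div_le_iff₀ hp]
  have := abs_nonneg t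
  rw [← sq_abs t]
  -- The claim is `e (e² - e|t| + t²) ≥ 0`, and the bracket is `(e - |t|)² + e|t|`.
  nlinarith [mul_nonneg he.le (sq_nonneg (e - |t|)), mul_nonneg he.le (mul_nonneg he.le this),
    pow_pos he 3]

theorem boundedTime_zero (e : ℝ) : boundedTime e 0 = 0 := by simp [boundedTime]

/-- Displays slowed time as the diagonal `s = t` of the time function `t - s t² / (e² + t²)`, whose
axis `s = 0` is ordinary time. -/
theorem boundedTime_eq {e : ℝ} (he : 0 < e) (t : ℝ) :
    boundedTime e t = t + t * (-(t ^ 2 / (e ^ 2 + t ^ 2))) := by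
  have hp : e ^ 2 + t ^ 2 ≠ 0 := by positivity
  unfold boundedTime
  field_simp
  ring

variable {P : Type*} [NormedAddCommGroup P] [NormedSpace ℝ P]

theorem ContDiffOn_boundedTime {e t : P → ℝ} {s : Set P} (he : ContDiffOn ℝ ∞ e s)
    (ht : ContDiffOn ℝ ∞ t s) (hpos : ∀ p ∈ s, 0 < e p) :
    ContDiffOn ℝ ∞ (fun p => boundedTime (e p) (t p)) s :=
  ht.mul ((he.pow 2).div ((he.pow 2).add (ht.pow 2)) fun p hp => by
    have := hpos p hp; positivity)

theorem hasDerivAt_boundedTime {e : ℝ} (he : 0 < e) : HasDerivAt (boundedTime e) 1 0 := by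
  have h1 : HasDerivAt (fun t : ℝ => e ^ 2 / (e ^ 2 + t ^ 2)) 0 0 := by
    have h := (hasDerivAt_const (0 : ℝ) (e ^ 2)).div
      (((hasDerivAt_id (0 : ℝ)).pow 2).const_add (e ^ 2)) (by simp; positivity)
    simp only [id_eq, Nat.cast_ofNat, zero_mul, mul_one, Nat.add_one_sub_one, pow_one, mul_zero,
      sub_zero, zero_div] at h
    exact h
  have h2 := (hasDerivAt_id (0 : ℝ)).mul h1
  have he2 : e ^ 2 ≠ 0 := by positivity
  refine h2.congr_deriv ?_
  simp [he2]

end BoundedTime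

/-! ### How long a family of fields stays admissible -/

section Cutoff

variable {E : Type*} [NormedAddCommGroup E] [NormedSpace ℝ E] [FiniteDimensional ℝ E]
  {W : Type*} [NormedAddCommGroup W] [NormedSpace ℝ W]
  {M : Type*} [TopologicalSpace M] [T2Space M] [SigmaCompactSpace M] [ChartedSpace E M]
  [IsManifold 𝓘(ℝ, E) ∞ M]
  {τ : FieldType E W}
  {Q : Type*} [NormedAddCommGroup Q] [NormedSpace ℝ Q]

/-- If the fields of a smooth family have admissible values for the parameters in a compact set,
then they have admissible values at `x` for the parameters within distance `ε x` of that set. -/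
theorem SmoothFieldFamily.exists_cutoff {ψ : Q → M → W} (hψ : SmoothFieldFamily τ ψ) {K : Set Q}
    (hK : IsCompact K) (hdom : ∀ q ∈ K, ∀ x, ψ q x ∈ τ.dom) :
    ∃ ε : M → ℝ, (∀ x, 0 < ε x) ∧
      (∀ x₀ : M, ContDiffOn ℝ ∞ (fun u => ε ((chartAt E x₀).symm u)) (chartAt E x₀).target) ∧
      ∀ x, ∀ k ∈ K, ∀ q, dist q k ≤ ε x → ψ q x ∈ τ.dom := by
  -- A partition of unity glues local constants, because the admissible radii at a point form an
  -- interval: shrinking a good positive radius keeps it good.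
  obtain ⟨g, hg⟩ := exists_contMDiffMap_forall_mem_convex_of_local_const (n := ⊤) (F := ℝ) 𝓘(ℝ, E)
    (t := fun x : M => {e : ℝ | 0 < e ∧ ∀ k ∈ K, ∀ q, dist q k ≤ e → ψ q x ∈ τ.dom})
    (fun x => by
      refine OrdConnected.convex ⟨?_⟩
      rintro a ⟨ha, -⟩ b ⟨-, hb⟩ c ⟨hac, hcb⟩
      exact ⟨ha.trans_le hac, fun k hk q hq => hb k hk q (hq.trans hcb)⟩)
    (fun x => by
      set N : Set (Q × E) := (univ ×ˢ (chartAt E x).target) ∩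
        (fun q : Q × E => fieldInChart τ (ψ q.1) x q.2) ⁻¹' τ.dom with hN
      have hNo : IsOpen N := (hψ x).continuousOn.isOpen_inter_preimage
        (isOpen_univ.prod (chartAt E x).open_target) τ.dom_open
      have hsub : K ×ˢ {chartAt E x x} ⊆ N := by
        rintro ⟨q, u⟩ ⟨hq, hu⟩
        rw [mem_singleton_iff] at hu
        simp only at hu hq
        subst hu
        refine ⟨⟨mem_univ _, mem_chart_target E x⟩, ?_⟩
        simp only [mem_preimage]
        rw [fieldInChart_self]
        exact hdom q hq x
      -- Compactness of `K` gives one radius that works for all nearby points.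
      obtain ⟨V, O, hV, hO, hKV, huO, hVO⟩ := generalized_tube_lemma hK isCompact_singleton hNo hsub
      obtain ⟨δ, hδ, hδV⟩ := hK.exists_cthickening_subset_open hV hKV
      refine ⟨δ, ?_⟩
      have h1 : ∀ᶠ y in nhds x, chartAt E x y ∈ O :=
        ((chartAt E x).continuousAt (mem_chart_source E x)).eventually
          (hO.mem_nhds (huO rfl))
      filter_upwards [h1, (chartAt E x).open_source.mem_nhds (mem_chart_source E x)] with y hy hys
      refine ⟨hδ, fun k hk q hq => ?_⟩
      have h2 : (q, chartAt E x y) ∈ N :=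
        hVO ⟨hδV (Metric.mem_cthickening_of_dist_le q k δ K hk hq), hy⟩
      have h3 := (fieldInChart_mem_dom ((chartAt E x).map_source hys)).1 h2.2
      rwa [(chartAt E x).left_inv hys] at h3)
  refine ⟨g, fun x => (hg x).1, fun x₀ => ?_, fun x => (hg x).2⟩
  have h := g.contMDiff.comp_contMDiffOn (contMDiffOn_chart_symm (I := 𝓘(ℝ, E)) (x := x₀))
  exact contMDiffOn_iff_contDiffOn.1 h

end Cutoff

/-! ### Calculus on field space: derivatives along curves -/

section Vary

variable {E : Type*} [NormedAddCommGroup E] [NormedSpace ℝ E]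
  {W : Type*} [NormedAddCommGroup W] [NormedSpace ℝ W]
  {M : Type*} [TopologicalSpace M] [ChartedSpace E M] [IsManifold 𝓘(ℝ, E) ∞ M]
  {τ : FieldType E W}
  {A : Type*} [NormedAddCommGroup A] [NormedSpace ℝ A]

/-- A function on field space that is smooth along smooth finite-dimensional families of fields. -/
def IsSmoothFunctional (τ : FieldType E W) (f : (M → W) → A) : Prop :=
  ∀ (P : Type) [NormedAddCommGroup P] [NormedSpace ℝ P] [FiniteDimensional ℝ P] (c : P → M → W),
    ConfigFamily τ c → ContDiff ℝ ∞ fun s => f (c s)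

theorem ConfigFamily.comp {P P' : Type*} [NormedAddCommGroup P] [NormedSpace ℝ P]
    [NormedAddCommGroup P'] [NormedSpace ℝ P'] {c : P → M → W} (hc : ConfigFamily τ c) {g : P' → P}
    (hg : ContDiff ℝ ∞ g) : ConfigFamily τ fun s => c (g s) :=
  ⟨hc.1.comp hg, fun s x => hc.2 (g s) x⟩

theorem ConfigFamily.mem_fieldSpace {P : Type*} [NormedAddCommGroup P] [NormedSpace ℝ P]
    {c : P → M → W} (hc : ConfigFamily τ c) (s : P) : c s ∈ fieldSpace τ :=
  hc.comp (g := fun _ : ℝ => s) contDiff_const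

theorem IsCurve.mem_fieldSpace {c : ℝ → M → W} {φ V : M → W} (h : IsCurve τ c φ V) :
    φ ∈ fieldSpace τ := by
  rw [← h.2.1]; exact h.1.mem_fieldSpace 0

theorem IsCurve.isVariation {c : ℝ → M → W} {φ V : M → W} (h : IsCurve τ c φ V) :
    IsVariation τ V := by
  have h1 := SmoothFieldFamily.deriv_right (P := ℝ)
    (h.1.1.comp (g := fun p : ℝ × ℝ => p.2) contDiff_snd)
  have h2 := h1.comp (g := fun _ : ℝ => ((0, 0) : ℝ × ℝ)) contDiff_const
  have h3 : V = fun y => deriv (fun t => c t y) 0 := funext fun y => (h.2.2 y).deriv.symm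
  rw [h3]
  exact h2

/-- Slowing a curve down without changing its velocity does not change derivatives along it. -/
theorem ConfigFamily.deriv_slowed {c : ℝ → M → W} (hc : ConfigFamily τ c) {ε : M → ℝ}
    (hε : ∀ x, 0 < ε x)
    (hεs : ∀ x₀ : M, ContDiffOn ℝ ∞ (fun u => ε ((chartAt E x₀).symm u)) (chartAt E x₀).target)
    {f : (M → W) → A} (hf : IsSmoothFunctional τ f) :
    deriv (fun t => f fun x => c (boundedTime (ε x) t) x) 0 = deriv (fun t => f (c t)) 0 := by
  -- The axis `s = 0` is the original curve, the diagonal is the slowed curve, and `Γ (s, 0)` is `c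
  -- 0` for every `s`, so `deriv_diagonal` applies.
  let Γ : ℝ × ℝ → M → W := fun p x => c (p.2 + p.1 * (-(p.2 ^ 2 / (ε x ^ 2 + p.2 ^ 2)))) x
  have hΓ : ConfigFamily τ Γ := by
    refine ⟨hc.1.reparam (g := fun (p : ℝ × ℝ) x =>
      p.2 + p.1 * (-(p.2 ^ 2 / (ε x ^ 2 + p.2 ^ 2)))) fun x₀ => ?_, fun s x => hc.2 _ x⟩
    have he : ContDiffOn ℝ ∞ (fun q : (ℝ × ℝ) × E => ε ((chartAt E x₀).symm q.2))
        (univ ×ˢ (chartAt E x₀).target) :=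
      (hεs x₀).comp contDiff_snd.contDiffOn fun q hq => hq.2
    have h1 : ContDiffOn ℝ ∞ (fun q : (ℝ × ℝ) × E => q.1.1) (univ ×ˢ (chartAt E x₀).target) :=
      ContDiff.contDiffOn (by fun_prop)
    have h2 : ContDiffOn ℝ ∞ (fun q : (ℝ × ℝ) × E => q.1.2) (univ ×ˢ (chartAt E x₀).target) :=
      ContDiff.contDiffOn (by fun_prop)
    refine h2.add (h1.mul (((h2.pow 2).div ((he.pow 2).add (h2.pow 2)) fun q _ => ?_).neg))
    have := hε ((chartAt E x₀).symm q.2)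
    positivity
  have hF := hf (ℝ × ℝ) Γ hΓ
  have key := deriv_diagonal (F := fun p => f (Γ p)) (hF.differentiable (by simp) _) (by
    intro s; simp [Γ])
  have e1 : (fun t => f (Γ (t, t))) = fun t => f fun x => c (boundedTime (ε x) t) x := by
    funext t
    refine congrArg f (funext fun x => ?_)
    simp only [Γ]
    rw [boundedTime_eq (hε x)]
  have e2 : (fun t => f (Γ (0, t))) = fun t => f (c t) := by
    funext t
    simp [Γ]
  rw [← e1, ← e2]
  exact key

variable [FiniteDimensional ℝ E] [T2Space M] [SigmaCompactSpace M]

/-- A smooth family of fields and variations is, locally in the parameter, tangent to a smooth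
family of curves of fields. -/
theorem exists_family_of_curves {P : Type*} [NormedAddCommGroup P] [NormedSpace ℝ P]
    [FiniteDimensional ℝ P] {c V : P → M → W} (hc : ConfigFamily τ c) (hV : SmoothFieldFamily τ V)
    (s₀ : P) : ∃ Γ : P × ℝ → M → W, ConfigFamily τ Γ ∧
      ∀ᶠ s in nhds s₀, IsCurve τ (fun t => Γ (s, t)) (c s) (V s) := by
  -- The cutoff needs a compact set of parameters. The map `ρ` sends all of `P` into the closed ball
  -- of radius 2 and is the identity near `s₀`; hence the conclusion is only local in the parameter.
  let χ : ContDiffBump s₀ := ⟨1, 2, by norm_num, by norm_num⟩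
  let ρ : P → P := fun s => s₀ + χ s • (s - s₀)
  have hρ : ContDiff ℝ ∞ ρ :=
    contDiff_const.add (χ.contDiff.smul (contDiff_id.sub contDiff_const))
  have hρ2 : ∀ s, ρ s ∈ Metric.closedBall s₀ 2 := by
    intro s
    rw [Metric.mem_closedBall, dist_eq_norm]
    simp only [ρ, add_sub_cancel_left, norm_smul, Real.norm_eq_abs, abs_of_nonneg χ.nonneg]
    by_cases hs : dist s s₀ ≤ 2
    · rw [dist_eq_norm] at hs
      calc χ s * ‖s - s₀‖ ≤ 1 * 2 := by
            gcongr
            exact χ.le_one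
        _ = 2 := one_mul 2
    · rw [χ.zero_of_le_dist (not_le.1 hs).le]
      norm_num
  have hρ1 : ∀ᶠ s in nhds s₀, ρ s = s := by
    filter_upwards [χ.eventuallyEq_one] with s hs
    simp only [ρ, hs, Pi.one_apply, one_smul, add_sub_cancel]
  let ψ : P × ℝ → M → W := fun p => c p.1 + p.2 • V p.1
  have hψ : SmoothFieldFamily τ ψ :=
    (hc.1.comp contDiff_fst).add ((hV.comp contDiff_fst).smul contDiff_snd)
  obtain ⟨ε, hε, hεs, hεd⟩ := hψ.exists_cutoff
    (K := Metric.closedBall s₀ 2 ×ˢ {0}) ((isCompact_closedBall s₀ 2).prod isCompact_singleton) (by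
    rintro ⟨s, t⟩ ⟨-, ht⟩ x
    rw [mem_singleton_iff] at ht
    simp only at ht
    subst ht
    simpa [ψ] using hc.2 s x)
  have hΓ : ConfigFamily τ fun (p : P × ℝ) x => ψ (ρ p.1, boundedTime (ε x) p.2) x := by
    refine ⟨hψ.reparam (g := fun (p : P × ℝ) x => (ρ p.1, boundedTime (ε x) p.2)) fun x₀ => ?_,
      fun s x => ?_⟩
    · have he : ContDiffOn ℝ ∞ (fun q : (P × ℝ) × E => ε ((chartAt E x₀).symm q.2))
          (univ ×ˢ (chartAt E x₀).target) :=
        (hεs x₀).comp contDiff_snd.contDiffOn fun q hq => hq.2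
      exact (hρ.comp (contDiff_fst.comp contDiff_fst)).contDiffOn.prodMk
        (ContDiffOn_boundedTime he (ContDiff.contDiffOn (by fun_prop)) fun _ _ => hε _)
    · refine hεd x (ρ s.1, 0) ⟨hρ2 _, rfl⟩ _ ?_
      rw [Prod.dist_eq, dist_self, dist_zero_right]
      exact max_le (hε x).le (abs_boundedTime_le (hε x) _)
  refine ⟨_, hΓ, ?_⟩
  filter_upwards [hρ1] with s hs
  refine ⟨hΓ.comp (contDiff_const.prodMk contDiff_id), ?_, fun x => ?_⟩
  · funext x
    simp [ψ, boundedTime_zero, hs]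
  · simp only [hs, ψ, Pi.add_apply, Pi.smul_apply]
    simpa using ((hasDerivAt_boundedTime (hε x)).smul_const (V s x)).const_add (c s x)

theorem exists_isCurve {φ V : M → W} (hφ : φ ∈ fieldSpace τ) (hV : IsVariation τ V) :
    ∃ c, IsCurve τ c φ V := by
  obtain ⟨Γ, -, h⟩ := exists_family_of_curves (P := ℝ) hφ hV 0
  exact ⟨_, h.self_of_nhds⟩

variable [CompleteSpace W]

/-- The derivative of a smooth function on field space along a curve depends only on the velocity
of the curve. -/
theorem IsCurve.deriv_eq {c₁ c₂ : ℝ → M → W} {φ V : M → W} (h₁ : IsCurve τ c₁ φ V)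
    (h₂ : IsCurve τ c₂ φ V) {f : (M → W) → A} (hf : IsSmoothFunctional τ f) :
    deriv (fun t => f (c₁ t)) 0 = deriv (fun t => f (c₂ t)) 0 := by
  -- Hadamard: `c₂ - c₁ = t d(t)` with `d` smooth, and `d(0) = 0` because the velocities agree.
  let d : ℝ → M → W := fun t x => dslope (fun a => c₂ a x - c₁ a x) 0 t
  have hd : SmoothFieldFamily τ d := fun x₀ => by
    have h := contDiffOn_dslope (G := fun t u => fieldInChart τ (c₂ t - c₁ t) x₀ u)
      (chartAt E x₀).open_target (h₂.1.1.sub h₁.1.1 x₀)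
    refine h.congr fun q _ => ?_
    -- The slope commutes with the change of frame, which is linear and independent of time.
    exact (((fieldRep τ x₀ q.2).dslope_comp
      (fun a => c₂ a ((chartAt E x₀).symm q.2) - c₁ a ((chartAt E x₀).symm q.2)) 0 q.1
      fun _ => (((h₂.2.2 _).sub (h₁.2.2 _)).differentiableAt)).symm :)
  have hd0 : ∀ x, d 0 x = 0 := by
    intro x
    simp only [d, dslope_same]
    exact ((h₂.2.2 x).sub (h₁.2.2 x)).deriv.trans (sub_self _)
  have hdt : ∀ t x, c₁ t x + t • d t x = c₂ t x := by
    intro t x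
    have h := sub_smul_dslope (fun a => c₂ a x - c₁ a x) 0 t
    simp only [sub_zero, h₁.2.1, h₂.2.1, sub_self] at h
    simp only [d]
    rw [h]
    abel
  let ψ : ℝ × ℝ → M → W := fun p => c₁ p.1 + p.2 • d p.1
  have hψ : SmoothFieldFamily τ ψ :=
    (h₁.1.1.comp contDiff_fst).add ((hd.comp contDiff_fst).smul contDiff_snd)
  obtain ⟨ε, hε, hεs, hεd⟩ := hψ.exists_cutoff (K := {(0, 0)}) isCompact_singleton (by
    intro q hq x
    rw [mem_singleton_iff] at hq
    subst hq
    simpa [ψ] using h₁.1.2 0 x)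
  -- Up to slowing, `Γ (s, t) = c₁ t + s d(t)`: the axis `s = 0` is `c₁`, the diagonal is `c₂`, and
  -- `Γ (s, 0)` is constant.
  let Γ : ℝ × ℝ → M → W := fun p x => ψ (boundedTime (ε x) p.2, boundedTime (ε x) p.1) x
  have hΓ : ConfigFamily τ Γ := by
    refine ⟨hψ.reparam (g := fun (p : ℝ × ℝ) x =>
      (boundedTime (ε x) p.2, boundedTime (ε x) p.1)) fun x₀ => ?_, fun s x => ?_⟩
    · have he : ContDiffOn ℝ ∞ (fun q : (ℝ × ℝ) × E => ε ((chartAt E x₀).symm q.2))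
          (univ ×ˢ (chartAt E x₀).target) :=
        (hεs x₀).comp contDiff_snd.contDiffOn fun q hq => hq.2
      exact (ContDiffOn_boundedTime he (ContDiff.contDiffOn (by fun_prop)) fun _ _ => hε _).prodMk
        (ContDiffOn_boundedTime he (ContDiff.contDiffOn (by fun_prop)) fun _ _ => hε _)
    · refine hεd x (0, 0) rfl _ ?_
      rw [Prod.dist_eq, dist_zero_right, dist_zero_right]
      exact max_le (abs_boundedTime_le (hε x) _) (abs_boundedTime_le (hε x) _)
  have hF := hf (ℝ × ℝ) Γ hΓ
  have key := deriv_diagonal (F := fun p => f (Γ p)) (hF.differentiable (by simp) _) (by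
    intro s
    refine congrArg f (funext fun x => ?_)
    simp [Γ, ψ, boundedTime_zero, hd0])
  have e1 : (fun t => f (Γ (t, t))) = fun t => f fun x => c₂ (boundedTime (ε x) t) x := by
    funext t
    exact congrArg f (funext fun x => hdt _ x)
  have e2 : (fun t => f (Γ (0, t))) = fun t => f fun x => c₁ (boundedTime (ε x) t) x := by
    funext t
    refine congrArg f (funext fun x => ?_)
    simp [Γ, ψ, boundedTime_zero]
  rw [← h₁.1.deriv_slowed hε hεs hf, ← h₂.1.deriv_slowed hε hεs hf, ← e1, ← e2, key]

/-- `vary` is an `epsilon` choice and carries no information by itself. Independence of the curve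
shows that a number with the chosen property exists. -/
theorem IsCurve.hasDerivAt_vary {c : ℝ → M → W} {φ V : M → W} (h : IsCurve τ c φ V)
    {f : (M → W) → A} (hf : IsSmoothFunctional τ f) :
    HasDerivAt (fun t => f (c t)) (vary τ f φ V) 0 := by
  refine Classical.epsilon_spec (p := fun a => ∀ c : ℝ → M → W, IsCurve τ c φ V →
    HasDerivAt (fun t => f (c t)) a 0) ⟨deriv (fun t => f (c t)) 0, fun c' h' => ?_⟩ c h
  rw [h.deriv_eq h' hf]
  exact ((hf ℝ c' h'.1).differentiable (by simp) 0).hasDerivAt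

theorem IsCurve.vary_eq {c : ℝ → M → W} {φ V : M → W} (h : IsCurve τ c φ V)
    {f : (M → W) → A} (hf : IsSmoothFunctional τ f) : vary τ f φ V = deriv (fun t => f (c t)) 0 :=
  (h.hasDerivAt_vary hf).deriv.symm

/-- Second variations of smooth functions on field space are symmetric. -/
theorem vary_vary_comm {f : (M → W) → A} (hf : IsSmoothFunctional τ f) {φ U V : M → W}
    (hφ : φ ∈ fieldSpace τ) (hU : IsVariation τ U) (hV : IsVariation τ V)
    (hfU : IsSmoothFunctional τ fun ψ => vary τ f ψ U)
    (hfV : IsSmoothFunctional τ fun ψ => vary τ f ψ V) :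
    vary τ (fun ψ => vary τ f ψ V) φ U = vary τ (fun ψ => vary τ f ψ U) φ V := by
  let ψ : ℝ × ℝ → M → W := fun p => φ + p.1 • U + p.2 • V
  have hψ : SmoothFieldFamily τ ψ := by
    have h1 : SmoothFieldFamily τ fun _ : ℝ × ℝ => φ := hφ.1.comp (g := fun _ => 0) contDiff_const
    have h2 : SmoothFieldFamily τ fun _ : ℝ × ℝ => U := hU.comp (g := fun _ => 0) contDiff_const
    have h3 : SmoothFieldFamily τ fun _ : ℝ × ℝ => V := hV.comp (g := fun _ => 0) contDiff_const
    exact (h1.add (h2.smul contDiff_fst)).add (h3.smul contDiff_snd)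
  obtain ⟨ε, hε, hεs, hεd⟩ := hψ.exists_cutoff (K := {(0, 0)}) isCompact_singleton (by
    intro q hq x
    rw [mem_singleton_iff] at hq
    subst hq
    simpa [ψ] using hφ.2 0 x)
  let Γ : ℝ × ℝ → M → W := fun p x => ψ (boundedTime (ε x) p.1, boundedTime (ε x) p.2) x
  have hΓ : ConfigFamily τ Γ := by
    refine ⟨hψ.reparam (g := fun (p : ℝ × ℝ) x =>
      (boundedTime (ε x) p.1, boundedTime (ε x) p.2)) fun x₀ => ?_, fun s x => ?_⟩
    · have he : ContDiffOn ℝ ∞ (fun q : (ℝ × ℝ) × E => ε ((chartAt E x₀).symm q.2))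
          (univ ×ˢ (chartAt E x₀).target) :=
        (hεs x₀).comp contDiff_snd.contDiffOn fun q hq => hq.2
      exact (ContDiffOn_boundedTime he (ContDiff.contDiffOn (by fun_prop)) fun _ _ => hε _).prodMk
        (ContDiffOn_boundedTime he (ContDiff.contDiffOn (by fun_prop)) fun _ _ => hε _)
    · refine hεd x (0, 0) rfl _ ?_
      rw [Prod.dist_eq, dist_zero_right, dist_zero_right]
      exact max_le (abs_boundedTime_le (hε x) _) (abs_boundedTime_le (hε x) _)
  -- The velocity at `t = 0` is `V` for every `s`, because `ε` depends only on the point and `V` not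
  -- on the field. So inner variations are partial derivatives of one function of `(s, t)`.
  have cV : ∀ s, IsCurve τ (fun t => Γ (s, t)) (Γ (s, 0)) V := fun s => by
    refine ⟨hΓ.comp (contDiff_const.prodMk contDiff_id), rfl, fun x => ?_⟩
    simp only [Γ, ψ, Pi.add_apply, Pi.smul_apply]
    simpa using (hasDerivAt_boundedTime (hε x)).smul_const (V x)
  have cU : ∀ t, IsCurve τ (fun s => Γ (s, t)) (Γ (0, t)) U := fun t => by
    refine ⟨hΓ.comp (contDiff_id.prodMk contDiff_const), rfl, fun x => ?_⟩
    simp only [Γ, ψ, Pi.add_apply, Pi.smul_apply]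
    simpa using (hasDerivAt_boundedTime (hε x)).smul_const (U x)
  have h0 : Γ (0, 0) = φ := by
    funext x
    simp [Γ, ψ, boundedTime_zero]
  have hcU : IsCurve τ (fun s => Γ (s, 0)) φ U := h0 ▸ cU 0
  have hcV : IsCurve τ (fun t => Γ (0, t)) φ V := h0 ▸ cV 0
  have hF : ContDiff ℝ ∞ fun p => f (Γ p) := hf (ℝ × ℝ) Γ hΓ
  have key := hasDerivAt_partial_fderiv (f := fun s t => f (Γ (s, t))) (t := 0) (u := (0 : ℝ))
    hF.contDiffAt
  have key2 : HasDerivAt (fun s => deriv (fun t => f (Γ (s, t))) 0)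
      (deriv (fun t => deriv (fun s => f (Γ (s, t))) 0) 0) 0 := by
    have h := (ContinuousLinearMap.apply ℝ A (1 : ℝ)).hasFDerivAt.comp_hasDerivAt 0 key
    simpa [Function.comp_def, fderiv_apply_one_eq_deriv] using h
  have e1 : (fun s => vary τ f (Γ (s, 0)) V) = fun s => deriv (fun t => f (Γ (s, t))) 0 :=
    funext fun s => (cV s).vary_eq hf
  have e2 : (fun t => vary τ f (Γ (0, t)) U) = fun t => deriv (fun s => f (Γ (s, t))) 0 :=
    funext fun t => (cU t).vary_eq hf
  rw [hcU.vary_eq hfV, hcV.vary_eq hfU, e1, e2, key2.deriv]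

/-- The variation of a smooth section-valued function on field space is jointly smooth. -/
theorem smoothInCharts_vary {F : Type*} [NormedAddCommGroup F] [NormedSpace ℝ F]
    {X : Type*} [TopologicalSpace X] [ChartedSpace F X] {R : X → F → A →L[ℝ] A}
    (hR : ∀ x, R x (chartAt F x x) = ContinuousLinearMap.id ℝ A) {α : (M → W) → X → A}
    (hα : ∀ (P : Type) [NormedAddCommGroup P] [NormedSpace ℝ P] [FiniteDimensional ℝ P]
      (c : P → M → W), ConfigFamily τ c → SmoothInCharts R fun s => α (c s))
    {P : Type} [NormedAddCommGroup P] [NormedSpace ℝ P] [FiniteDimensional ℝ P]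
    {c V : P → M → W} (hc : ConfigFamily τ c) (hV : SmoothFieldFamily τ V) :
    SmoothInCharts R fun s x => vary τ (fun ψ => α ψ x) (c s) (V s) := by
  rintro x₀ ⟨s₀, u⟩ hq
  -- Near `s₀` the variation is the `t`-derivative at `0` of one smooth family with an extra
  -- parameter; smoothness is local, so this suffices.
  obtain ⟨Γ, hΓ, hcurve⟩ := exists_family_of_curves hc hV s₀
  have h1 := ((hα (P × ℝ) Γ hΓ).deriv_right hR).comp (g := fun s : P => ((s, 0) : P × ℝ))
    (contDiff_id.prodMk contDiff_const)
  refine (h1 x₀ (s₀, u) hq).congr_of_eventuallyEq_of_mem ?_ hq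
  refine Filter.Eventually.filter_mono nhdsWithin_le_nhds ?_
  have hev := (continuous_fst (X := P) (Y := F)).continuousAt (x := (s₀, u)) |>.eventually hcurve
  filter_upwards [hev] with q hq
  rw [hq.vary_eq (f := fun ψ => α ψ ((chartAt F x₀).symm q.2))
    fun P' _ _ _ c' hc' => (hα P' c' hc').contDiff_apply hR _]

end Vary

/-! ### Forms on field space: smoothness, product rules, `δd = dδ` and `δ² = 0` -/

section FieldSpaceForms

variable {E : Type*} [NormedAddCommGroup E] [NormedSpace ℝ E]
  {W : Type*} [NormedAddCommGroup W] [NormedSpace ℝ W]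
  {M : Type*} [TopologicalSpace M] [ChartedSpace E M] [IsManifold 𝓘(ℝ, E) ∞ M]
  {τ : FieldType E W}
  {F : Type*} [NormedAddCommGroup F] [NormedSpace ℝ F]
  {X : Type*} [TopologicalSpace X] [ChartedSpace F X] [IsManifold 𝓘(ℝ, F) ∞ X] {k : ℕ}
  {P : Type} [NormedAddCommGroup P] [NormedSpace ℝ P] [FiniteDimensional ℝ P]

/-- The smoothness part of `IsOneForm`. -/
def IsSmoothOneForm (τ : FieldType E W) (θ : (M → W) → (M → W) → X → F [⋀^Fin k]→L[ℝ] ℝ) : Prop :=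
  ∀ (P : Type) [NormedAddCommGroup P] [NormedSpace ℝ P] [FiniteDimensional ℝ P]
    (c V : P → M → W), ConfigFamily τ c → SmoothFieldFamily τ V →
      SmoothFormFamily fun s => θ (c s) (V s)

theorem IsOneForm.isSmoothOneForm {θ : (M → W) → (M → W) → X → F [⋀^Fin k]→L[ℝ] ℝ}
    (hθ : IsOneForm τ θ) : IsSmoothOneForm τ θ := hθ.2

theorem IsZeroForm.isSmoothFunctional {α : (M → W) → X → F [⋀^Fin k]→L[ℝ] ℝ}
    (hα : IsZeroForm τ α) (x : X) : IsSmoothFunctional τ fun ψ => α ψ x :=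
  fun P _ _ _ c hc => (hα P c hc).contDiff_apply x

theorem IsZeroForm.isSmoothForm {α : (M → W) → X → F [⋀^Fin k]→L[ℝ] ℝ}
    (hα : IsZeroForm τ α) {φ : M → W} (hφ : φ ∈ fieldSpace τ) : IsSmoothForm (α φ) :=
  hα ℝ (fun _ => φ) hφ

theorem IsZeroForm.add {α β : (M → W) → X → F [⋀^Fin k]→L[ℝ] ℝ}
    (hα : IsZeroForm τ α) (hβ : IsZeroForm τ β) : IsZeroForm τ fun ψ => α ψ + β ψ :=
  fun P _ _ _ c hc => (hα P c hc).add (hβ P c hc)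

theorem IsZeroForm.sub {α β : (M → W) → X → F [⋀^Fin k]→L[ℝ] ℝ}
    (hα : IsZeroForm τ α) (hβ : IsZeroForm τ β) : IsZeroForm τ fun ψ => α ψ - β ψ :=
  fun P _ _ _ c hc => (hα P c hc).sub (hβ P c hc)

theorem IsZeroForm.iForm {α : (M → W) → X → F [⋀^Fin (k + 1)]→L[ℝ] ℝ}
    (hα : IsZeroForm τ α) {ξ : (M → W) → X → F} (hξ : IsFieldVec τ ξ) :
    IsZeroForm τ fun ψ => iForm (ξ ψ) (α ψ) :=
  fun P _ _ _ c hc => (hα P c hc).iForm (hξ P c hc)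

theorem IsSmoothOneForm.isZeroForm {θ : (M → W) → (M → W) → X → F [⋀^Fin k]→L[ℝ] ℝ}
    (hθ : IsSmoothOneForm τ θ) {V : M → W} (hV : IsVariation τ V) : IsZeroForm τ fun ψ => θ ψ V :=
  fun P _ _ _ c hc => hθ P c (fun _ => V) hc
    (SmoothFieldFamily.comp (φ := fun _ : ℝ => V) hV (g := fun _ => 0) contDiff_const)

theorem IsSmoothOneForm.isSmoothForm {θ : (M → W) → (M → W) → X → F [⋀^Fin k]→L[ℝ] ℝ}
    (hθ : IsSmoothOneForm τ θ) {φ V : M → W} (hφ : φ ∈ fieldSpace τ) (hV : IsVariation τ V) :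
    IsSmoothForm (θ φ V) := (hθ.isZeroForm hV).isSmoothForm hφ

theorem IsFieldVec.isSmoothFunctional {ξ : (M → W) → X → F} (hξ : IsFieldVec τ ξ) (x : X) :
    IsSmoothFunctional τ fun ψ => ξ ψ x :=
  fun P _ _ _ c hc => (hξ P c hc).inCharts.contDiff_apply vecRep_self x

theorem IsFieldVec.isSmoothVec {ξ : (M → W) → X → F} (hξ : IsFieldVec τ ξ) {φ : M → W}
    (hφ : φ ∈ fieldSpace τ) : IsSmoothVec (ξ φ) := hξ ℝ (fun _ => φ) hφ

theorem IsSmoothPotential.isZeroForm {Q : (M → E) → (M → W) → M → E [⋀^Fin k]→L[ℝ] ℝ}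
    {ξ : (M → W) → M → E} (hQ : IsSmoothPotential τ Q) (hξ : IsFieldVec τ ξ) :
    IsZeroForm τ fun ψ => Q (ξ ψ) ψ := fun P _ _ _ c hc => hQ P _ c (hξ P c hc) hc

theorem IsSmoothPotential.isSmoothForm {Q : (M → E) → (M → W) → M → E [⋀^Fin k]→L[ℝ] ℝ}
    {φ : M → W} (hQ : IsSmoothPotential τ Q) {ζ : M → E} (hζ : IsSmoothVec ζ)
    (hφ : φ ∈ fieldSpace τ) : IsSmoothForm (Q ζ φ) := hQ ℝ (fun _ => ζ) (fun _ => φ) hζ hφ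

section Hat

variable [CompleteSpace E]

theorem IsFieldVec.smoothFieldFamily_hat {ξ : (M → W) → M → E} (hξ : IsFieldVec τ ξ) {c : P → M → W}
    (hc : ConfigFamily τ c) : SmoothFieldFamily τ fun s => hat τ ξ (c s) :=
  hc.1.lieField (hξ P c hc)

theorem IsSmoothOneForm.contr1 {θ : (M → W) → (M → W) → X → F [⋀^Fin k]→L[ℝ] ℝ}
    (hθ : IsSmoothOneForm τ θ) {ξ : (M → W) → M → E} (hξ : IsFieldVec τ ξ) :
    IsZeroForm τ (contr1 τ ξ θ) :=
  fun P _ _ _ c hc => hθ P c _ hc (hξ.smoothFieldFamily_hat hc)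

theorem IsFieldVec.isVariation_hat {ξ : (M → W) → M → E} (hξ : IsFieldVec τ ξ) {φ : M → W}
    (hφ : φ ∈ fieldSpace τ) : IsVariation τ (hat τ ξ φ) :=
  hξ.smoothFieldFamily_hat (P := ℝ) (c := fun _ => φ) hφ

theorem isVariation_lieField {ζ : M → E} (hζ : IsSmoothVec ζ) {φ : M → W}
    (hφ : φ ∈ fieldSpace τ) : IsVariation τ (lieField τ ζ φ) :=
  SmoothFieldFamily.lieField (φ := fun _ : ℝ => φ) hφ.1 hζ

end Hat

variable [FiniteDimensional ℝ E] [T2Space M] [SigmaCompactSpace M] [CompleteSpace W]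

theorem IsZeroForm.delta0 {α : (M → W) → X → F [⋀^Fin k]→L[ℝ] ℝ} (hα : IsZeroForm τ α) :
    IsSmoothOneForm τ (delta0 τ α) := by
  intro P _ _ _ c V hc hV
  have h : SmoothInCharts formRep fun s x => vary τ (fun ψ => α ψ x) (c s) (V s) :=
    smoothInCharts_vary formRep_self (fun P _ _ _ c hc => (hα P c hc).inCharts) hc hV
  exact h

theorem IsFieldVec.isSmoothVec_deltaVec {ξ : (M → W) → X → F} (hξ : IsFieldVec τ ξ) {φ V : M → W}
    (hφ : φ ∈ fieldSpace τ) (hV : IsVariation τ V) : IsSmoothVec (deltaVec τ ξ φ V) :=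
  smoothInCharts_vary (P := ℝ) (R := vecRep) vecRep_self (fun P _ _ _ c hc => (hξ P c hc).inCharts)
    (c := fun _ => φ) (V := fun _ => V) hφ hV

theorem IsZeroForm.hasDerivAt {α : (M → W) → X → F [⋀^Fin k]→L[ℝ] ℝ} (hα : IsZeroForm τ α)
    {c : ℝ → M → W} {φ V : M → W} (hc : IsCurve τ c φ V) (x : X) :
    HasDerivAt (fun t => α (c t) x) (CovariantPhaseSpace.delta0 τ α φ V x) 0 :=
  hc.hasDerivAt_vary (hα.isSmoothFunctional x)

theorem IsZeroForm.delta0_eq {α : (M → W) → X → F [⋀^Fin k]→L[ℝ] ℝ} (hα : IsZeroForm τ α)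
    {c : ℝ → M → W} {φ V : M → W} (hc : IsCurve τ c φ V) :
    CovariantPhaseSpace.delta0 τ α φ V = fun x => deriv (fun t => α (c t) x) 0 :=
  funext fun x => ((hα.hasDerivAt hc x).deriv).symm

theorem IsFieldVec.hasDerivAt {ξ : (M → W) → X → F} (hξ : IsFieldVec τ ξ)
    {c : ℝ → M → W} {φ V : M → W} (hc : IsCurve τ c φ V) (x : X) :
    HasDerivAt (fun t => ξ (c t) x) (deltaVec τ ξ φ V x) 0 :=
  hc.hasDerivAt_vary (hξ.isSmoothFunctional x)

theorem IsZeroForm.hasDerivAt_dForm {α : (M → W) → X → F [⋀^Fin k]→L[ℝ] ℝ} (hα : IsZeroForm τ α)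
    {c : ℝ → M → W} {φ V : M → W} (hc : IsCurve τ c φ V) (x : X) :
    HasDerivAt (fun t => dForm (α (c t)) x) (dForm (CovariantPhaseSpace.delta0 τ α φ V) x) 0 := by
  rw [hα.delta0_eq hc]
  exact (hα ℝ c hc.1).hasDerivAt_dForm x 0

theorem hasDerivAt_curryLeft {a : ℝ → F [⋀^Fin (k + 1)]→L[ℝ] ℝ} {z : ℝ → F}
    {a' : F [⋀^Fin (k + 1)]→L[ℝ] ℝ} {z' : F} {t : ℝ} (ha : HasDerivAt a a' t)
    (hz : HasDerivAt z z' t) :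
    HasDerivAt (fun s => (a s).curryLeft (z s)) ((a t).curryLeft z' + a'.curryLeft (z t)) t := by
  let C := (ContinuousAlternatingMap.curryLeftLI (𝕜 := ℝ) (E := F) (F := ℝ)
    (n := k)).toContinuousLinearMap
  have h1 : HasDerivAt (fun s => (a s).curryLeft) a'.curryLeft t :=
    HasFDerivAt.comp_hasDerivAt (l := fun b => C b) t C.hasFDerivAt ha
  have h2 := h1.clm_apply hz
  rw [add_comm] at h2
  exact h2

theorem IsZeroForm.delta0_iForm {α : (M → W) → X → F [⋀^Fin (k + 1)]→L[ℝ] ℝ} (hα : IsZeroForm τ α)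
    {ξ : (M → W) → X → F} (hξ : IsFieldVec τ ξ) {c : ℝ → M → W} {φ V : M → W}
    (hc : IsCurve τ c φ V) :
    CovariantPhaseSpace.delta0 τ (fun ψ => CovariantPhaseSpace.iForm (ξ ψ) (α ψ)) φ V =
      CovariantPhaseSpace.iForm (deltaVec τ ξ φ V) (α φ) +
        CovariantPhaseSpace.iForm (ξ φ) (CovariantPhaseSpace.delta0 τ α φ V) := by
  funext x
  have h := hasDerivAt_curryLeft (hα.hasDerivAt hc x) (hξ.hasDerivAt hc x)
  rw [hc.2.1] at h
  exact ((hα.iForm hξ).hasDerivAt hc x).unique h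

theorem IsZeroForm.delta0_add {α β : (M → W) → X → F [⋀^Fin k]→L[ℝ] ℝ} (hα : IsZeroForm τ α)
    (hβ : IsZeroForm τ β) {c : ℝ → M → W} {φ V : M → W} (hc : IsCurve τ c φ V) :
    CovariantPhaseSpace.delta0 τ (fun ψ => α ψ + β ψ) φ V =
      CovariantPhaseSpace.delta0 τ α φ V + CovariantPhaseSpace.delta0 τ β φ V :=
  funext fun x => ((hα.add hβ).hasDerivAt hc x).unique ((hα.hasDerivAt hc x).add (hβ.hasDerivAt hc x))

theorem IsZeroForm.delta0_sub {α β : (M → W) → X → F [⋀^Fin k]→L[ℝ] ℝ} (hα : IsZeroForm τ α)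
    (hβ : IsZeroForm τ β) {c : ℝ → M → W} {φ V : M → W} (hc : IsCurve τ c φ V) :
    CovariantPhaseSpace.delta0 τ (fun ψ => α ψ - β ψ) φ V =
      CovariantPhaseSpace.delta0 τ α φ V - CovariantPhaseSpace.delta0 τ β φ V :=
  funext fun x => ((hα.sub hβ).hasDerivAt hc x).unique ((hα.hasDerivAt hc x).sub (hβ.hasDerivAt hc x))

/-- `δ² = 0` on field-space `0`-forms. -/
theorem IsZeroForm.delta1_delta0 {α : (M → W) → X → F [⋀^Fin k]→L[ℝ] ℝ} (hα : IsZeroForm τ α)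
    {φ U V : M → W} (hφ : φ ∈ fieldSpace τ) (hU : IsVariation τ U) (hV : IsVariation τ V) :
    delta1 τ (CovariantPhaseSpace.delta0 τ α) φ U V = 0 :=
  funext fun x => sub_eq_zero.2 <| vary_vary_comm (hα.isSmoothFunctional x) hφ hU hV
    ((hα.delta0.isZeroForm hU).isSmoothFunctional x) ((hα.delta0.isZeroForm hV).isSmoothFunctional x)

theorem IsSmoothOneForm.isSmoothForm_delta1 {θ : (M → W) → (M → W) → X → F [⋀^Fin k]→L[ℝ] ℝ}
    (hθ : IsSmoothOneForm τ θ) {φ U V : M → W} (hφ : φ ∈ fieldSpace τ) (hU : IsVariation τ U)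
    (hV : IsVariation τ V) : IsSmoothForm (delta1 τ θ φ U V) :=
  ((hθ.isZeroForm hV).delta0.isSmoothForm hφ hU).sub ((hθ.isZeroForm hU).delta0.isSmoothForm hφ hV)

theorem IsSmoothOneForm.isSmoothForm_anomaly1 {θ : (M → W) → (M → W) → X → F [⋀^Fin k]→L[ℝ] ℝ}
    (hθ : IsSmoothOneForm τ θ) {ξ : (M → W) → M → E} (hξ : IsFieldVec τ ξ) {ξX : (M → W) → X → F}
    (hξX : IsFieldVec τ ξX) {φ V : M → W} (hφ : φ ∈ fieldSpace τ) (hV : IsVariation τ V) :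
    IsSmoothForm (anomaly1 τ ξ ξX θ φ V) := by
  have : CompleteSpace E := FiniteDimensional.complete ℝ E
  have h1 := hθ.isSmoothForm_delta1 hφ (hξ.isVariation_hat hφ) hV
  have h2 := (hθ.contr1 hξ).delta0.isSmoothForm hφ hV
  have h3 : IsSmoothForm (lieForm (ξX φ) (θ φ V)) :=
    SmoothFormFamily.lieForm (hθ.isSmoothForm hφ hV) (hξX.isSmoothVec hφ)
  have h4 := hθ.isSmoothForm hφ (isVariation_lieField (hξ.isSmoothVec_deltaVec hφ hV) hφ)
  exact ((h1.add h2).sub h3).sub h4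

end FieldSpaceForms

/-! ### The generalized Iyer–Wald identity at a point -/

section IyerWald

variable {E : Type*} [NormedAddCommGroup E] [NormedSpace ℝ E] [FiniteDimensional ℝ E]
  {W : Type*} [NormedAddCommGroup W] [NormedSpace ℝ W]
  {M : Type*} [TopologicalSpace M] [ChartedSpace E M]
  [IsManifold 𝓘(ℝ, E) ∞ M] {τ : FieldType E W} {k : ℕ}

/-- The potential of `I_ξ̂ ω'` in the generalized Iyer-Wald identity. -/
noncomputable def iyerWaldPotential (τ : FieldType E W)
    (θ : (M → W) → (M → W) → M → E [⋀^Fin (k + 1)]→L[ℝ] ℝ)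
    (b : (M → W) → M → E [⋀^Fin (k + 1)]→L[ℝ] ℝ)
    (lam : (M → W) → (M → W) → M → E [⋀^Fin k]→L[ℝ] ℝ)
    (Q : (M → E) → (M → W) → M → E [⋀^Fin k]→L[ℝ] ℝ)
    (ξ : (M → W) → M → E) (φ V : M → W) : M → E [⋀^Fin k]→L[ℝ] ℝ :=
  delta0 τ (fun ψ => potential τ Q b lam (ξ ψ) ψ) φ V - potential τ Q b lam (deltaVec τ ξ φ V) φ
    - iForm (ξ φ) (θ φ V) - anomaly1 τ ξ ξ lam φ V

variable {L : (M → W) → M → E [⋀^Fin (k + 2)]→L[ℝ] ℝ}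
  {θ : (M → W) → (M → W) → M → E [⋀^Fin (k + 1)]→L[ℝ] ℝ}
  {b : (M → W) → M → E [⋀^Fin (k + 1)]→L[ℝ] ℝ}
  {lam : (M → W) → (M → W) → M → E [⋀^Fin k]→L[ℝ] ℝ}
  {Q : (M → E) → (M → W) → M → E [⋀^Fin k]→L[ℝ] ℝ}
  {ξ : (M → W) → M → E} {φ V : M → W}

theorem isZeroForm_potential (hQ : IsSmoothPotential τ Q) (hb : IsZeroForm τ b)
    (hlam : IsSmoothOneForm τ lam) (hξ : IsFieldVec τ ξ) :
    IsZeroForm τ fun ψ => potential τ Q b lam (ξ ψ) ψ := by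
  have : CompleteSpace E := FiniteDimensional.complete ℝ E
  exact ((hQ.isZeroForm hξ).add (hb.iForm hξ)).add (hlam.contr1 hξ)

theorem isSmoothForm_potential (hQ : IsSmoothPotential τ Q) (hb : IsZeroForm τ b)
    (hlam : IsSmoothOneForm τ lam) {ζ : M → E} (hζ : IsSmoothVec ζ) (hφ : φ ∈ fieldSpace τ) :
    IsSmoothForm (potential τ Q b lam ζ φ) := by
  have : CompleteSpace E := FiniteDimensional.complete ℝ E
  exact ((hQ.isSmoothForm hζ hφ).add ((hb.isSmoothForm hφ).iForm hζ)).add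
    (hlam.isSmoothForm hφ (isVariation_lieField hζ hφ))

variable [CompleteSpace W] [T2Space M] [SigmaCompactSpace M]

theorem isSmoothForm_iyerWaldPotential (hθ : IsSmoothOneForm τ θ) (hb : IsZeroForm τ b)
    (hlam : IsSmoothOneForm τ lam) (hQ : IsSmoothPotential τ Q) (hξ : IsFieldVec τ ξ)
    (hφ : φ ∈ fieldSpace τ) (hV : IsVariation τ V) :
    IsSmoothForm (iyerWaldPotential τ θ b lam Q ξ φ V) :=
  ((((isZeroForm_potential hQ hb hlam hξ).delta0.isSmoothForm hφ hV).sub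
    (isSmoothForm_potential hQ hb hlam (hξ.isSmoothVec_deltaVec hφ hV) hφ)).sub
      ((hθ.isSmoothForm hφ hV).iForm (hξ.isSmoothVec hφ))).sub
        (hlam.isSmoothForm_anomaly1 hξ hξ hφ hV)

/-- The Noether identity is differentiated along a curve in `S` itself. It is used at the single
spacetime point `x`, since all spatial derivatives enter through `dForm`, which commutes with the
variation. -/
theorem iyerWald_of_mem (hL : IsZeroForm τ L) (hθ : IsSmoothOneForm τ θ) (hb : IsZeroForm τ b)
    (hlam : IsSmoothOneForm τ lam) (hQ : IsSmoothPotential τ Q) (hξ : IsFieldVec τ ξ)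
    {S : Set (M → W)} (hV : IsTangent τ S φ V) {x : M}
    (hnoether : ∀ ψ ∈ S, ∀ ζ : M → E, IsSmoothVec ζ → covCurrent τ L θ b lam ζ ψ x = dForm (Q ζ ψ) x)
    (hLθ : delta0 τ L φ V x = dForm (θ φ V) x)
    (hanom : anomaly1 τ ξ ξ θ φ V x =
      anomaly1 τ ξ ξ (delta0 τ b) φ V x + dForm (anomaly1 τ ξ ξ lam φ V) x) :
    - contr2 τ ξ (delta1 τ θ) φ V x = dForm (iyerWaldPotential τ θ b lam Q ξ φ V) x := by
  have : CompleteSpace E := FiniteDimensional.complete ℝ E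
  obtain ⟨c, hc, hcS⟩ := hV
  have hφ : φ ∈ fieldSpace τ := hc.mem_fieldSpace
  have hVv : IsVariation τ V := hc.isVariation
  have hφS : φ ∈ S := by rw [← hc.2.1]; exact hcS 0
  have hδξ : IsSmoothVec (deltaVec τ ξ φ V) := hξ.isSmoothVec_deltaVec hφ hVv
  have hlieδ : IsVariation τ (lieField τ (deltaVec τ ξ φ V) φ) := isVariation_lieField hδξ hφ
  -- the variation of the Noether current along the curve of solutions
  have d1 := (hθ.contr1 hξ).hasDerivAt hc x
  have d2 := (hb.delta0.contr1 hξ).hasDerivAt hc x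
  have d3 := (hlam.contr1 hξ).hasDerivAt_dForm hc x
  have d4 := hasDerivAt_curryLeft ((hL.hasDerivAt hc x).sub (hb.hasDerivAt_dForm hc x))
    (hξ.hasDerivAt hc x)
  have d5 := (hQ.isZeroForm hξ).hasDerivAt_dForm hc x
  have e1 := (((d1.sub d2).sub d3).sub d4).unique (d5.congr_of_eventuallyEq
    (Filter.Eventually.of_forall fun t =>
      hnoether (c t) (hcS t) (ξ (c t)) (hξ.isSmoothVec (hc.1.mem_fieldSpace t))))
  -- The Noether identity with the fixed generator `δξ(V)`.
  have e2 := hnoether φ hφS _ hδξ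
  simp only [Pi.sub_apply, hc.2.1] at e1
  -- expand the exact terms
  have q1 : delta0 τ (fun ψ => potential τ Q b lam (ξ ψ) ψ) φ V =
      delta0 τ (fun ψ => Q (ξ ψ) ψ) φ V + (iForm (deltaVec τ ξ φ V) (b φ) +
        iForm (ξ φ) (delta0 τ b φ V)) + delta0 τ (contr1 τ ξ lam) φ V := by
    have h1 := ((hQ.isZeroForm hξ).add (hb.iForm hξ)).delta0_add (hlam.contr1 hξ) hc
    rw [(hQ.isZeroForm hξ).delta0_add (hb.iForm hξ) hc, hb.delta0_iForm hξ hc] at h1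
    exact h1
  have sQ := (hQ.isZeroForm hξ).delta0.isSmoothForm hφ hVv
  have sb1 : IsSmoothForm (iForm (deltaVec τ ξ φ V) (b φ)) := (hb.isSmoothForm hφ).iForm hδξ
  have sb2 : IsSmoothForm (iForm (ξ φ) (delta0 τ b φ V)) :=
    (hb.delta0.isSmoothForm hφ hVv).iForm (hξ.isSmoothVec hφ)
  have sl := (hlam.contr1 hξ).delta0.isSmoothForm hφ hVv
  have sQδ := hQ.isSmoothForm hδξ hφ
  have slδ := hlam.isSmoothForm hφ hlieδ
  have sθ : IsSmoothForm (iForm (ξ φ) (θ φ V)) :=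
    (hθ.isSmoothForm hφ hVv).iForm (hξ.isSmoothVec hφ)
  have sA := hlam.isSmoothForm_anomaly1 hξ hξ hφ hVv
  -- The term `i_{δξ} b'` from the product rule for `δ(i_ξ b')` cancels against the one in
  -- `Q'_{δξ}`.
  have hpot : iyerWaldPotential τ θ b lam Q ξ φ V =
      (delta0 τ (fun ψ => Q (ξ ψ) ψ) φ V + iForm (ξ φ) (delta0 τ b φ V) +
        delta0 τ (contr1 τ ξ lam) φ V) - (Q (deltaVec τ ξ φ V) φ +
          lam φ (lieField τ (deltaVec τ ξ φ V) φ)) - iForm (ξ φ) (θ φ V) - anomaly1 τ ξ ξ lam φ V := by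
    rw [iyerWaldPotential, q1, potential]
    abel
  have hd : dForm (iyerWaldPotential τ θ b lam Q ξ φ V) =
      (dForm (delta0 τ (fun ψ => Q (ξ ψ) ψ) φ V) + dForm (iForm (ξ φ) (delta0 τ b φ V)) +
        dForm (delta0 τ (contr1 τ ξ lam) φ V)) - (dForm (Q (deltaVec τ ξ φ V) φ) +
          dForm (lam φ (lieField τ (deltaVec τ ξ φ V) φ))) - dForm (iForm (ξ φ) (θ φ V)) -
            dForm (anomaly1 τ ξ ξ lam φ V) := by
    rw [hpot, IsSmoothForm.dForm_sub ((((sQ.add sb2).add sl).sub (sQδ.add slδ)).sub sθ) sA,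
      IsSmoothForm.dForm_sub (((sQ.add sb2).add sl).sub (sQδ.add slδ)) sθ,
      IsSmoothForm.dForm_sub ((sQ.add sb2).add sl) (sQδ.add slδ),
      IsSmoothForm.dForm_add (sQ.add sb2) sl, IsSmoothForm.dForm_add sQ sb2,
      IsSmoothForm.dForm_add sQδ slδ]
  rw [hd]
  have hδδ : contr2 τ ξ (delta1 τ (delta0 τ b)) φ V = 0 :=
    hb.delta1_delta0 hφ (hξ.isVariation_hat hφ) hVv
  simp only [Pi.sub_apply, Pi.add_apply]
  -- The anomaly of `λ'` enters only as a whole and must stay folded: its degree `k` may be `0`,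
  -- where `lieForm` does not unfold by the general Cartan formula. The degree of `θ'` is positive.
  generalize dForm (anomaly1 τ ξ ξ lam φ V) x = Λ at hanom ⊢
  simp only [anomaly1, lieFS1, lieForm, contrDelta, Pi.sub_apply, Pi.add_apply, hδδ, Pi.zero_apply]
    at hanom
  simp only [covCurrent, Pi.sub_apply] at e2
  rw [hLθ] at e1
  simp only [iForm, Pi.sub_apply] at e1 e2 hanom ⊢
  have hsub : ((dForm (θ φ V) x - dForm (delta0 τ b φ V) x).curryLeft (ξ φ x)) =
      (dForm (θ φ V) x).curryLeft (ξ φ x) - (dForm (delta0 τ b φ V) x).curryLeft (ξ φ x) := rfl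
  rw [hsub] at e1
  have hsub2 : ((L φ x - dForm (b φ) x).curryLeft (deltaVec τ ξ φ V x)) =
      (L φ x).curryLeft (deltaVec τ ξ φ V x) - (dForm (b φ) x).curryLeft (deltaVec τ ξ φ V x) := rfl
  rw [hsub2] at e1 e2
  -- The terms `i_ξ dθ'` from `i_ξ δL'` and from Cartan's formula cancel, as do `i_ξ dδb'` and all
  -- terms in `L'`; what remains is exact.
  linear_combination (norm := module) e1 - e2 - hanom

end IyerWald

/-! ### Pullback of forms along smooth cubes -/

section Cubes

variable {E : Type*} [NormedAddCommGroup E] [NormedSpace ℝ E]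
  {X : Type*} [TopologicalSpace X] [ChartedSpace E X] {k j : ℕ}

/-- The derivative of a smooth cube. -/
noncomputable def cubeDeriv (σ : SmoothCube E X k) (u : Fin k → ℝ) : (Fin k → ℝ) →L[ℝ] E :=
  mfderivWithin 𝓘(ℝ, Fin k → ℝ) 𝓘(ℝ, E) (clampExt σ.toFun) (Icc 0 1) u

/-- The pullback of a differential form along a smooth cube. -/
noncomputable def cubePull (α : X → E [⋀^Fin j]→L[ℝ] ℝ) (σ : SmoothCube E X k) (u : Fin k → ℝ) :
    (Fin k → ℝ) [⋀^Fin j]→L[ℝ] ℝ :=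
  (α (clampExt σ.toFun u)).compContinuousLinearMap (cubeDeriv σ u)

theorem cubeIntegral_eq (α : X → E [⋀^Fin k]→L[ℝ] ℝ) (σ : SmoothCube E X k) :
    cubeIntegral α σ = ∫ u in Icc (0 : Fin k → ℝ) 1, cubePull α σ u fun i => Pi.single i 1 := rfl

/-- A smooth cube in the preferred chart at `x₀`. -/
noncomputable def cubeChart (σ : SmoothCube E X k) (x₀ : X) (u : Fin k → ℝ) : E :=
  chartAt E x₀ (clampExt σ.toFun u)

theorem uniqueDiffOn_cube : UniqueDiffOn ℝ (Icc (0 : Fin k → ℝ) 1) := by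
  rw [← pi_univ_Icc]
  exact UniqueDiffOn.univ_pi fun i => uniqueDiffOn_Icc zero_lt_one

variable {σ : SmoothCube E X k} {x₀ : X} {u : Fin k → ℝ}

theorem eventually_clampExt_mem_source (hu : u ∈ Icc (0 : Fin k → ℝ) 1)
    (hx : clampExt σ.toFun u ∈ (chartAt E x₀).source) :
    ∀ᶠ w in nhdsWithin u (Icc (0 : Fin k → ℝ) 1), clampExt σ.toFun w ∈ (chartAt E x₀).source :=
  (σ.smooth u hu).continuousWithinAt ((chartAt E x₀).open_source.mem_nhds hx)

variable [IsManifold 𝓘(ℝ, E) ∞ X]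

theorem contDiffWithinAt_cubeChart (hu : u ∈ Icc (0 : Fin k → ℝ) 1)
    (hx : clampExt σ.toFun u ∈ (chartAt E x₀).source) :
    ContDiffWithinAt ℝ ∞ (cubeChart σ x₀) (Icc 0 1) u := by
  rw [← contMDiffWithinAt_iff_contDiffWithinAt]
  have h2 : ContMDiffAt 𝓘(ℝ, E) 𝓘(ℝ, E) ∞ (chartAt E x₀) (clampExt σ.toFun u) :=
    (contMDiffOn_chart (I := 𝓘(ℝ, E)) (x := x₀)).contMDiffAt
      ((chartAt E x₀).open_source.mem_nhds hx)
  exact h2.comp_contMDiffWithinAt u (σ.smooth u hu)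

theorem hasFDerivWithinAt_cubeChart (hu : u ∈ Icc (0 : Fin k → ℝ) 1)
    (hx : clampExt σ.toFun u ∈ (chartAt E x₀).source) :
    HasFDerivWithinAt (cubeChart σ x₀)
      ((tangentCoordChange 𝓘(ℝ, E) (clampExt σ.toFun u) x₀ (clampExt σ.toFun u)).comp
        (cubeDeriv σ u)) (Icc 0 1) u := by
  set x := clampExt σ.toFun u with hxd
  have h2 : HasFDerivWithinAt (cubeChart σ x) (cubeDeriv σ u) (Icc 0 1) u := by
    have h := ((σ.smooth u hu).mdifferentiableWithinAt (by simp)).hasMFDerivWithinAt.2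
    simp only [modelWithCornersSelf_coe, range_id, inter_univ] at h
    exact h
  have h3 := hasFDerivAt_transition (E := E) (x := x) (y := x₀) (mem_chart_source E x) hx
  have h4 := HasFDerivAt.comp_hasFDerivWithinAt (g := transition E x x₀) (f := cubeChart σ x) u h3 h2
  refine h4.congr_of_eventuallyEq ?_ ?_
  · filter_upwards [eventually_clampExt_mem_source hu (mem_chart_source E x)] with w hw
    simp only [cubeChart, transition, Function.comp_apply]
    rw [(chartAt E x).left_inv hw]
  · simp only [cubeChart, transition, Function.comp_apply]
    rw [(chartAt E x).left_inv (mem_chart_source E x)]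

theorem cubePull_eq (α : X → E [⋀^Fin j]→L[ℝ] ℝ) (hu : u ∈ Icc (0 : Fin k → ℝ) 1)
    (hx : clampExt σ.toFun u ∈ (chartAt E x₀).source) :
    cubePull α σ u = (formInChart α x₀ (cubeChart σ x₀ u)).compContinuousLinearMap
      (fderivWithin ℝ (cubeChart σ x₀) (Icc 0 1) u) := by
  rw [(hasFDerivWithinAt_cubeChart hu hx).fderivWithin (uniqueDiffOn_cube u hu)]
  unfold formInChart cubePull cubeChart
  rw [(chartAt E x₀).left_inv hx]
  have key : ∀ (a : E [⋀^Fin j]→L[ℝ] ℝ) (A : (Fin k → ℝ) →L[ℝ] E) (B C : E →L[ℝ] E),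
      C.comp B = ContinuousLinearMap.id ℝ E → a.compContinuousLinearMap A =
        (a.compContinuousLinearMap C).compContinuousLinearMap (B.comp A) := by
    intro a A B C h
    ext w
    exact congrArg a (funext fun i => (DFunLike.congr_fun h (A (w i))).symm)
  exact key _ _ _ _ ((coordChange_comp (mem_chart_source E _) hx (mem_chart_source E _)).trans
    (coordChange_self (mem_chart_source E _)))

theorem cubeDeriv_eq (hu : u ∈ Icc (0 : Fin k → ℝ) 1) :
    cubeDeriv σ u = fderivWithin ℝ (cubeChart σ (clampExt σ.toFun u)) (Icc 0 1) u := by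
  rw [(hasFDerivWithinAt_cubeChart hu (mem_chart_source E _)).fderivWithin (uniqueDiffOn_cube u hu),
    coordChange_self (mem_chart_source E _)]
  rfl

theorem SmoothFormFamily.contDiffOn_cubePull {P : Type*} [NormedAddCommGroup P] [NormedSpace ℝ P]
    {α : P → X → E [⋀^Fin j]→L[ℝ] ℝ} (hα : SmoothFormFamily α) (σ : SmoothCube E X k) :
    ContDiffOn ℝ ∞ (fun q : P × (Fin k → ℝ) => cubePull (α q.1) σ q.2)
      (univ ×ˢ Icc (0 : Fin k → ℝ) 1) := by
  rintro ⟨s, u⟩ ⟨-, hu⟩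
  have hu : u ∈ Icc (0 : Fin k → ℝ) 1 := hu
  set x₀ := clampExt σ.toFun u
  have hx : clampExt σ.toFun u ∈ (chartAt E x₀).source := mem_chart_source E _
  have hF := contDiffWithinAt_cubeChart hu hx
  have hG := hF.fderivWithin_right (m := ∞) uniqueDiffOn_cube (by simp) hu
  have hsnd : MapsTo (Prod.snd : P × (Fin k → ℝ) → Fin k → ℝ) (univ ×ˢ Icc 0 1) (Icc 0 1) :=
    fun q hq => hq.2
  have hF' := hF.comp (f := Prod.snd) (s, u) contDiffWithinAt_snd hsnd
  have h1 : ContDiffWithinAt ℝ ∞ (fun q : P × (Fin k → ℝ) =>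
      formInChart (α q.1) x₀ (cubeChart σ x₀ q.2)) (univ ×ˢ Icc 0 1) (s, u) :=
    ContDiffAt.comp_contDiffWithinAt (x := (s, u))
      (g := fun q : P × E => formInChart (α q.1) x₀ q.2)
      (f := fun q : P × (Fin k → ℝ) => ((q.1, cubeChart σ x₀ q.2) : P × E))
      (hα.contDiffAt ((chartAt E x₀).map_source hx) s) (contDiffWithinAt_fst.prodMk hF')
  have h2 : ContDiffWithinAt ℝ ∞ (fun q : P × (Fin k → ℝ) =>
      fderivWithin ℝ (cubeChart σ x₀) (Icc 0 1) q.2) (univ ×ˢ Icc 0 1) (s, u) :=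
    hG.comp (f := Prod.snd) (s, u) contDiffWithinAt_snd hsnd
  have h3 := ContDiffAt.comp_contDiffWithinAt (s, u)
    contDiff_compContinuousLinearMap.contDiffAt (h1.prodMk h2)
  refine h3.congr_of_eventuallyEq ?_ (cubePull_eq _ hu hx)
  have hev : ∀ᶠ q : P × (Fin k → ℝ) in nhdsWithin (s, u) (univ ×ˢ Icc 0 1),
      clampExt σ.toFun q.2 ∈ (chartAt E x₀).source := by
    rw [nhdsWithin_prod_eq]
    exact Filter.tendsto_snd.eventually (eventually_clampExt_mem_source hu hx)
  filter_upwards [hev, self_mem_nhdsWithin] with q hq hqI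
  exact cubePull_eq _ hqI.2 hq

theorem IsSmoothForm.contDiffOn_cubePull {α : X → E [⋀^Fin j]→L[ℝ] ℝ} (hα : IsSmoothForm α)
    (σ : SmoothCube E X k) : ContDiffOn ℝ ∞ (cubePull α σ) (Icc (0 : Fin k → ℝ) 1) :=
  (SmoothFormFamily.contDiffOn_cubePull hα σ).comp (t := univ ×ˢ Icc 0 1)
    (f := fun u => ((0 : ℝ), u)) (contDiff_const.prodMk contDiff_id).contDiffOn
    fun _ hu => ⟨mem_univ _, hu⟩

/-- `extDeriv` needs full derivatives, whereas a cube is differentiated within the closed cube; the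
two agree only at interior points. -/
theorem extDeriv_cubePull {α : X → E [⋀^Fin j]→L[ℝ] ℝ} (hα : IsSmoothForm α)
    (hu : u ∈ interior (Icc (0 : Fin k → ℝ) 1)) :
    extDeriv (cubePull α σ) u = cubePull (dForm α) σ u := by
  have hI := mem_interior_iff_mem_nhds.1 hu
  have hu' := interior_subset hu
  set x := clampExt σ.toFun u with hxd
  have hx : clampExt σ.toFun u ∈ (chartAt E x).source := mem_chart_source E _
  have hloc : cubePull α σ =ᶠ[nhds u] fun w =>
      (formInChart α x (cubeChart σ x w)).compContinuousLinearMap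
        (fderiv ℝ (cubeChart σ x) w) := by
    have h := eventually_clampExt_mem_source hu' hx
    rw [nhdsWithin_eq_nhds.2 hI] at h
    filter_upwards [h, isOpen_interior.mem_nhds hu] with w hw hwI
    rw [cubePull_eq α (interior_subset hwI) hw,
      fderivWithin_of_mem_nhds (mem_interior_iff_mem_nhds.1 hwI)]
  rw [hloc.extDeriv_eq, extDeriv_pullback (r := ∞)]
  · rw [cubePull, cubeDeriv_eq hu', fderivWithin_of_mem_nhds hI]
    rfl
  · exact hα.differentiableAt x
  · exact (contDiffWithinAt_cubeChart hu' hx).contDiffAt hI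
  · simp [minSmoothness_of_isRCLikeNormedField]; norm_cast

end Cubes

/-! ### Faces of cubes and Stokes' theorem on a cube -/

section Faces

variable {E : Type*} [NormedAddCommGroup E] [NormedSpace ℝ E]
  {X : Type*} [TopologicalSpace X] [ChartedSpace E X] {k : ℕ}

theorem clampExt_face (σ : SmoothCube E X (k + 1)) (i : Fin (k + 1)) (e : unitInterval)
    (u : Fin k → ℝ) : clampExt (σ.face i e).toFun u =
      clampExt σ.toFun (Fin.insertNth (α := fun _ => ℝ) i (e : ℝ) u) :=
  clampExt_insertNth σ.toFun i e u

theorem insertNth_mem_Icc {i : Fin (k + 1)} {e : ℝ} (he : e ∈ Icc (0 : ℝ) 1) {u : Fin k → ℝ}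
    (hu : u ∈ Icc (0 : Fin k → ℝ) 1) :
    (Fin.insertNth (α := fun _ => ℝ) i e u : Fin (k + 1) → ℝ) ∈ Icc (0 : Fin (k + 1) → ℝ) 1 := by
  constructor <;> intro a <;> refine Fin.succAboveCases i ?_ ?_ a
  · simpa using he.1
  · intro a; simpa using hu.1 a
  · simpa using he.2
  · intro a; simpa using hu.2 a

/-- The linear part of the affine embedding of a face of a cube. -/
noncomputable def faceCLM (i : Fin (k + 1)) : (Fin k → ℝ) →L[ℝ] (Fin (k + 1) → ℝ) :=
  ContinuousLinearMap.pi fun a =>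
    i.succAboveCases (α := fun _ => (Fin k → ℝ) →L[ℝ] ℝ) 0 (fun b => ContinuousLinearMap.proj b) a

theorem faceCLM_single (i : Fin (k + 1)) (a : Fin k) :
    faceCLM i (Pi.single a 1) = Pi.single (i.succAbove a) 1 := by
  funext b
  refine Fin.succAboveCases i ?_ ?_ b
  · simp [faceCLM, Fin.ne_succAbove]
  · intro b
    simp [faceCLM, Pi.single_apply]

theorem hasFDerivAt_insertNth (i : Fin (k + 1)) (e : ℝ) (u : Fin k → ℝ) :
    HasFDerivAt (fun u : Fin k → ℝ => (Fin.insertNth (α := fun _ => ℝ) i e u : Fin (k + 1) → ℝ))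
      (faceCLM i) u := by
  rw [hasFDerivAt_pi']
  intro a
  refine Fin.succAboveCases i ?_ ?_ a
  · have : (ContinuousLinearMap.proj i).comp (faceCLM i) = (0 : (Fin k → ℝ) →L[ℝ] ℝ) := by
      ext; simp [faceCLM]
    simpa [this] using hasFDerivAt_const e u
  · intro b
    have : (ContinuousLinearMap.proj (i.succAbove b)).comp (faceCLM i) =
        (ContinuousLinearMap.proj b : (Fin k → ℝ) →L[ℝ] ℝ) := by
      ext; simp [faceCLM]
    simp only [Fin.insertNth_apply_succAbove, this]
    exact hasFDerivAt_apply b u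

variable [IsManifold 𝓘(ℝ, E) ∞ X] {σ : SmoothCube E X (k + 1)} {i : Fin (k + 1)}
  {e : unitInterval} {u : Fin k → ℝ}

/-- Chain rule within the closed cubes for the affine embedding of the face. It applies on the
boundary because cubes are smooth up to the boundary. -/
theorem cubeDeriv_face (hu : u ∈ Icc (0 : Fin k → ℝ) 1) :
    cubeDeriv (σ.face i e) u =
      (cubeDeriv σ (Fin.insertNth (α := fun _ => ℝ) i (e : ℝ) u)).comp (faceCLM i) := by
  have hw := insertNth_mem_Icc (i := i) e.2 hu
  rw [cubeDeriv_eq hu, cubeDeriv_eq hw, clampExt_face]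
  have h1 := ((contDiffWithinAt_cubeChart (σ := σ) hw
    (mem_chart_source E (clampExt σ.toFun (Fin.insertNth (α := fun _ => ℝ) i (e : ℝ) u)))
      ).differentiableWithinAt (by simp)).hasFDerivWithinAt
  have h2 := h1.comp u (hasFDerivAt_insertNth i (e : ℝ) u).hasFDerivWithinAt
    (fun w hw => insertNth_mem_Icc e.2 hw)
  refine HasFDerivWithinAt.fderivWithin (h2.congr_of_eventuallyEq ?_ ?_) (uniqueDiffOn_cube u hu)
  · exact Filter.Eventually.of_forall fun w => congrArg _ (clampExt_face σ i e w)
  · exact congrArg _ (clampExt_face σ i e u)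

theorem cubePull_face (α : X → E [⋀^Fin k]→L[ℝ] ℝ) (hu : u ∈ Icc (0 : Fin k → ℝ) 1) :
    cubePull α (σ.face i e) u (fun a => Pi.single a 1) =
      cubePull α σ (Fin.insertNth (α := fun _ => ℝ) i (e : ℝ) u)
        (i.removeNth (α := fun _ => Fin (k + 1) → ℝ) fun a => Pi.single a 1) := by
  rw [cubePull, cubePull, cubeDeriv_face hu, clampExt_face]
  refine congrArg (α _) (funext fun a => ?_)
  exact congrArg (cubeDeriv σ _) (faceCLM_single i a)

/-- Stokes' theorem on a smooth cube. -/
theorem cubeIntegral_dForm {α : X → E [⋀^Fin k]→L[ℝ] ℝ} (hα : IsSmoothForm α)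
    (σ : SmoothCube E X (k + 1)) : cubeIntegral (dForm α) σ = ∑ i : Fin (k + 1),
      (-1 : ℝ) ^ (i : ℕ) * (cubeIntegral α (σ.face i 1) - cubeIntegral α (σ.face i 0)) := by
  let e : Fin (k + 1) → Fin (k + 1) → ℝ := fun a => Pi.single a 1
  -- The vector field whose divergence is `dα` on the standard frame and whose flux through the
  -- `i`-th faces is, up to sign, the integral of `α`; Stokes becomes the divergence theorem on a
  -- box.
  let f : Fin (k + 1) → (Fin (k + 1) → ℝ) → ℝ := fun i u =>
    (-1 : ℝ) ^ (i : ℕ) * cubePull α σ u (i.removeNth e)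
  have hcont := hα.contDiffOn_cubePull σ
  have happ : ∀ v : Fin k → Fin (k + 1) → ℝ,
      ContDiffOn ℝ ∞ (fun u => cubePull α σ u v) (Icc (0 : Fin (k + 1) → ℝ) 1) := fun v =>
    (ContinuousAlternatingMap.apply ℝ (Fin (k + 1) → ℝ) ℝ v).contDiff.comp_contDiffOn hcont
  have hint : pi univ (fun i : Fin (k + 1) => Ioo ((0 : Fin (k + 1) → ℝ) i) ((1 : Fin (k + 1) → ℝ) i))
      = interior (Icc (0 : Fin (k + 1) → ℝ) 1) := by
    rw [← pi_univ_Icc, interior_pi_set finite_univ]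
    simp
  have hder : ∀ u ∈ interior (Icc (0 : Fin (k + 1) → ℝ) 1),
      ∑ i, fderiv ℝ (f i) u (e i) = cubePull (dForm α) σ u e := by
    intro u hu
    have hd : DifferentiableAt ℝ (cubePull α σ) u :=
      (hcont.contDiffAt (mem_interior_iff_mem_nhds.1 hu)).differentiableAt (by simp)
    rw [← extDeriv_cubePull hα hu, extDeriv_apply hd]
    refine Finset.sum_congr rfl fun i _ => ?_
    have hd2 : DifferentiableAt ℝ (fun u => cubePull α σ u (i.removeNth e)) u :=
      ((happ _).contDiffAt (mem_interior_iff_mem_nhds.1 hu)).differentiableAt (by simp)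
    change fderiv ℝ (fun u => (-1 : ℝ) ^ (i : ℕ) * cubePull α σ u (i.removeNth e)) u (e i) = _
    rw [fderiv_const_mul hd2]
    simp
  -- The boundary of the cube is a null set, so the interior formula is enough. Integrability of the
  -- divergence comes from continuity of the pullback of `dα` up to the boundary.
  have hae : (fun u => ∑ i, fderiv ℝ (f i) u (e i)) =ᵐ[MeasureTheory.volume.restrict
      (Icc (0 : Fin (k + 1) → ℝ) 1)] fun u => cubePull (dForm α) σ u e := by
    have h1 := (MeasureTheory.Measure.univ_pi_Ioo_ae_eq_Icc
      (μ := fun _ : Fin (k + 1) => (MeasureTheory.volume : MeasureTheory.Measure ℝ))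
      (f := (0 : Fin (k + 1) → ℝ)) (g := 1))
    rw [← MeasureTheory.volume_pi, hint] at h1
    rw [← MeasureTheory.Measure.restrict_congr_set h1]
    exact (MeasureTheory.ae_restrict_iff' isOpen_interior.measurableSet).2
      (Filter.Eventually.of_forall hder)
  have hdc : ContinuousOn (fun u => cubePull (dForm α) σ u e) (Icc (0 : Fin (k + 1) → ℝ) 1) :=
    ((ContinuousAlternatingMap.apply ℝ (Fin (k + 1) → ℝ) ℝ e).contDiff.comp_contDiffOn
      ((SmoothFormFamily.dForm hα).isSmoothForm 0 |>.contDiffOn_cubePull σ)).continuousOn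
  have key := MeasureTheory.integral_divergence_of_hasFDerivAt_off_countable' (0 : Fin (k + 1) → ℝ) 1
    zero_le_one f (fun i u => fderiv ℝ (f i) u) ∅ countable_empty
    (fun i => continuousOn_const.mul (happ _).continuousOn)
    (fun u hu i => by
      rw [sdiff_empty, hint] at hu
      exact (((happ _).contDiffAt (mem_interior_iff_mem_nhds.1 hu)).differentiableAt
        (by simp)).const_mul _ |>.hasFDerivAt)
    ((MeasureTheory.integrable_congr hae).2 (hdc.integrableOn_compact isCompact_Icc))
  rw [cubeIntegral_eq, ← MeasureTheory.integral_congr_ae hae, key]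
  refine Finset.sum_congr rfl fun i _ => ?_
  have hface : ∀ (c : unitInterval), ∫ u in Icc (0 : Fin k → ℝ) 1,
      f i (Fin.insertNth (α := fun _ => ℝ) i (c : ℝ) u) =
        (-1 : ℝ) ^ (i : ℕ) * cubeIntegral α (σ.face i c) := by
    intro c
    rw [cubeIntegral_eq, ← MeasureTheory.integral_const_mul]
    refine MeasureTheory.setIntegral_congr_fun measurableSet_Icc fun u hu => ?_
    exact congrArg _ (cubePull_face α hu).symm
  rw [mul_sub, ← hface 1, ← hface 0]
  rfl

end Faces

/-! ### Cubical chains: `∂∂ = 0` and images under maps -/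

section ChainComplex

variable {E : Type*} [NormedAddCommGroup E] [NormedSpace ℝ E]
  {X : Type*} [TopologicalSpace X] [ChartedSpace E X] {k : ℕ}
  {E' : Type*} [NormedAddCommGroup E'] [NormedSpace ℝ E']
  {Y : Type*} [TopologicalSpace Y] [ChartedSpace E' Y]

/-- The boundary of a single smooth cube. -/
noncomputable def cubeBoundary (σ : SmoothCube E X (k + 1)) : Chain E X k :=
  ∑ i : Fin (k + 1), (-1 : ℤ) ^ (i : ℕ) •
    (Finsupp.single (σ.face i 1) (1 : ℤ) - Finsupp.single (σ.face i 0) (1 : ℤ))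

theorem boundary_eq (c : Chain E X (k + 1)) :
    c.boundary = Finsupp.linearCombination ℤ cubeBoundary c := rfl

theorem chainIntegral_eq (c : Chain E X k) (α : X → E [⋀^Fin k]→L[ℝ] ℝ) :
    chainIntegral c α = Finsupp.linearCombination ℤ (cubeIntegral α) c := by
  simp [chainIntegral, Finsupp.linearCombination_apply]

theorem boundary_map {f : Y → X} (hf : ContMDiff 𝓘(ℝ, E') 𝓘(ℝ, E) ∞ f)
    (c : Chain E' Y (k + 1)) : (Chain.map hf c).boundary = Chain.map hf c.boundary := by
  rw [boundary_eq, boundary_eq, Chain.map, Chain.map, Finsupp.linearCombination_mapDomain]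
  change _ = Finsupp.lmapDomain ℤ ℤ (SmoothCube.map hf) _
  rw [Finsupp.apply_linearCombination]
  congr 2
  funext σ
  simp only [Function.comp_apply, cubeBoundary, map_sum, map_zsmul, map_sub,
    Finsupp.lmapDomain_apply, Finsupp.mapDomain_single]
  rfl

/-- Distinct cubes have distinct images, so no cancellation can occur in the image chain. This is
where injectivity of `N → M` enters. -/
theorem map_injective {f : Y → X} (hf : ContMDiff 𝓘(ℝ, E') 𝓘(ℝ, E) ∞ f)
    (hinj : Function.Injective f) :
    Function.Injective (Chain.map (k := k) hf) := by
  refine Finsupp.mapDomain_injective fun σ σ' h => SmoothCube.ext (funext fun v => hinj ?_)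
  exact congrFun (congrArg SmoothCube.toFun h) v

/-- Two coordinates may be frozen in either order; `succAbove` and `predAbove` renumber them after
the exchange. -/
theorem face_face (σ : SmoothCube E X (k + 2)) (i : Fin (k + 2)) (j : Fin (k + 1))
    (e e' : unitInterval) :
    (σ.face i e).face j e' = (σ.face (i.succAbove j) e').face (j.predAbove i) e := by
  refine SmoothCube.ext (funext fun v => congrArg σ.toFun ?_)
  symm
  rw [Fin.insertNth_eq_iff]
  refine ⟨by simp, ?_⟩
  rw [Fin.insertNth_eq_iff]
  refine ⟨by simp [Fin.removeNth, Fin.succAbove_succAbove_predAbove], ?_⟩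
  rw [← Fin.removeNth_removeNth_eq_swap]
  simp

theorem boundary_cubeBoundary (σ : SmoothCube E X (k + 2)) :
    Chain.boundary (cubeBoundary σ) = 0 := by
  let T : Fin (k + 2) × Fin (k + 1) → Chain E X k := fun p =>
    Finsupp.single ((σ.face p.1 1).face p.2 1) 1 - Finsupp.single ((σ.face p.1 1).face p.2 0) 1 -
      (Finsupp.single ((σ.face p.1 0).face p.2 1) 1 - Finsupp.single ((σ.face p.1 0).face p.2 0) 1)
  have hT : ∀ p : Fin (k + 2) × Fin (k + 1), T (p.1.succAbove p.2, p.2.predAbove p.1) = T p := by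
    intro p
    simp only [T, ← face_face]
    abel
  have h1 : Chain.boundary (cubeBoundary σ) =
      ∑ p : Fin (k + 2) × Fin (k + 1), (-1 : ℤ) ^ ((p.1 : ℕ) + (p.2 : ℕ)) • T p := by
    rw [boundary_eq, cubeBoundary, Fintype.sum_prod_type]
    simp only [map_sum, map_zsmul, map_sub, Finsupp.linearCombination_single, one_smul]
    refine Finset.sum_congr rfl fun i _ => ?_
    rw [cubeBoundary, cubeBoundary, ← Finset.sum_sub_distrib, Finset.smul_sum]
    refine Finset.sum_congr rfl fun j _ => ?_
    rw [← smul_sub, smul_smul, pow_add]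
  rw [h1]
  -- Exchanging the order of the two frozen coordinates fixes the double face combination `T` and
  -- reverses the sign, without fixed points.
  refine Finset.sum_involution (fun p _ => (p.1.succAbove p.2, p.2.predAbove p.1)) ?_ ?_ ?_ ?_
  · intro p _
    rw [hT]
    dsimp only
    rw [Fin.neg_one_pow_succAbove_add_predAbove, pow_add]
    simp
  · intro p _ _ h
    exact Fin.succAbove_ne p.1 p.2 (congrArg Prod.fst h)
  · intro p _
    exact Finset.mem_univ _
  · intro p _
    exact Prod.ext (Fin.succAbove_succAbove_predAbove p.1 p.2)
      (Fin.predAbove_predAbove_succAbove p.1 p.2)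

theorem boundary_boundary (c : Chain E X (k + 2)) : c.boundary.boundary = 0 := by
  rw [boundary_eq c, boundary_eq, Finsupp.apply_linearCombination]
  have : (⇑(Finsupp.linearCombination ℤ (cubeBoundary (E := E) (X := X) (k := k))) ∘ cubeBoundary) =
      0 := funext fun σ => boundary_cubeBoundary σ
  rw [this]
  simp

theorem cubeIntegral_map {f : Y → X} (hf : ContMDiff 𝓘(ℝ, E') 𝓘(ℝ, E) ∞ f)
    (α : X → E [⋀^Fin k]→L[ℝ] ℝ)
    (σ : SmoothCube E' Y k) : cubeIntegral α (σ.map hf) = cubeIntegral (pullForm f α) σ := by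
  refine MeasureTheory.setIntegral_congr_fun measurableSet_Icc fun u hu => ?_
  refine congrArg (α _) (funext fun i => ?_)
  have h := mfderiv_comp_mfderivWithin (I := 𝓘(ℝ, Fin k → ℝ)) (I' := 𝓘(ℝ, E')) (I'' := 𝓘(ℝ, E))
    (f := clampExt σ.toFun) (g := f) u (hf.mdifferentiable (by simp) _)
    ((σ.smooth u hu).mdifferentiableWithinAt (by simp))
    (uniqueMDiffWithinAt_iff_uniqueDiffWithinAt.2 (uniqueDiffOn_cube u hu))
  exact DFunLike.congr_fun h _

theorem chainIntegral_map {f : Y → X} (hf : ContMDiff 𝓘(ℝ, E') 𝓘(ℝ, E) ∞ f)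
    (α : X → E [⋀^Fin k]→L[ℝ] ℝ)
    (c : Chain E' Y k) : chainIntegral (Chain.map hf c) α = chainIntegral c (pullForm f α) := by
  rw [chainIntegral_eq, chainIntegral_eq, Chain.map, Finsupp.linearCombination_mapDomain]
  congr 2
  exact funext fun σ => cubeIntegral_map hf α σ

end ChainComplex

/-! ### Integration over chains: linearity, Stokes, differentiation under the integral -/

section ChainIntegrals

variable {E : Type*} [NormedAddCommGroup E] [NormedSpace ℝ E]
  {X : Type*} [TopologicalSpace X] [ChartedSpace E X] {k : ℕ}

theorem chainIntegral_congr {α β : X → E [⋀^Fin k]→L[ℝ] ℝ} {s : Set X} (h : ∀ x ∈ s, α x = β x)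
    {c : Chain E X k} (hc : c.LiesIn s) : chainIntegral c α = chainIntegral c β := by
  refine Finsupp.sum_congr fun σ hσ => congrArg _ ?_
  refine MeasureTheory.setIntegral_congr_fun measurableSet_Icc fun u _ => ?_
  exact DFunLike.congr_fun (h _ (hc σ hσ (mem_range_self _))) _

theorem chainIntegral_neg (α : X → E [⋀^Fin k]→L[ℝ] ℝ) (c : Chain E X k) :
    chainIntegral c (- α) = - chainIntegral c α := by
  rw [chainIntegral, chainIntegral, ← Finsupp.sum_neg]
  refine Finsupp.sum_congr fun σ _ => ?_
  rw [← mul_neg]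
  exact congrArg _ (MeasureTheory.integral_neg _)

variable [IsManifold 𝓘(ℝ, E) ∞ X]

theorem IsSmoothForm.continuousOn_cubePull_apply {α : X → E [⋀^Fin k]→L[ℝ] ℝ} (hα : IsSmoothForm α)
    {m : ℕ} (σ : SmoothCube E X m) (v : Fin k → Fin m → ℝ) :
    ContinuousOn (fun u => cubePull α σ u v) (Icc (0 : Fin m → ℝ) 1) :=
  (ContinuousAlternatingMap.apply ℝ (Fin m → ℝ) ℝ v).continuous.comp_continuousOn
    (hα.contDiffOn_cubePull σ).continuousOn

theorem IsSmoothForm.integrableOn_cubePull {α : X → E [⋀^Fin k]→L[ℝ] ℝ} (hα : IsSmoothForm α)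
    {m : ℕ} (σ : SmoothCube E X m) (v : Fin k → Fin m → ℝ) :
    MeasureTheory.IntegrableOn (fun u => cubePull α σ u v) (Icc (0 : Fin m → ℝ) 1) :=
  (hα.continuousOn_cubePull_apply σ v).integrableOn_compact isCompact_Icc

theorem IsSmoothForm.chainIntegral_add {α β : X → E [⋀^Fin k]→L[ℝ] ℝ} (hα : IsSmoothForm α)
    (hβ : IsSmoothForm β) (c : Chain E X k) :
    chainIntegral c (α + β) = chainIntegral c α + chainIntegral c β := by
  rw [chainIntegral, chainIntegral, chainIntegral, ← Finsupp.sum_add]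
  refine Finsupp.sum_congr fun σ _ => ?_
  rw [← mul_add]
  exact congrArg _ (MeasureTheory.integral_add (hα.integrableOn_cubePull σ _)
    (hβ.integrableOn_cubePull σ _))

theorem IsSmoothForm.chainIntegral_sub {α β : X → E [⋀^Fin k]→L[ℝ] ℝ} (hα : IsSmoothForm α)
    (hβ : IsSmoothForm β) (c : Chain E X k) :
    chainIntegral c (α - β) = chainIntegral c α - chainIntegral c β := by
  rw [sub_eq_add_neg, sub_eq_add_neg, ← chainIntegral_neg]
  exact hα.chainIntegral_add (SmoothFormFamily.neg hβ) c

/-- Stokes' theorem on a smooth chain. -/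
theorem IsSmoothForm.chainIntegral_dForm {α : X → E [⋀^Fin k]→L[ℝ] ℝ} (hα : IsSmoothForm α)
    (c : Chain E X (k + 1)) : chainIntegral c (dForm α) = chainIntegral c.boundary α := by
  rw [chainIntegral_eq, chainIntegral_eq, boundary_eq, Finsupp.apply_linearCombination]
  congr 2
  funext σ
  rw [cubeIntegral_dForm hα, Function.comp_apply, cubeBoundary]
  simp only [map_sum, map_zsmul, map_sub, Finsupp.linearCombination_single, one_smul,
    zsmul_eq_mul]
  push_cast
  rfl

theorem SmoothFormFamily.hasDerivAt_cubeIntegral {α : ℝ → X → E [⋀^Fin k]→L[ℝ] ℝ}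
    (hα : SmoothFormFamily α) (σ : SmoothCube E X k) (t : ℝ) :
    HasDerivAt (fun s => cubeIntegral (α s) σ)
      (cubeIntegral (fun x => _root_.deriv (fun s => α s x) t) σ) t := by
  let e : Fin k → Fin k → ℝ := fun i => Pi.single i 1
  let α' : ℝ → X → E [⋀^Fin k]→L[ℝ] ℝ := fun s x => _root_.deriv (fun s => α s x) s
  have hα' : SmoothFormFamily α' := hα.deriv
  have hK : IsCompact (Icc (t - 1) (t + 1) ×ˢ Icc (0 : Fin k → ℝ) 1) :=
    isCompact_Icc.prod isCompact_Icc
  have hcont : ContinuousOn (fun q : ℝ × (Fin k → ℝ) => cubePull (α' q.1) σ q.2 e)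
      (Icc (t - 1) (t + 1) ×ˢ Icc (0 : Fin k → ℝ) 1) :=
    (ContinuousAlternatingMap.apply ℝ (Fin k → ℝ) ℝ e).continuous.comp_continuousOn
      ((hα'.contDiffOn_cubePull σ).continuousOn.mono (prod_mono_left (subset_univ _)))
  -- A dominating constant: the parameter derivative is jointly continuous on a compact time
  -- interval times the cube.
  obtain ⟨C, hC⟩ := hK.exists_bound_of_continuousOn hcont
  refine (hasDerivAt_integral_of_dominated_loc_of_deriv_le
    (μ := MeasureTheory.volume.restrict (Icc (0 : Fin k → ℝ) 1)) (bound := fun _ => C)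
    (F := fun s u => cubePull (α s) σ u e) (F' := fun s u => cubePull (α' s) σ u e)
    (Icc_mem_nhds (sub_one_lt t) (lt_add_one t)) ?_ ?_ ?_ ?_ ?_ ?_).2
  · exact Filter.Eventually.of_forall fun s =>
      ((hα.isSmoothForm s).integrableOn_cubePull σ e).aestronglyMeasurable
  · exact (hα.isSmoothForm t).integrableOn_cubePull σ e
  · exact ((hα'.isSmoothForm t).integrableOn_cubePull σ e).aestronglyMeasurable
  · exact (MeasureTheory.ae_restrict_iff' measurableSet_Icc).2
      (Filter.Eventually.of_forall fun u hu s hs => hC (s, u) ⟨hs, hu⟩)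
  · exact continuousOn_const.integrableOn_compact isCompact_Icc
  · refine Filter.Eventually.of_forall fun u s _ => ?_
    exact (ContinuousAlternatingMap.apply ℝ E ℝ fun i => cubeDeriv σ u (e i)
      ).hasFDerivAt.comp_hasDerivAt
      s (hα.hasDerivAt (clampExt σ.toFun u) s)

/-- Differentiation under the integral over a chain. -/
theorem SmoothFormFamily.hasDerivAt_chainIntegral {α : ℝ → X → E [⋀^Fin k]→L[ℝ] ℝ}
    (hα : SmoothFormFamily α) (c : Chain E X k) (t : ℝ) :
    HasDerivAt (fun s => chainIntegral c (α s))
      (chainIntegral c (fun x => _root_.deriv (fun s => α s x) t)) t := by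
  unfold chainIntegral Finsupp.sum
  exact HasDerivAt.fun_sum fun σ _ => (hα.hasDerivAt_cubeIntegral σ t).const_mul _

end ChainIntegrals

/-! ### Exact terms integrate to zero over the cut -/

section Cycles

variable {E : Type*} [NormedAddCommGroup E] [NormedSpace ℝ E]
  {M : Type*} [TopologicalSpace M] [ChartedSpace E M]
  {F : Type*} [NormedAddCommGroup F] [NormedSpace ℝ F]
  {X : Type*} [TopologicalSpace X] [ChartedSpace F X] [IsManifold 𝓘(ℝ, F) ∞ X] {k : ℕ}

/-- `∫_S £_ζ α = ∫_S i_ζ dα` if the image of `S` under an injective map is a boundary. -/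
theorem IsSmoothForm.chainIntegral_lieForm {Sig : Chain E M (k + 1)} {S : Chain F X k}
    {f : X → M} (hf : ContMDiff 𝓘(ℝ, F) 𝓘(ℝ, E) ∞ f) (hinj : Function.Injective f)
    (hS : S.map hf = Sig.boundary) {ζ : X → F} (hζ : IsSmoothVec ζ) {α : X → F [⋀^Fin k]→L[ℝ] ℝ}
    (hα : IsSmoothForm α) : chainIntegral S (lieForm ζ α - iForm ζ (dForm α)) = 0 := by
  cases k with
  | zero =>
    -- In degree 0 the integrand vanishes identically, since there `£_ζ = i_ζ d`.
    change chainIntegral S (iForm ζ (dForm α) - iForm ζ (dForm α)) = 0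
    have h0 := chainIntegral_neg (0 : X → F [⋀^Fin 0]→L[ℝ] ℝ) S
    rw [neg_zero] at h0
    rw [sub_self]
    linarith
  | succ k =>
    have hi : IsSmoothForm (iForm ζ α) := SmoothFormFamily.iForm hα hζ
    -- The image of `∂S` is `∂∂` of `Sig`, hence zero, and pushforward of chains is injective.
    have h0 : S.boundary = 0 := by
      apply map_injective hf hinj
      rw [← boundary_map hf, hS, boundary_boundary]
      exact Finsupp.mapDomain_zero.symm
    change chainIntegral S (dForm (iForm ζ α) + iForm ζ (dForm α) - iForm ζ (dForm α)) = 0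
    rw [add_sub_cancel_right, hi.chainIntegral_dForm, h0]
    simp [chainIntegral]

end Cycles

/-! ### Smoothness of field-space forms pulled back to the hypersurface -/

section Pullbacks

variable {E : Type*} [NormedAddCommGroup E] [NormedSpace ℝ E]
  {W : Type*} [NormedAddCommGroup W] [NormedSpace ℝ W]
  {M : Type*} [TopologicalSpace M] [ChartedSpace E M] [IsManifold 𝓘(ℝ, E) ∞ M] {τ : FieldType E W}
  {F : Type*} [NormedAddCommGroup F] [NormedSpace ℝ F]
  {X : Type*} [TopologicalSpace X] [ChartedSpace F X] [IsManifold 𝓘(ℝ, F) ∞ X] {k : ℕ} {f : X → M}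

theorem IsZeroForm.pullForm (hf : ContMDiff 𝓘(ℝ, F) 𝓘(ℝ, E) ∞ f)
    {α : (M → W) → M → E [⋀^Fin k]→L[ℝ] ℝ} (hα : IsZeroForm τ α) :
    IsZeroForm τ fun ψ => pullForm (E' := F) f (α ψ) :=
  fun P _ _ _ c hc => (hα P c hc).pullForm hf

theorem IsSmoothOneForm.pullForm (hf : ContMDiff 𝓘(ℝ, F) 𝓘(ℝ, E) ∞ f)
    {θ : (M → W) → (M → W) → M → E [⋀^Fin k]→L[ℝ] ℝ}
    (hθ : IsSmoothOneForm τ θ) : IsSmoothOneForm τ fun ψ Y => pullForm (E' := F) f (θ ψ Y) :=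
  fun P _ _ _ c V hc hV => (hθ P c V hc hV).pullForm hf

theorem isZeroForm_chargeDensity [FiniteDimensional ℝ E]
    {b : (M → W) → M → E [⋀^Fin (k + 1)]→L[ℝ] ℝ}
    {lam : (M → W) → (M → W) → M → E [⋀^Fin k]→L[ℝ] ℝ}
    {Q : (M → E) → (M → W) → M → E [⋀^Fin k]→L[ℝ] ℝ}
    {l : (M → W) → X → F [⋀^Fin (k + 1)]→L[ℝ] ℝ}
    {β : (M → W) → (M → W) → X → F [⋀^Fin k]→L[ℝ] ℝ}
    {ξ : (M → W) → M → E} {ξX : (M → W) → X → F} (hf : ContMDiff 𝓘(ℝ, F) 𝓘(ℝ, E) ∞ f)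
    (hb : IsZeroForm τ b)
    (hlam : IsSmoothOneForm τ lam) (hQ : IsSmoothPotential τ Q) (hl : IsZeroForm τ l)
    (hβ : IsSmoothOneForm τ β) (hξ : IsFieldVec τ ξ) (hξX : IsFieldVec τ ξX) :
    IsZeroForm τ fun ψ => chargeDensity τ f (potential τ Q b lam) l β (ξ ψ) (ξX ψ) ψ := by
  have : CompleteSpace E := FiniteDimensional.complete ℝ E
  exact (((isZeroForm_potential hQ hb hlam hξ).pullForm hf).add (hl.iForm hξX)).sub (hβ.contr1 hξ)

end Pullbacks

/-! ### Variation of charges and the local identity on the hypersurface -/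

section Charges

variable {E : Type*} [NormedAddCommGroup E] [NormedSpace ℝ E] [FiniteDimensional ℝ E]
  {W : Type*} [NormedAddCommGroup W] [NormedSpace ℝ W] [CompleteSpace W]
  {M : Type*} [TopologicalSpace M] [ChartedSpace E M] [IsManifold 𝓘(ℝ, E) ∞ M]
  [T2Space M] [SigmaCompactSpace M] {τ : FieldType E W}
  {F : Type*} [NormedAddCommGroup F] [NormedSpace ℝ F]
  {X : Type*} [TopologicalSpace X] [ChartedSpace F X] [IsManifold 𝓘(ℝ, F) ∞ X] {k : ℕ}
  {φ V : M → W}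

/-- To evaluate `vary` it is enough to exhibit one number that is the derivative along every curve
with the given velocity; differentiation under the integral provides it. -/
theorem IsZeroForm.vary_chainIntegral {α : (M → W) → X → F [⋀^Fin k]→L[ℝ] ℝ}
    (hα : IsZeroForm τ α) {c : ℝ → M → W} (hc : IsCurve τ c φ V) (S : Chain F X k) :
    vary τ (fun ψ => chainIntegral S (α ψ)) φ V =
      chainIntegral S (CovariantPhaseSpace.delta0 τ α φ V) := by
  have h : ∀ c : ℝ → M → W, IsCurve τ c φ V → HasDerivAt (fun t => chainIntegral S (α (c t)))
      (chainIntegral S (CovariantPhaseSpace.delta0 τ α φ V)) 0 := by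
    intro c hc
    rw [hα.delta0_eq hc]
    exact (hα ℝ c hc.1).hasDerivAt_chainIntegral S 0
  exact (Classical.epsilon_spec (p := fun a => ∀ c : ℝ → M → W, IsCurve τ c φ V →
    HasDerivAt (fun t => chainIntegral S (α (c t))) a 0) ⟨_, h⟩ c hc).unique (h c hc)

theorem delta1_sub {θ η : (M → W) → (M → W) → X → F [⋀^Fin k]→L[ℝ] ℝ}
    (hθ : IsSmoothOneForm τ θ) (hη : IsSmoothOneForm τ η) {U : M → W} (hφ : φ ∈ fieldSpace τ)
    (hU : IsVariation τ U) (hV : IsVariation τ V) :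
    delta1 τ (fun ψ Y => θ ψ Y - η ψ Y) φ U V = delta1 τ θ φ U V - delta1 τ η φ U V := by
  obtain ⟨cU, hcU⟩ := exists_isCurve hφ hU
  obtain ⟨cV, hcV⟩ := exists_isCurve hφ hV
  change CovariantPhaseSpace.delta0 τ (fun ψ => θ ψ V - η ψ V) φ U -
    CovariantPhaseSpace.delta0 τ (fun ψ => θ ψ U - η ψ U) φ V = _
  rw [(hθ.isZeroForm hV).delta0_sub (hη.isZeroForm hV) hcU,
    (hθ.isZeroForm hU).delta0_sub (hη.isZeroForm hU) hcV]
  change _ = (delta0 τ (fun ψ => θ ψ V) φ U - delta0 τ (fun ψ => θ ψ U) φ V) -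
    (delta0 τ (fun ψ => η ψ V) φ U - delta0 τ (fun ψ => η ψ U) φ V)
  abel

theorem lieForm_sub {ζ : X → F} (hζ : IsSmoothVec ζ) {α β : X → F [⋀^Fin k]→L[ℝ] ℝ}
    (hα : IsSmoothForm α) (hβ : IsSmoothForm β) :
    lieForm ζ (α - β) = lieForm ζ α - lieForm ζ β := by
  have hi : ∀ {m : ℕ} (a b : X → F [⋀^Fin (m + 1)]→L[ℝ] ℝ),
      iForm ζ (a - b) = iForm ζ a - iForm ζ b := fun _ _ => rfl
  cases k with
  | zero =>
    change iForm ζ (dForm (α - β)) = iForm ζ (dForm α) - iForm ζ (dForm β)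
    rw [hα.dForm_sub hβ, hi]
  | succ k =>
    change dForm (iForm ζ (α - β)) + iForm ζ (dForm (α - β)) =
      dForm (iForm ζ α) + iForm ζ (dForm α) - (dForm (iForm ζ β) + iForm ζ (dForm β))
    have h1 : IsSmoothForm (iForm ζ α) := SmoothFormFamily.iForm hα hζ
    have h2 : IsSmoothForm (iForm ζ β) := SmoothFormFamily.iForm hβ hζ
    rw [hα.dForm_sub hβ, hi, hi, h1.dForm_sub h2]
    abel

theorem anomaly1_sub {θ η : (M → W) → (M → W) → X → F [⋀^Fin k]→L[ℝ] ℝ}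
    (hθ : IsSmoothOneForm τ θ) (hη : IsSmoothOneForm τ η) {ξ : (M → W) → M → E}
    (hξ : IsFieldVec τ ξ) {ξX : (M → W) → X → F} (hξX : IsFieldVec τ ξX)
    (hφ : φ ∈ fieldSpace τ) (hV : IsVariation τ V) :
    anomaly1 τ ξ ξX (fun ψ Y => θ ψ Y - η ψ Y) φ V =
      anomaly1 τ ξ ξX θ φ V - anomaly1 τ ξ ξX η φ V := by
  have : CompleteSpace E := FiniteDimensional.complete ℝ E
  obtain ⟨c, hc⟩ := exists_isCurve hφ hV
  have h1 : contr2 τ ξ (delta1 τ fun ψ Y => θ ψ Y - η ψ Y) φ V =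
      contr2 τ ξ (delta1 τ θ) φ V - contr2 τ ξ (delta1 τ η) φ V :=
    delta1_sub hθ hη hφ (hξ.isVariation_hat hφ) hV
  have h2 : delta0 τ (contr1 τ ξ fun ψ Y => θ ψ Y - η ψ Y) φ V =
      delta0 τ (contr1 τ ξ θ) φ V - delta0 τ (contr1 τ ξ η) φ V :=
    (hθ.contr1 hξ).delta0_sub (hη.contr1 hξ) hc
  have h3 := lieForm_sub (hξX.isSmoothVec hφ) (hθ.isSmoothForm hφ hV) (hη.isSmoothForm hφ hV)
  simp only [anomaly1, lieFS1, contrDelta, h1, h2, h3]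
  abel

variable {f : X → M}

theorem IsZeroForm.delta0_pullForm (hf : ContMDiff 𝓘(ℝ, F) 𝓘(ℝ, E) ∞ f)
    {α : (M → W) → M → E [⋀^Fin k]→L[ℝ] ℝ} 
    (hα : IsZeroForm τ α) {c : ℝ → M → W} (hc : IsCurve τ c φ V) :
    CovariantPhaseSpace.delta0 τ (fun ψ => CovariantPhaseSpace.pullForm (E' := F) f (α ψ)) φ V =
      CovariantPhaseSpace.pullForm f (CovariantPhaseSpace.delta0 τ α φ V) := by
  funext y
  refine ((hα.pullForm hf).hasDerivAt hc y).unique ?_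
  exact (ContinuousAlternatingMap.compContinuousLinearMapCLM
    (show F →L[ℝ] E from mfderiv 𝓘(ℝ, F) 𝓘(ℝ, E) f y)).hasFDerivAt.comp_hasDerivAt 0
      (hα.hasDerivAt hc (f y))

/-- The anomaly operator commutes with the pullback to a hypersurface to which the generator is
tangent. -/
theorem IsSmoothOneForm.anomaly1_pullForm (hf : ContMDiff 𝓘(ℝ, F) 𝓘(ℝ, E) ∞ f)
    {θ : (M → W) → (M → W) → M → E [⋀^Fin k]→L[ℝ] ℝ}
    (hθ : IsSmoothOneForm τ θ) {ξ : (M → W) → M → E} (hξ : IsFieldVec τ ξ)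
    {ξX : (M → W) → X → F} (hφ : φ ∈ fieldSpace τ) (hV : IsVariation τ V)
    (htan : ∀ y, (show F →L[ℝ] E from mfderiv 𝓘(ℝ, F) 𝓘(ℝ, E) f y) (ξX φ y) = ξ φ (f y)) :
    anomaly1 τ ξ ξX (fun ψ Y => CovariantPhaseSpace.pullForm (E' := F) f (θ ψ Y)) φ V =
      CovariantPhaseSpace.pullForm f (anomaly1 τ ξ ξ θ φ V) := by
  have : CompleteSpace E := FiniteDimensional.complete ℝ E
  have hU := hξ.isVariation_hat hφ
  obtain ⟨cU, hcU⟩ := exists_isCurve hφ hU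
  obtain ⟨c, hc⟩ := exists_isCurve hφ hV
  have h1 := (hθ.isZeroForm hV).delta0_pullForm hf hcU
  have h2 := (hθ.isZeroForm hU).delta0_pullForm hf hc
  have h3 := (hθ.contr1 hξ).delta0_pullForm hf hc
  have h4 := pullForm_lieForm hf (hξ.isSmoothVec hφ) htan (hθ.isSmoothForm hφ hV)
  change CovariantPhaseSpace.delta0 τ
      (fun ψ => CovariantPhaseSpace.pullForm (E' := F) f (θ ψ V)) φ (hat τ ξ φ) -
    CovariantPhaseSpace.delta0 τ
      (fun ψ => CovariantPhaseSpace.pullForm (E' := F) f (θ ψ (hat τ ξ φ))) φ V +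
    CovariantPhaseSpace.delta0 τ
      (fun ψ => CovariantPhaseSpace.pullForm (E' := F) f (CovariantPhaseSpace.contr1 τ ξ θ ψ)) φ V -
    lieForm (ξX φ) (CovariantPhaseSpace.pullForm f (θ φ V)) -
    CovariantPhaseSpace.pullForm f (θ φ (lieField τ (deltaVec τ ξ φ V) φ)) = _
  rw [h1, h2, h3, ← h4]
  simp only [← pullForm_sub, ← pullForm_add]
  rfl

variable {θ : (M → W) → (M → W) → M → E [⋀^Fin (k + 1)]→L[ℝ] ℝ}
  {b : (M → W) → M → E [⋀^Fin (k + 1)]→L[ℝ] ℝ}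
  {lam : (M → W) → (M → W) → M → E [⋀^Fin k]→L[ℝ] ℝ}
  {Q : (M → E) → (M → W) → M → E [⋀^Fin k]→L[ℝ] ℝ}
  {l : (M → W) → X → F [⋀^Fin (k + 1)]→L[ℝ] ℝ}
  {β : (M → W) → (M → W) → X → F [⋀^Fin k]→L[ℝ] ℝ}
  {ℰ : (M → W) → (M → W) → X → F [⋀^Fin (k + 1)]→L[ℝ] ℝ}
  {ξ : (M → W) → M → E} {ξX : (M → W) → X → F}

/-- The `δℓ'` part of `i_ξ θ'` completes `δ(i_ξ ℓ')`, and `Δ_ξ̂ β'` in the flux supplies `I_ξ̂ δβ' +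
δ I_ξ̂ β' - £_ξ β' - I_{δξ^} β'`. Only `£_ξ β' - i_ξ dβ'` is left over. It is kept in this form so
that the identity covers degree 0 as well. -/
theorem pullForm_iyerWaldPotential (hf : ContMDiff 𝓘(ℝ, F) 𝓘(ℝ, E) ∞ f) (hb : IsZeroForm τ b)
    (hlam : IsSmoothOneForm τ lam) (hQ : IsSmoothPotential τ Q) (hl : IsZeroForm τ l)
    (hβ : IsSmoothOneForm τ β) (hξ : IsFieldVec τ ξ) (hξX : IsFieldVec τ ξX)
    (hφ : φ ∈ fieldSpace τ) (hV : IsVariation τ V)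
    (htan : ∀ y, (show F →L[ℝ] E from mfderiv 𝓘(ℝ, F) 𝓘(ℝ, E) f y) (ξX φ y) = ξ φ (f y))
    (hdec : pullForm f (θ φ V) = - delta0 τ l φ V + dForm (β φ V) + ℰ φ V) :
    pullForm f (iyerWaldPotential τ θ b lam Q ξ φ V) + contr2 τ ξ (delta1 τ β) φ V =
      delta0 τ (fun ψ => chargeDensity τ f (potential τ Q b lam) l β (ξ ψ) (ξX ψ) ψ) φ V -
        fluxDensity τ f lam β ℰ (chargeDensity τ f (potential τ Q b lam) l β) ξ ξX φ V +
        (lieForm (ξX φ) (β φ V) - iForm (ξX φ) (dForm (β φ V))) := by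
  have : CompleteSpace E := FiniteDimensional.complete ℝ E
  obtain ⟨c, hc⟩ := exists_isCurve hφ hV
  have hq := isZeroForm_potential hQ hb hlam hξ
  have hδh : delta0 τ (fun ψ => chargeDensity τ f (potential τ Q b lam) l β (ξ ψ) (ξX ψ) ψ) φ V =
      pullForm f (delta0 τ (fun ψ => potential τ Q b lam (ξ ψ) ψ) φ V) +
        (iForm (deltaVec τ ξX φ V) (l φ) + iForm (ξX φ) (delta0 τ l φ V)) -
          delta0 τ (contr1 τ ξ β) φ V := by
    have h1 := ((hq.pullForm hf).add (hl.iForm hξX)).delta0_sub (hβ.contr1 hξ) hc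
    rw [(hq.pullForm hf).delta0_add (hl.iForm hξX) hc, hl.delta0_iForm hξX hc,
      hq.delta0_pullForm hf hc] at h1
    exact h1
  have hA := (anomaly1_sub hβ (hlam.pullForm hf) hξ hξX hφ hV).trans
    (congrArg _ (hlam.anomaly1_pullForm hf hξ hφ hV htan))
  have hpull : pullForm f (iyerWaldPotential τ θ b lam Q ξ φ V) =
      pullForm f (delta0 τ (fun ψ => potential τ Q b lam (ξ ψ) ψ) φ V) -
        pullForm f (potential τ Q b lam (deltaVec τ ξ φ V) φ) -
        iForm (ξX φ) (- delta0 τ l φ V + dForm (β φ V) + ℰ φ V) -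
        pullForm f (anomaly1 τ ξ ξ lam φ V) := by
    rw [← hdec, ← pullForm_iForm htan]
    simp only [← pullForm_sub]
    rfl
  have hi : iForm (ξX φ) (- delta0 τ l φ V + dForm (β φ V) + ℰ φ V) =
      - iForm (ξX φ) (delta0 τ l φ V) + iForm (ξX φ) (dForm (β φ V)) + iForm (ξX φ) (ℰ φ V) := rfl
  rw [hpull, hδh, fluxDensity, hA, hi]
  simp only [anomaly1, lieFS1, contrDelta, chargeDensity]
  abel

end Charges

/-! ### The Iyer–Wald identity on the closure of the region -/

section IntegratedCharges

variable {E : Type*} [NormedAddCommGroup E] [NormedSpace ℝ E] [FiniteDimensional ℝ E]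
  {W : Type*} [NormedAddCommGroup W] [NormedSpace ℝ W] [CompleteSpace W]
  {M : Type*} [TopologicalSpace M] [ChartedSpace E M] [IsManifold 𝓘(ℝ, E) ∞ M]
  [T2Space M] [SigmaCompactSpace M] {τ : FieldType E W} {k : ℕ} {φ V : M → W}
  {L : (M → W) → M → E [⋀^Fin (k + 2)]→L[ℝ] ℝ}
  {θ : (M → W) → (M → W) → M → E [⋀^Fin (k + 1)]→L[ℝ] ℝ}
  {EL : (M → W) → M → W →L[ℝ] E [⋀^Fin (k + 2)]→L[ℝ] ℝ} {U : Set M}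
  {b : (M → W) → M → E [⋀^Fin (k + 1)]→L[ℝ] ℝ}
  {lam : (M → W) → (M → W) → M → E [⋀^Fin k]→L[ℝ] ℝ}
  {Q : (M → E) → (M → W) → M → E [⋀^Fin k]→L[ℝ] ℝ}
  {ξ : (M → W) → M → E}

theorem iyerWald_of_mem_closure (hL : IsZeroForm τ L) (hθ : IsSmoothOneForm τ θ)
    (hvar : ∀ φ ∈ fieldSpace τ, ∀ V, IsVariation τ V → ∀ x ∈ U,
      delta0 τ L φ V x = EL φ x (V x) + dForm (θ φ V) x)
    (hb : IsZeroForm τ b) (hlam : IsSmoothOneForm τ lam) (hQ : IsSmoothPotential τ Q)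
    (hanom : ∀ ζ : (M → W) → M → E, IsFieldVec τ ζ →
      ∀ φ ∈ fieldSpace τ, ∀ V, IsVariation τ V → ∀ x ∈ U,
        anomaly1 τ ζ ζ θ φ V x =
          anomaly1 τ ζ ζ (delta0 τ b) φ V x + dForm (anomaly1 τ ζ ζ lam φ V) x)
    (hnoether : ∀ ζ : M → E, IsSmoothVec ζ → ∀ φ ∈ solutionSpace τ EL U, ∀ x ∈ U,
      covCurrent τ L θ b lam ζ φ x = dForm (Q ζ φ) x)
    (hξ : IsFieldVec τ ξ) (hφ : φ ∈ solutionSpace τ EL U)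
    (hV : IsTangent τ (solutionSpace τ EL U) φ V) {x : M} (hx : x ∈ closure U) :
    - contr2 τ ξ (delta1 τ θ) φ V x = dForm (iyerWaldPotential τ θ b lam Q ξ φ V) x := by
  have : CompleteSpace E := FiniteDimensional.complete ℝ E
  have hVv : IsVariation τ V := hV.choose_spec.1.isVariation
  have hω : IsSmoothForm (contr2 τ ξ (delta1 τ θ) φ V) :=
    hθ.isSmoothForm_delta1 hφ.1 (hξ.isVariation_hat hφ.1) hVv
  have hA := isSmoothForm_iyerWaldPotential hθ hb hlam hQ hξ hφ.1 hVv
  have hdiff : IsSmoothForm (- contr2 τ ξ (delta1 τ θ) φ V -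
      dForm (iyerWaldPotential τ θ b lam Q ξ φ V)) :=
    (SmoothFormFamily.neg hω).sub (SmoothFormFamily.dForm hA)
  refine sub_eq_zero.1 (hdiff.eq_zero_of_mem_closure (U := U) (fun y hy => sub_eq_zero.2 ?_) hx)
  refine iyerWald_of_mem hL hθ hb hlam hQ hξ hV (fun ψ hψ ζ hζ => hnoether ζ hζ ψ hψ y hy) ?_
    (hanom ξ hξ φ hφ.1 V hVv y hy)
  -- On shell the variation of `L'` reduces to `dθ'`.
  rw [hvar φ hφ.1 V hVv y hy, hφ.2 y hy]
  simp

end IntegratedCharges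

end CovariantPhaseSpace

/-! ### The main theorem -/

theorem mainTheorem1 {n : ℕ}
    {M : Type*} [TopologicalSpace M] [T2Space M] [SigmaCompactSpace M]
    [ChartedSpace (EuclideanSpace ℝ (Fin (n + 2))) M]
    [IsManifold 𝓘(ℝ, EuclideanSpace ℝ (Fin (n + 2))) ∞ M]
    {W : Type*} [NormedAddCommGroup W] [NormedSpace ℝ W] [FiniteDimensional ℝ W]
    (τ : FieldType (EuclideanSpace ℝ (Fin (n + 2))) W)
    (U : Set M) (hU : IsOpen U)
    -- the Lagrangian, the symplectic potential, and the field equations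
    (L : (M → W) → M → EuclideanSpace ℝ (Fin (n + 2)) [⋀^Fin (n + 2)]→L[ℝ] ℝ)
    (θ : (M → W) → (M → W) → M → EuclideanSpace ℝ (Fin (n + 2)) [⋀^Fin (n + 1)]→L[ℝ] ℝ)
    (EL : (M → W) → M → W →L[ℝ] EuclideanSpace ℝ (Fin (n + 2)) [⋀^Fin (n + 2)]→L[ℝ] ℝ)
    (hLsmooth : IsZeroForm τ L) (hθsmooth : IsOneForm τ θ)
    (hL : ∀ φ ∈ fieldSpace τ, ∀ V, IsVariation τ V → ∀ x ∈ U,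
      delta0 τ L φ V x = EL φ x (V x) + dForm (θ φ V) x)
    -- the quantities `b'` and `λ'` that describe the noncovariance of `L'` and `θ'`
    (b : (M → W) → M → EuclideanSpace ℝ (Fin (n + 2)) [⋀^Fin (n + 1)]→L[ℝ] ℝ)
    (lam : (M → W) → (M → W) → M → EuclideanSpace ℝ (Fin (n + 2)) [⋀^Fin n]→L[ℝ] ℝ)
    (hbsmooth : IsZeroForm τ b) (hlamsmooth : IsOneForm τ lam)
    (hb : ∀ ζ : (M → W) → M → EuclideanSpace ℝ (Fin (n + 2)), IsFieldVec τ ζ →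
      ∀ φ ∈ fieldSpace τ, ∀ x ∈ U,
        anomaly0 τ ζ ζ L φ x = dForm (anomaly0 τ ζ ζ b φ) x)
    (hlam : ∀ ζ : (M → W) → M → EuclideanSpace ℝ (Fin (n + 2)), IsFieldVec τ ζ →
      ∀ φ ∈ fieldSpace τ, ∀ V, IsVariation τ V → ∀ x ∈ U,
        anomaly1 τ ζ ζ θ φ V x =
          anomaly1 τ ζ ζ (delta0 τ b) φ V x + dForm (anomaly1 τ ζ ζ lam φ V) x)
    -- the potential of the Noether current of the covariant Lagrangian
    (Q : (M → EuclideanSpace ℝ (Fin (n + 2))) → (M → W) →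
      M → EuclideanSpace ℝ (Fin (n + 2)) [⋀^Fin n]→L[ℝ] ℝ)
    (hQsmooth : IsSmoothPotential τ Q)
    (hQ : ∀ ζ : M → EuclideanSpace ℝ (Fin (n + 2)), IsSmoothVec ζ →
      ∀ φ ∈ solutionSpace τ EL U, ∀ x ∈ U,
        covCurrent τ L θ b lam ζ φ x = dForm (Q ζ φ) x) :
    -- the generalized Iyer-Wald identity
    (∀ ξ : (M → W) → M → EuclideanSpace ℝ (Fin (n + 2)), IsFieldVec τ ξ →
      ∀ φ ∈ solutionSpace τ EL U, ∀ V, IsTangent τ (solutionSpace τ EL U) φ V →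
      ∀ x ∈ closure U,
        - contr2 τ ξ (delta1 τ θ) φ V x =
          dForm (delta0 τ (fun ψ => potential τ Q b lam (ξ ψ) ψ) φ V
            - potential τ Q b lam (deltaVec τ ξ φ V) φ
            - iForm (ξ φ) (θ φ V) - anomaly1 τ ξ ξ lam φ V) x) ∧
    -- the boundary component `N`, and the decomposition of the pullback of `θ'` to `N`
    (∀ {N : Type*} [TopologicalSpace N] [ChartedSpace (EuclideanSpace ℝ (Fin (n + 1))) N]
      [IsManifold 𝓘(ℝ, EuclideanSpace ℝ (Fin (n + 1))) ∞ N]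
      (f : N → M)
      (hf : ContMDiff 𝓘(ℝ, EuclideanSpace ℝ (Fin (n + 1)))
        𝓘(ℝ, EuclideanSpace ℝ (Fin (n + 2))) ∞ f)
      (_ : Function.Injective f)
      (l : (M → W) → N → EuclideanSpace ℝ (Fin (n + 1)) [⋀^Fin (n + 1)]→L[ℝ] ℝ)
      (β : (M → W) → (M → W) → N → EuclideanSpace ℝ (Fin (n + 1)) [⋀^Fin n]→L[ℝ] ℝ)
      (ℰ : (M → W) → (M → W) → N → EuclideanSpace ℝ (Fin (n + 1)) [⋀^Fin (n + 1)]→L[ℝ] ℝ)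
      (_ : IsZeroForm τ l) (_ : IsOneForm τ β) (_ : IsOneForm τ ℰ)
      (_ : ∀ φ ∈ solutionSpace τ EL U, ∀ V, IsTangent τ (solutionSpace τ EL U) φ V →
        pullForm f (θ φ V) = - delta0 τ l φ V + dForm (β φ V) + ℰ φ V)
      -- the possibly field-dependent generator `ξ`, tangent to `N`
      (ξ : (M → W) → M → EuclideanSpace ℝ (Fin (n + 2))) (_ : IsFieldVec τ ξ)
      (ξN : (M → W) → N → EuclideanSpace ℝ (Fin (n + 1))) (_ : IsFieldVec τ ξN)
      (_ : ∀ φ ∈ fieldSpace τ, ∀ y : N,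
        mfderiv 𝓘(ℝ, EuclideanSpace ℝ (Fin (n + 1))) 𝓘(ℝ, EuclideanSpace ℝ (Fin (n + 2))) f y
          (ξN φ y) = ξ φ (f y))
      -- the slice `Σ` in the closure of the region, with `∂Σ` the image of a chain `S` in `N`
      (Sig : Chain (EuclideanSpace ℝ (Fin (n + 2))) M (n + 1))
      (S : Chain (EuclideanSpace ℝ (Fin (n + 1))) N n)
      (_ : Sig.LiesIn (closure U)) (_ : S.map hf = Sig.boundary)
      (φ : M → W) (_ : φ ∈ solutionSpace τ EL U)
      (V : M → W) (_ : IsTangent τ (solutionSpace τ EL U) φ V),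
      let h := chargeDensity τ f (potential τ Q b lam) l β
      let Ω := symplecticForm τ θ β Sig S
      let flux := chainIntegral S (fluxDensity τ f lam β ℰ h ξ ξN φ V)
      let H := fun ψ : M → W => chainIntegral S (h (ξ ψ) (ξN ψ) ψ)
      -- the contraction of `ξ̂` into the subregion symplectic form
      (- Ω φ (hat τ ξ φ) V =
        chainIntegral S (delta0 τ (fun ψ => h (ξ ψ) (ξN ψ) ψ) φ V) - flux) ∧
      -- the modified Hamilton equation
      (vary τ H φ V = - Ω φ (hat τ ξ φ) V + flux)) := by
  have : CompleteSpace W := FiniteDimensional.complete ℝ W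
  have hθ := hθsmooth.isSmoothOneForm
  have hlam' := hlamsmooth.isSmoothOneForm
  refine ⟨fun ξ hξ φ hφ V hV x hx => iyerWald_of_mem_closure hLsmooth hθ hL hbsmooth hlam'
    hQsmooth hlam hQ hξ hφ hV hx, ?_⟩
  intro N _ _ _ f hf hinj l β ℰ hl hβ hℰ hdec ξ hξ ξN hξN htan Sig S hSig hS φ hφ V hV h Ω flux H
  have hβ' := hβ.isSmoothOneForm
  obtain ⟨c, hc⟩ : ∃ c, IsCurve τ c φ V := ⟨_, hV.choose_spec.1⟩
  have hVv := hc.isVariation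
  have hU' := hξ.isVariation_hat hφ.1
  have hh : IsZeroForm τ fun ψ => h (ξ ψ) (ξN ψ) ψ :=
    isZeroForm_chargeDensity hf hbsmooth hlam' hQsmooth hl hβ' hξ hξN
  have hA := isSmoothForm_iyerWaldPotential hθ hbsmooth hlam' hQsmooth hξ hφ.1 hVv
  have hfA : IsSmoothForm (pullForm f (iyerWaldPotential τ θ b lam Q ξ φ V)) :=
    SmoothFormFamily.pullForm hf hA
  have hδβ : IsSmoothForm (delta1 τ β φ (hat τ ξ φ) V) := hβ'.isSmoothForm_delta1 hφ.1 hU' hVv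
  have hδh := hh.delta0.isSmoothForm hφ.1 hVv
  have hlie : IsSmoothForm (lieForm (ξN φ) (β φ V) - iForm (ξN φ) (dForm (β φ V))) :=
    (SmoothFormFamily.lieForm (hβ'.isSmoothForm hφ.1 hVv) (hξN.isSmoothVec hφ.1)).sub
      ((SmoothFormFamily.dForm (hβ'.isSmoothForm hφ.1 hVv)).iForm (hξN.isSmoothVec hφ.1))
  have key := pullForm_iyerWaldPotential (Q := Q) (b := b) hf hbsmooth hlam' hQsmooth hl hβ' hξ hξN
    hφ.1 hVv (htan φ hφ.1) (hdec φ hφ V hV)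
  -- Smoothness of the flux density, needed to split the integral, is read off from `key`, in which
  -- every other term is known to be smooth.
  have hflux : IsSmoothForm (fluxDensity τ f lam β ℰ h ξ ξN φ V) := by
    have e : fluxDensity τ f lam β ℰ h ξ ξN φ V =
        delta0 τ (fun ψ => h (ξ ψ) (ξN ψ) ψ) φ V +
          (lieForm (ξN φ) (β φ V) - iForm (ξN φ) (dForm (β φ V))) -
          (pullForm f (iyerWaldPotential τ θ b lam Q ξ φ V) + contr2 τ ξ (delta1 τ β) φ V) := by
      rw [key]
      abel
    rw [e]
    exact (SmoothFormFamily.add hδh hlie).sub (SmoothFormFamily.add hfA hδβ)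
  have hΩ : - Ω φ (hat τ ξ φ) V =
      chainIntegral S (delta0 τ (fun ψ => h (ξ ψ) (ξN ψ) ψ) φ V) - flux := by
    -- Claim 1 on the closure of `U`, then Stokes, then transfer of the boundary integral to the
    -- chain in `N`.
    have h1 : - chainIntegral Sig (delta1 τ θ φ (hat τ ξ φ) V) =
        chainIntegral S (pullForm f (iyerWaldPotential τ θ b lam Q ξ φ V)) := by
      rw [← chainIntegral_neg, ← chainIntegral_map hf, hS, ← hA.chainIntegral_dForm]
      exact chainIntegral_congr (fun x hx => iyerWald_of_mem_closure hLsmooth hθ hL hbsmooth hlam'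
        hQsmooth hlam hQ hξ hφ hV hx) hSig
    have h2 : - Ω φ (hat τ ξ φ) V =
        chainIntegral S (pullForm f (iyerWaldPotential τ θ b lam Q ξ φ V)) +
          chainIntegral S (delta1 τ β φ (hat τ ξ φ) V) := by
      rw [← h1]
      simp only [Ω, symplecticForm]
      ring
    rw [h2, ← hfA.chainIntegral_add hδβ]
    change chainIntegral S (_ + contr2 τ ξ (delta1 τ β) φ V) = _
    rw [key, IsSmoothForm.chainIntegral_add (SmoothFormFamily.sub hδh hflux) hlie,
      hδh.chainIntegral_sub hflux, (hβ'.isSmoothForm hφ.1 hVv).chainIntegral_lieForm hf hinj hS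
        (hξN.isSmoothVec hφ.1), add_zero]
  refine ⟨hΩ, ?_⟩
  rw [hΩ, sub_add_cancel]
  exact hh.vary_chainIntegral hc S
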